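/- For a symmetric $n\times n$ matrix $w$ of nonnegative rational numbers let $H_w=\sum_{1\le i<j\le n}w_{ij}E_{ij}$, where $E_{ij}$ is the projection onto $|\mathrm{EPR}\rangle=\frac{|00\rangle+|11\rangle}{\sqrt2}$ on qubits $i$ and $j$, tensored with the identity on the other qubits, and let $\lambda_{\max}(H_w)$ be the largest eigenvalue of $H_w$. There is a classical (deterministic) algorithm that, given $n$ and $w$ (numerators and denominators in binary), outputs a description of an $n$-qubit mixed state $\rho$ with $$\operatorname{tr}(\rho H_w)\ \ge\ \frac{1+\sqrt5}{4}\,\lambda_{\max}(H_w),$$ and whose running time is at most a fixed polynomial in the bit length of the input. Here a description of a state is an expression built by tensor products (over disjoint sets of qubits) and by probabilistic mixtures with rational weights (over the same set of qubits) from density matrices on listed sets of qubits that are written out entry by entry, the real and imaginary parts of the entries being given exactly by expressions in rational numbers, sums, products and real square roots of nonnegative numbers. Running time is counted on a random access machine with logarithmic cost. Consequently, if $\alpha^*_{\mathrm{EPR}}$ denotes the supremum of all $\alpha\in[0,1]$ for which there is such a polynomial-time algorithm with $\operatorname{tr}(\rho H_w)\ge\alpha\,\lambda_{\max}(H_w)$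 for all $n$ and $w$, then $\alpha^*_{\mathrm{EPR}}\ge\frac{1+\sqrt5}{4}\approx0.809$. -/

import Mathlib

namespace EPR

open scoped ComplexOrder

noncomputable section

/-! ## The EPR Hamiltonian -/

/-- Operators on `n` qubits, as matrices in the computational basis `{0,1}ⁿ`. -/
abbrev Op (n : ℕ) : Type := Matrix (Fin n → Fin 2) (Fin n → Fin 2) ℂ

/-- Amplitudes of the two-qubit state `|EPR⟩ = (|00⟩ + |11⟩) / √2`. -/
def eprVec (a b : Fin 2) : ℂ :=
  if a = b then ((1 / Real.sqrt 2 : ℝ) : ℂ) else 0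

/-- `E_ij` for `i ≠ j`: the projection `|EPR⟩⟨EPR|` on qubits `i` and `j`, tensored with the
identity on all other qubits. -/
def eprProj {n : ℕ} (i j : Fin n) : Op n := fun x y =>
  if ∀ k, k ≠ i → k ≠ j → x k = y k then eprVec (x i) (x j) * star (eprVec (y i) (y j)) else 0

/-- An instance: a number of qubits and a symmetric interaction matrix with nonnegative
(rational) entries. -/
structure Instance where
  n : ℕ
  w : Matrix (Fin n) (Fin n) ℚ≥0
  symm : w.IsSymm

/-- `H = ∑_{i<j} w_ij E_ij`. -/
def Instance.ham (I : Instance) : Op I.n :=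
  ∑ i, ∑ j ∈ Finset.Ioi i, (I.w i j : ℂ) • eprProj i j

/-- The maximum eigenvalue (used for Hermitian matrices only). -/
def lambdaMax {n : ℕ} (H : Op n) : ℝ :=
  sSup {μ : ℝ | Module.End.HasEigenvalue (Matrix.toLin' H) (μ : ℂ)}

/-- Density matrices (mixed states). -/
def IsDensity {ι : Type} [Fintype ι] (ρ : Matrix ι ι ℂ) : Prop :=
  ρ.PosSemidef ∧ ρ.trace = 1

/-- The energy `tr(ρ H)`, which is real for Hermitian `ρ` and `H`. -/
def energy {n : ℕ} (ρ H : Op n) : ℝ := (ρ * H).trace.re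

/-! ## Explicit descriptions of states

Descriptions are built from explicitly written density matrices on a few qubits by tensor
products and by probabilistic mixtures. A block on `m` qubits is written out with its `4 ^ m`
entries, which are complex numbers whose real and imaginary parts are given exactly, as
expressions in rational numbers, sums, products and square roots. -/

/-- Exact real numbers in radicals. -/
inductive Radical : Type
  | rat (q : ℚ)
  | add (a b : Radical)
  | mul (a b : Radical)
  | sqrt (a : Radical)

def Radical.val : Radical → ℝ
  | .rat q => (q : ℝ)
  | .add a b => a.val + b.val
  | .mul a b => a.val * b.val
  | .sqrt a => Real.sqrt a.val

/-- No square root of a negative number is written. -/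
def Radical.Legal : Radical → Prop
  | .rat _ => True
  | .add a b => a.Legal ∧ b.Legal
  | .mul a b => a.Legal ∧ b.Legal
  | .sqrt a => a.Legal ∧ 0 ≤ a.val

/-- Exact complex numbers: real part and imaginary part. -/
abbrev Entry : Type := Radical × Radical

def Entry.val (z : Entry) : ℂ := ⟨Radical.val z.1, Radical.val z.2⟩

/-- Descriptions of states of some of the `n` qubits. -/
inductive StateDesc (n : ℕ) : Type
  /-- An explicit state of the `m` distinct qubits `q 0, …, q (m-1)`. -/
  | block (m : ℕ) (q : Fin m ↪ Fin n) (A : Matrix (Fin m → Fin 2) (Fin m → Fin 2) Entry)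
  /-- The tensor product of states of disjoint sets of qubits. -/
  | tensor (a b : StateDesc n)
  /-- The mixture `p • a + (1 - p) • b` of states of the same set of qubits. -/
  | mix (p : ℚ) (a b : StateDesc n)

namespace StateDesc

variable {n : ℕ}

/-- The set of qubits a description is about. -/
def qubits : StateDesc n → Finset (Fin n)
  | block _ q _ => Finset.univ.map q
  | tensor a b => a.qubits ∪ b.qubits
  | mix _ a _ => a.qubits

/-- The entries of the described density matrix. If `d` is about the set `S` of qubits, then
`d.toOp x y = ⟨x|_S ρ |y⟩_S` depends on the restrictions of `x` and `y` to `S` only; so the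
entries of a tensor product over disjoint sets are the products of the entries of its factors,
and for `S` the set of all qubits `d.toOp` is the density matrix itself. -/
def toOp : StateDesc n → Op n
  | block _ q A => fun x y => Entry.val (A (x ∘ q) (y ∘ q))
  | tensor a b => fun x y => a.toOp x y * b.toOp x y
  | mix p a b => fun x y => (p : ℂ) * a.toOp x y + (1 - (p : ℂ)) * b.toOp x y

/-- The description is meaningful: blocks are density matrices, tensor factors live on disjoint
sets of qubits, mixtures are over states of the same qubits, with a probability as weight. -/
def Valid : StateDesc n → Prop
  | block _ _ A =>
      (∀ x y, (A x y).1.Legal ∧ (A x y).2.Legal) ∧ IsDensity (A.map Entry.val)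
  | tensor a b => a.Valid ∧ b.Valid ∧ Disjoint a.qubits b.qubits
  | mix p a b => a.Valid ∧ b.Valid ∧ a.qubits = b.qubits ∧ 0 ≤ p ∧ p ≤ 1

/-- `d` describes the `n`-qubit state `ρ`. -/
def Describes (d : StateDesc n) (ρ : Op n) : Prop :=
  d.Valid ∧ d.qubits = Finset.univ ∧ d.toOp = ρ ∧ IsDensity ρ

end StateDesc

/-! ## Encodings as sequences of natural numbers -/

/-- `n`, followed by numerator and denominator (in lowest terms) of all `w_ij`, row by row. -/
def Instance.encode (I : Instance) : List ℕ :=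
  I.n :: (List.ofFn fun i => (List.ofFn fun j => [(I.w i j).num, (I.w i j).den]).flatten).flatten

/-- Sign, absolute value of the numerator, and denominator. -/
def encodeRat (q : ℚ) : List ℕ := [if q < 0 then 1 else 0, q.num.natAbs, q.den]

/-- Prefix notation. -/
def Radical.encode : Radical → List ℕ
  | .rat q => 0 :: encodeRat q
  | .add a b => 1 :: (a.encode ++ b.encode)
  | .mul a b => 2 :: (a.encode ++ b.encode)
  | .sqrt a => 3 :: a.encode

def Entry.encode (z : Entry) : List ℕ := Radical.encode z.1 ++ Radical.encode z.2

/-- Prefix notation; of a block, the number of qubits, the list of qubits and all entries of the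
matrix are written, row by row. -/
def StateDesc.encode {n : ℕ} : StateDesc n → List ℕ
  | .block m q A =>
      0 :: m :: (List.ofFn (fun k => (q k : ℕ)) ++
        (List.ofFn fun r : Fin (2 ^ m) => (List.ofFn fun c : Fin (2 ^ m) =>
          Entry.encode (A (finFunctionFinEquiv.symm r) (finFunctionFinEquiv.symm c))).flatten).flatten)
  | .tensor a b => 1 :: (a.encode ++ b.encode)
  | .mix p a b => 2 :: (encodeRat p ++ a.encode ++ b.encode)

/-- The number of bits of a sequence of natural numbers written in binary, with one extra symbol
for each number. -/
def bitLength (l : List ℕ) : ℕ := (l.map fun k => k.size + 1).sum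

/-! ## Random access machines with logarithmic cost

A deterministic RAM with directly addressed registers, an indirectly addressed memory and a
write-only output, programmed with the usual control structures. Every instruction and every test
is charged the bit lengths of the numbers it handles, so that running times are polynomially
related to those of Turing machines. -/

structure RAMState where
  reg : ℕ → ℕ
  mem : ℕ → ℕ
  out : List ℕ

inductive Instr : Type
  | const (d k : ℕ)
  | add (d a b : ℕ)
  | sub (d a b : ℕ)
  | mul (d a b : ℕ)
  | div (d a b : ℕ)
  | load (d a : ℕ)
  | store (a b : ℕ)
  | write (a : ℕ)

def RAMState.setReg (s : RAMState) (d v : ℕ) : RAMState :=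
  { s with reg := Function.update s.reg d v }

/-- Effect of an instruction; subtraction is truncated, division is rounded down. -/
def Instr.exec : Instr → RAMState → RAMState
  | .const d k, s => s.setReg d k
  | .add d a b, s => s.setReg d (s.reg a + s.reg b)
  | .sub d a b, s => s.setReg d (s.reg a - s.reg b)
  | .mul d a b, s => s.setReg d (s.reg a * s.reg b)
  | .div d a b, s => s.setReg d (s.reg a / s.reg b)
  | .load d a, s => s.setReg d (s.mem (s.reg a))
  | .store a b, s => { s with mem := Function.update s.mem (s.reg a) (s.reg b) }
  | .write a, s => { s with out := s.out ++ [s.reg a] }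

/-- Logarithmic cost. -/
def Instr.cost : Instr → RAMState → ℕ
  | .const _ k, _ => 1 + k.size
  | .add _ a b, s => 1 + (s.reg a).size + (s.reg b).size
  | .sub _ a b, s => 1 + (s.reg a).size + (s.reg b).size
  | .mul _ a b, s => 1 + (s.reg a).size + (s.reg b).size
  | .div _ a b, s => 1 + (s.reg a).size + (s.reg b).size
  | .load _ a, s => 1 + (s.reg a).size + (s.mem (s.reg a)).size
  | .store a b, s => 1 + (s.reg a).size + (s.reg b).size
  | .write a, s => 1 + (s.reg a).size

inductive Program : Type
  | instr (i : Instr)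
  | seq (P Q : Program)
  /-- `if reg a < reg b then P else Q` -/
  | ifLt (a b : ℕ) (P Q : Program)
  /-- `while reg a < reg b do P` -/
  | whileLt (a b : ℕ) (P : Program)

/-- Cost of comparing two registers. -/
def testCost (s : RAMState) (a b : ℕ) : ℕ := 1 + (s.reg a).size + (s.reg b).size

/-- `Exec P s s' t`: started in state `s`, the program `P` stops in state `s'` after time `t`. -/
inductive Exec : Program → RAMState → RAMState → ℕ → Prop
  | instr (i : Instr) (s : RAMState) : Exec (.instr i) s (i.exec s) (i.cost s)
  | seq {P Q : Program} {s s' s'' : RAMState} {t t' : ℕ} :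
      Exec P s s' t → Exec Q s' s'' t' → Exec (.seq P Q) s s'' (t + t')
  | ifTrue {a b : ℕ} {P Q : Program} {s s' : RAMState} {t : ℕ} :
      s.reg a < s.reg b → Exec P s s' t → Exec (.ifLt a b P Q) s s' (testCost s a b + t)
  | ifFalse {a b : ℕ} {P Q : Program} {s s' : RAMState} {t : ℕ} :
      ¬ s.reg a < s.reg b → Exec Q s s' t → Exec (.ifLt a b P Q) s s' (testCost s a b + t)
  | whileTrue {a b : ℕ} {P : Program} {s s' s'' : RAMState} {t t' : ℕ} :
      s.reg a < s.reg b → Exec P s s' t → Exec (.whileLt a b P) s' s'' t' →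
        Exec (.whileLt a b P) s s'' (testCost s a b + t + t')
  | whileFalse {a b : ℕ} {P : Program} {s : RAMState} :
      ¬ s.reg a < s.reg b → Exec (.whileLt a b P) s s (testCost s a b)

/-- Start: the input is in the memory, its length is in register `0`, all else is `0`. -/
def initState (input : List ℕ) : RAMState where
  reg := Function.update (fun _ => 0) 0 input.length
  mem := fun k => input.getD k 0
  out := []

/-- On the given input, `P` stops with the given output within time `T`. -/
def Program.OutputsWithin (P : Program) (input output : List ℕ) (T : ℕ) : Prop :=
  ∃ s t, Exec P (initState input) s t ∧ s.out = output ∧ t ≤ T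

/-! ## Approximation algorithms -/

/-- There is a polynomial-time `α`-approximation algorithm for the EPR family: one program and
one polynomial serve all instances. -/
def HasPolyTimeApprox (α : ℝ) : Prop :=
  ∃ (P : Program) (p : Polynomial ℕ), ∀ I : Instance, ∃ (d : StateDesc I.n) (ρ : Op I.n),
    P.OutputsWithin I.encode d.encode (p.eval (bitLength I.encode)) ∧
    d.Describes ρ ∧ α * lambdaMax I.ham ≤ energy ρ I.ham

/-- `α*`: the supremum of the `α ∈ [0, 1]` for which there is such an algorithm. -/
def alphaStar : ℝ := sSup {α : ℝ | α ∈ Set.Icc 0 1 ∧ HasPolyTimeApprox α}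

end

end EPR

/-! Let W be the sum of the weights w_ij with i < j, let M be the maximum over permutations σ of the
sum of w_{iσ(i)} over all i with σ(i) ≠ i, and let r = (1+√5)/4. The proof shows λ_max ≤ B and
produces a state of energy at least r·B, where B = W/2 + M/4.

Upper bound. Projections sharing a qubit satisfy E_ij E_ik E_ij = E_ij/4, which forces k of them at
a common qubit to sum to at most (k+1)/2 (`sum_inner_proj_le`). Hence the excesses max(0, 2⟨E_ij⟩ -
1) of a normalized vector form a fractional matching, and weak duality bounds the energy by W/2 plus
half the value of any fractional vertex cover (`lambdaMax_ham_le`). Averaging the row and column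
variables of an optimal dual solution of the assignment problem gives a cover of value M/2
(`ratio_mul_lambdaMax_le`).

Lower bound. The state is built along the cycles of an optimal σ from small blocks whose qubits all
have Z-bias at least t, where t² = (√5-1)/2. Qubits in different tensor factors then have energy at
least (1+t²)/4 = r/2, and a tilted EPR pair of bias t has energy (1+√(1-t²))/2 = r; the golden ratio
is what makes both equalities hold together. A transposition becomes one tilted pair. On a longer
cycle, a uniform mixture of the rotations of a nearly perfect matching gives every edge at least
3r/4. An odd cycle has no perfect matching, and one three-qubit block makes up for the loss
(`sum_edgeBound`). In all cases a pair receives r/2 plus r/4 for each of σ(i) = j and σ(j) = i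
(`permDesc_spec`), which sums to r·B (`energy_permDesc`).

Algorithm. The Hungarian method on costs cleared of denominators finds σ together with dual
variables that certify its optimality (`Hungarian.setup_solve_spec`), and the description is printed
in prefix notation (`Printer.print_spec`). Both are written in a loop language whose programs
compile to the machine with polynomial time bounds (`Cmd.outputsWithin`). -/

namespace EPR

/-! ### Polynomial-time simulation of a loop language on the random access machine. -/

/-! ## Polynomially bounded runs -/

/-- All registers and memory cells hold numbers of at most `b` bits. -/
def RAMState.Fits (s : RAMState) (b : ℕ) : Prop :=
  (∀ k, (s.reg k).size ≤ b) ∧ ∀ k, (s.mem k).size ≤ b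

/-- The program takes `s` to `s'`, and its weight `N` bounds the number of steps as well as the
growth of the bit lengths. -/
def Runs (P : Program) (s s' : RAMState) (N : ℕ) : Prop :=
  ∀ b, s.Fits b → s'.Fits (b + N) ∧ ∃ t, Exec P s s' t ∧ t ≤ N * (2 * (b + N) + 3)

/-- The number of bits by which an instruction can increase the numbers of a state. -/
def Instr.weight : Instr → RAMState → ℕ
  | .const _ k, _ => 1 + k.size
  | .mul _ _ b, s => 1 + (s.reg b).size
  | _, _ => 1

theorem RAMState.Fits.mono {s : RAMState} {b c : ℕ} (h : s.Fits b) (hbc : b ≤ c) : s.Fits c :=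
  ⟨fun k => (h.1 k).trans hbc, fun k => (h.2 k).trans hbc⟩

theorem RAMState.Fits.setReg {s : RAMState} {b c d v : ℕ} (h : s.Fits b) (hbc : b ≤ c)
    (hv : v.size ≤ c) : (s.setReg d v).Fits c := by
  refine ⟨fun k => ?_, (h.mono hbc).2⟩
  by_cases hk : k = d
  · subst hk; simpa [RAMState.setReg] using hv
  · simpa [RAMState.setReg, hk] using (h.mono hbc).1 k

theorem size_add_le (a b : ℕ) : (a + b).size ≤ max a.size b.size + 1 := by
  rw [Nat.size_le, pow_succ]
  have ha : a < 2 ^ max a.size b.size :=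
    (Nat.lt_size_self a).trans_le (Nat.pow_le_pow_right two_pos (le_max_left _ _))
  have hb : b < 2 ^ max a.size b.size :=
    (Nat.lt_size_self b).trans_le (Nat.pow_le_pow_right two_pos (le_max_right _ _))
  omega

theorem size_mul_le (a b : ℕ) : (a * b).size ≤ a.size + b.size := by
  rw [Nat.size_le, pow_add]
  exact Nat.mul_lt_mul'' (Nat.lt_size_self a) (Nat.lt_size_self b)

theorem Runs.instr (i : Instr) (s : RAMState) : Runs (.instr i) s (i.exec s) (i.weight s) := by
  intro b hb
  have hr := hb.1
  have hm := hb.2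
  refine ⟨?_, i.cost s, Exec.instr i s, ?_⟩
  · cases i with
    | const d k => exact hb.setReg (by simp) (by simp [Instr.weight]; omega)
    | add d x y =>
      refine hb.setReg (by simp) ((size_add_le _ _).trans ?_)
      have := hr x; have := hr y; simp [Instr.weight]; omega
    | sub d x y =>
      refine hb.setReg (by simp) ((Nat.size_le_size (Nat.sub_le _ _)).trans ?_)
      have := hr x; simp [Instr.weight]; omega
    | mul d x y =>
      refine hb.setReg (by simp) ((size_mul_le _ _).trans ?_)
      have := hr x; simp [Instr.weight]; omega
    | div d x y =>
      refine hb.setReg (by simp) ((Nat.size_le_size (Nat.div_le_self _ _)).trans ?_)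
      have := hr x; simp [Instr.weight]; omega
    | load d x => exact hb.setReg (by simp) ((hm _).trans (by simp))
    | store x y =>
      refine ⟨fun k => (hr k).trans (by simp), fun k => ?_⟩
      by_cases hk : k = s.reg x
      · subst hk
        simpa [Instr.exec] using (hr y).trans (by simp)
      · simpa [Instr.exec, hk] using (hm k).trans (by simp)
    | write x => exact ⟨fun k => (hr k).trans (by simp), fun k => (hm k).trans (by simp)⟩
  · cases i with
    | const d k =>
      simp only [Instr.cost, Instr.weight]
      exact Nat.le_mul_of_pos_right _ (by omega)
    | add d x y => have := hr x; have := hr y; simp only [Instr.cost, Instr.weight]; omega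
    | sub d x y => have := hr x; have := hr y; simp only [Instr.cost, Instr.weight]; omega
    | mul d x y =>
      have := hr x; have := hr y; simp only [Instr.cost, Instr.weight]
      nlinarith [Nat.zero_le ((s.reg y).size)]
    | div d x y => have := hr x; have := hr y; simp only [Instr.cost, Instr.weight]; omega
    | load d x =>
      have := hr x; have := hm (s.reg x); simp only [Instr.cost, Instr.weight]; omega
    | store x y => have := hr x; have := hr y; simp only [Instr.cost, Instr.weight]; omega
    | write x => have := hr x; simp only [Instr.cost, Instr.weight]; omega

theorem Runs.mono {P : Program} {s s' : RAMState} {N N' : ℕ} (h : Runs P s s' N) (hN : N ≤ N') :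
    Runs P s s' N' := by
  intro b hb
  obtain ⟨h1, t, h2, h3⟩ := h b hb
  exact ⟨h1.mono (by omega), t, h2, h3.trans (by gcongr)⟩

theorem Runs.seq {P Q : Program} {s s' s'' : RAMState} {N N' : ℕ} (h : Runs P s s' N)
    (h' : Runs Q s' s'' N') : Runs (.seq P Q) s s'' (N + N') := by
  intro b hb
  obtain ⟨h1, t, h2, h3⟩ := h b hb
  obtain ⟨h1', t', h2', h3'⟩ := h' _ h1
  refine ⟨by rwa [← add_assoc], t + t', h2.seq h2', (add_le_add h3 h3').trans ?_⟩
  rw [add_mul, ← add_assoc]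
  exact Nat.add_le_add_right (Nat.mul_le_mul_left _ (by omega)) _

theorem Runs.ifTrue {a b : ℕ} {P Q : Program} {s s' : RAMState} {N : ℕ}
    (hab : s.reg a < s.reg b) (h : Runs P s s' N) : Runs (.ifLt a b P Q) s s' (N + 1) := by
  intro c hc
  obtain ⟨h1, t, h2, h3⟩ := h c hc
  refine ⟨h1.mono (by omega), _, Exec.ifTrue hab h2, ?_⟩
  have := hc.1 a; have := hc.1 b
  unfold testCost
  nlinarith

theorem Runs.ifFalse {a b : ℕ} {P Q : Program} {s s' : RAMState} {N : ℕ}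
    (hab : ¬ s.reg a < s.reg b) (h : Runs Q s s' N) : Runs (.ifLt a b P Q) s s' (N + 1) := by
  intro c hc
  obtain ⟨h1, t, h2, h3⟩ := h c hc
  refine ⟨h1.mono (by omega), _, Exec.ifFalse hab h2, ?_⟩
  have := hc.1 a; have := hc.1 b
  unfold testCost
  nlinarith

theorem Runs.whileFalse {a b : ℕ} {P : Program} {s : RAMState} (hab : ¬ s.reg a < s.reg b) :
    Runs (.whileLt a b P) s s 1 := by
  intro c hc
  refine ⟨hc.mono (by omega), _, Exec.whileFalse hab, ?_⟩
  have := hc.1 a; have := hc.1 b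
  unfold testCost
  omega

theorem Runs.whileTrue {a b : ℕ} {P : Program} {s s' s'' : RAMState} {N N' : ℕ}
    (hab : s.reg a < s.reg b) (h : Runs P s s' N) (h' : Runs (.whileLt a b P) s' s'' N') :
    Runs (.whileLt a b P) s s'' (N + N' + 1) := by
  intro c hc
  obtain ⟨h1, t, h2, h3⟩ := h c hc
  obtain ⟨h1', t', h2', h3'⟩ := h' _ h1
  refine ⟨h1'.mono (by omega), _, Exec.whileTrue hab h2 h2', ?_⟩
  have := hc.1 a; have := hc.1 b
  unfold testCost
  have e1 : N * (2 * (c + N) + 3) ≤ N * (2 * (c + (N + N' + 1)) + 3) := by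
    exact Nat.mul_le_mul_left _ (by omega)
  have e2 : N' * (2 * (c + N + N') + 3) ≤ N' * (2 * (c + (N + N' + 1)) + 3) := by
    exact Nat.mul_le_mul_left _ (by omega)
  nlinarith

/-! ## A small imperative language

Programs work on scalar variables and sixteen arrays; the input is read-only. The only loops are
`for x < n`, where `n` is the first number of the input. -/

structure Store where
  var : ℕ → ℕ
  arr : Fin 16 → ℕ → ℕ
  out : List ℕ

/-- Products need an input number as one factor. A multiplication therefore adds at most the bit
length of the input to the size of a number, and polynomially many steps keep all numbers
polynomially long; repeated squaring in a loop would not. -/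
inductive Expr : Type
  | const (k : ℕ)
  | var (x : ℕ)
  | inp (e : Expr)
  | get (A : Fin 16) (e : Expr)
  | add (a b : Expr)
  | sub (a b : Expr)
  | div (a b : Expr)
  /-- `a` times the input number at position `e` -/
  | mulInp (a e : Expr)

def Expr.eval (inp : List ℕ) (h : Store) : Expr → ℕ
  | .const k => k
  | .var x => h.var x
  | .inp e => inp.getD (e.eval inp h) 0
  | .get A e => h.arr A (e.eval inp h)
  | .add a b => a.eval inp h + b.eval inp h
  | .sub a b => a.eval inp h - b.eval inp h
  | .div a b => a.eval inp h / b.eval inp h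
  | .mulInp a e => a.eval inp h * inp.getD (e.eval inp h) 0

inductive Cmd : Type
  | skip
  | set (x : ℕ) (e : Expr)
  | put (A : Fin 16) (i e : Expr)
  | write (e : Expr)
  | seq (c c' : Cmd)
  /-- `if a < b then c else c'` -/
  | ifLt (a b : Expr) (c c' : Cmd)
  /-- `for x < n do c`, where `n` is the first input number -/
  | forN (x : ℕ) (c : Cmd)

def Store.setVar (h : Store) (x v : ℕ) : Store := { h with var := Function.update h.var x v }

def Store.setArr (h : Store) (A : Fin 16) (i v : ℕ) : Store :=
  { h with arr := Function.update h.arr A (Function.update (h.arr A) i v) }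

def loop {α : Type} (f : ℕ → α → α) : ℕ → α → α
  | 0, a => a
  | k + 1, a => f k (loop f k a)

def Cmd.eval (inp : List ℕ) : Cmd → Store → Store
  | .skip, h => h
  | .set x e, h => h.setVar x (e.eval inp h)
  | .put A i e, h => h.setArr A (i.eval inp h) (e.eval inp h)
  | .write e, h => { h with out := h.out ++ [e.eval inp h] }
  | .seq c c', h => c'.eval inp (c.eval inp h)
  | .ifLt a b c c', h => if a.eval inp h < b.eval inp h then c.eval inp h else c'.eval inp h
  | .forN x c, h => loop (fun i h => c.eval inp (h.setVar x i)) (inp.getD 0 0) h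

/-! ## Compilation

Variable `x` lives in register `2x+1`, the temporaries in the even registers from `2` on. Cell `i`
of array `A` is stored `16i+A` places after the input. -/

infixr:60 " ;; " => Program.seq

/-- The value ends up in temporary `t`; a second operand is evaluated from `t + 1` on, so that the
first one survives. -/
def Expr.compile (t : ℕ) : Expr → Program
  | .const k => .instr (.const (2 * t + 2) k)
  | .var x => .instr (.const (2 * t + 2) 0) ;; .instr (.add (2 * t + 2) (2 * x + 1) (2 * t + 2))
  | .inp e => e.compile t ;;
      .ifLt (2 * t + 2) 0 (.instr (.load (2 * t + 2) (2 * t + 2))) (.instr (.const (2 * t + 2) 0))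
  | .get A e => e.compile t ;; .instr (.const (2 * t + 4) 16) ;;
      .instr (.mul (2 * t + 2) (2 * t + 2) (2 * t + 4)) ;; .instr (.const (2 * t + 4) A) ;;
      .instr (.add (2 * t + 2) (2 * t + 2) (2 * t + 4)) ;;
      .instr (.add (2 * t + 2) 0 (2 * t + 2)) ;;
      .instr (.load (2 * t + 2) (2 * t + 2))
  | .add a b => a.compile t ;; b.compile (t + 1) ;;
      .instr (.add (2 * t + 2) (2 * t + 2) (2 * t + 4))
  | .sub a b => a.compile t ;; b.compile (t + 1) ;;
      .instr (.sub (2 * t + 2) (2 * t + 2) (2 * t + 4))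
  | .div a b => a.compile t ;; b.compile (t + 1) ;;
      .instr (.div (2 * t + 2) (2 * t + 2) (2 * t + 4))
  | .mulInp a e => a.compile t ;; (e.compile (t + 1) ;;
      .ifLt (2 * t + 4) 0 (.instr (.load (2 * t + 4) (2 * t + 4)))
        (.instr (.const (2 * t + 4) 0))) ;;
      .instr (.mul (2 * t + 2) (2 * t + 2) (2 * t + 4))

open Polynomial in
/-- Weight of the evaluation of an expression, in terms of the bit length of the input. -/
noncomputable def Expr.weight : Expr → ℕ[X]
  | .const k => 1 + (k.size : ℕ[X])
  | .var _ => 2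
  | .inp e => e.weight + 2
  | .get A e => e.weight + (16 + ((A : ℕ).size : ℕ[X]))
  | .add a b => a.weight + b.weight + 1
  | .sub a b => a.weight + b.weight + 1
  | .div a b => a.weight + b.weight + 1
  | .mulInp a e => a.weight + e.weight + (3 + X)

structure Represents (inp : List ℕ) (h : Store) (s : RAMState) : Prop where
  len : s.reg 0 = inp.length
  var : ∀ x, s.reg (2 * x + 1) = h.var x
  mem_inp : ∀ k < inp.length, s.mem k = inp.getD k 0
  arr : ∀ (A : Fin 16) i, s.mem (inp.length + (i * 16 + A)) = h.arr A i
  out : s.out = h.out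

/-- `s'` differs from `s` in temporaries from `t` on only. -/
structure SameUpTo (t : ℕ) (s s' : RAMState) : Prop where
  reg : ∀ r, r % 2 = 1 ∨ r < 2 * t + 2 → s'.reg r = s.reg r
  mem : s'.mem = s.mem
  out : s'.out = s.out

theorem SameUpTo.refl (t : ℕ) (s : RAMState) : SameUpTo t s s := ⟨fun _ _ => rfl, rfl, rfl⟩

theorem SameUpTo.trans {t : ℕ} {s s' s'' : RAMState} (h : SameUpTo t s s')
    (h' : SameUpTo t s' s'') : SameUpTo t s s'' :=
  ⟨fun r hr => (h'.reg r hr).trans (h.reg r hr), h'.mem.trans h.mem, h'.out.trans h.out⟩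

theorem SameUpTo.mono {t t' : ℕ} {s s' : RAMState} (h : SameUpTo t s s') (ht : t' ≤ t) :
    SameUpTo t' s s' :=
  ⟨fun r hr => h.reg r (by omega), h.mem, h.out⟩

theorem SameUpTo.setReg {t d : ℕ} {s s' : RAMState} (h : SameUpTo t s s') (v : ℕ) (hd : d % 2 = 0)
    (htd : 2 * t + 2 ≤ d) : SameUpTo t s (s'.setReg d v) := by
  refine ⟨fun r hr => ?_, h.mem, h.out⟩
  have : r ≠ d := by omega
  simpa [RAMState.setReg, this] using h.reg r hr

theorem Represents.of_sameUpTo {inp : List ℕ} {h : Store} {s s' : RAMState} {t : ℕ}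
    (hs : Represents inp h s) (hss : SameUpTo t s s') : Represents inp h s' where
  len := by rw [hss.reg 0 (by omega), hs.len]
  var x := by rw [hss.reg _ (by omega), hs.var]
  mem_inp k hk := by rw [hss.mem, hs.mem_inp k hk]
  arr A i := by rw [hss.mem, hs.arr]
  out := by rw [hss.out, hs.out]

@[simp] theorem RAMState.setReg_reg_self (s : RAMState) (d v : ℕ) :
    (s.setReg d v).reg d = v := by
  simp [RAMState.setReg]

theorem RAMState.setReg_reg_ne (s : RAMState) {d r : ℕ} (v : ℕ) (h : r ≠ d) :
    (s.setReg d v).reg r = s.reg r := by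
  simp [RAMState.setReg, h]

theorem runs_binary {P Q : Program} {s s' s'' : RAMState}
    {t N N' w v v' : ℕ} {i : Instr} {f : ℕ → ℕ → ℕ}
    (hP : Runs P s s' N) (hv : s'.reg (2 * t + 2) = v) (hs : SameUpTo t s s')
    (hQ : Runs Q s' s'' N') (hv' : s''.reg (2 * t + 4) = v') (hs' : SameUpTo (t + 1) s' s'')
    (hi : i.exec s'' = s''.setReg (2 * t + 2) (f (s''.reg (2 * t + 2)) (s''.reg (2 * t + 4))))
    (hw : i.weight s'' ≤ w) :
    ∃ s₁, Runs (P ;; Q ;; .instr i) s s₁ (N + N' + w) ∧ s₁.reg (2 * t + 2) = f v v' ∧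
      SameUpTo t s s₁ := by
  refine ⟨_, (hP.seq (hQ.seq ((Runs.instr i s'').mono hw))).mono (by omega), ?_, ?_⟩
  · rw [hi, RAMState.setReg_reg_self, hv', hs'.reg _ (by omega), hv]
  · rw [hi]
    exact (hs.trans (hs'.mono (by omega))).setReg _ (by omega) (by omega)

/-- The comparison with register `0`, the input length, is needed because the cells behind the input
hold the arrays, while reading past the end of the input has to give `0`. -/
theorem runs_inp {inp : List ℕ} {h : Store} {P : Program} {s s' : RAMState} {t N v : ℕ}
    (hr : Represents inp h s) (hP : Runs P s s' N) (hv : s'.reg (2 * t + 2) = v)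
    (hs : SameUpTo t s s') :
    ∃ s₁, Runs (P ;; .ifLt (2 * t + 2) 0 (.instr (.load (2 * t + 2) (2 * t + 2)))
        (.instr (.const (2 * t + 2) 0))) s s₁ (N + 2) ∧
      s₁.reg (2 * t + 2) = inp.getD v 0 ∧ SameUpTo t s s₁ := by
  have hr' := hr.of_sameUpTo hs
  by_cases hlt : v < inp.length
  · refine ⟨_, (hP.seq (Runs.ifTrue (by rw [hv, hr'.len]; exact hlt) (Runs.instr _ s'))).mono
      (by simp [Instr.weight]), ?_, ?_⟩
    · simp [Instr.exec, hv, hr'.mem_inp v hlt]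
    · exact hs.setReg _ (by omega) (by omega)
  · refine ⟨_, (hP.seq (Runs.ifFalse (by rw [hv, hr'.len]; exact hlt) (Runs.instr _ s'))).mono
      (by simp [Instr.weight]), ?_, ?_⟩
    · rw [List.getD_eq_default _ _ (not_lt.1 hlt)]; simp [Instr.exec]
    · exact hs.setReg _ (by omega) (by omega)

/-- The address of cell `i` of the array `A` is computed in temporary `t`. -/
theorem runs_address {inp : List ℕ} {h : Store} {P : Program} {s s' : RAMState} {t N v : ℕ}
    (A : Fin 16) (hr : Represents inp h s) (hP : Runs P s s' N) (hv : s'.reg (2 * t + 2) = v)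
    (hs : SameUpTo t s s') :
    ∃ s₁, (∀ Q s₂ M, Runs Q s₁ s₂ M →
        Runs (P ;; .instr (.const (2 * t + 4) 16) ;;
          .instr (.mul (2 * t + 2) (2 * t + 2) (2 * t + 4)) ;; .instr (.const (2 * t + 4) A) ;;
          .instr (.add (2 * t + 2) (2 * t + 2) (2 * t + 4)) ;;
          .instr (.add (2 * t + 2) 0 (2 * t + 2)) ;; Q) s s₂
            (N + (15 + (A : ℕ).size) + M)) ∧
      s₁.reg (2 * t + 2) = inp.length + (v * 16 + A) ∧ SameUpTo t s s₁ := by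
  have hr' := hr.of_sameUpTo hs
  have h16 : Nat.size 16 = 5 := by decide
  refine ⟨_, fun Q s₂ M hQ => (hP.seq ((Runs.instr _ _).seq ((Runs.instr _ _).seq
    ((Runs.instr _ _).seq ((Runs.instr _ _).seq ((Runs.instr _ _).seq hQ)))))).mono ?_, ?_, ?_⟩
  · simp [Instr.weight, Instr.exec, h16]
    omega
  · simp [Instr.exec, RAMState.setReg_reg_ne, hr'.len, hv]
  · simp only [Instr.exec]
    refine SameUpTo.setReg ?_ _ (by omega) (by omega)
    refine SameUpTo.setReg ?_ _ (by omega) (by omega)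
    refine SameUpTo.setReg ?_ _ (by omega) (by omega)
    refine SameUpTo.setReg ?_ _ (by omega) (by omega)
    exact SameUpTo.setReg hs _ (by omega) (by omega)

theorem Expr.compile_spec {inp : List ℕ} {m : ℕ} (hm : ∀ v ∈ inp, v.size ≤ m) {h : Store}
    (e : Expr) (t : ℕ) {s : RAMState} (hs : Represents inp h s) :
    ∃ s', Runs (e.compile t) s s' (e.weight.eval m) ∧ s'.reg (2 * t + 2) = e.eval inp h ∧
      SameUpTo t s s' := by
  have hm' : ∀ k, (inp.getD k 0).size ≤ m := by
    intro k
    by_cases hk : k < inp.length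
    · rw [List.getD_eq_getElem _ _ hk]
      exact hm _ (List.getElem_mem hk)
    · rw [List.getD_eq_default _ _ (not_lt.1 hk)]
      simp
  induction e generalizing t s with
  | const k =>
    refine ⟨_, (Runs.instr _ s).mono (by simp [Expr.weight, Instr.weight]), ?_, ?_⟩
    · simp [Instr.exec, Expr.eval]
    · exact (SameUpTo.refl t s).setReg _ (by omega) (by omega)
  | var x =>
    refine ⟨_, ((Runs.instr _ s).seq (Runs.instr _ _)).mono
      (by simp [Expr.weight, Instr.weight]), ?_, ?_⟩
    · have : 2 * x + 1 ≠ 2 * t + 2 := by omega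
      simp only [Instr.exec, Expr.eval, RAMState.setReg_reg_self]
      rw [RAMState.setReg_reg_ne _ _ this, hs.var, add_zero]
    · exact ((SameUpTo.refl t s).setReg _ (by omega) (by omega)).setReg _ (by omega) (by omega)
  | inp e ih =>
    obtain ⟨s', h1, h2, h3⟩ := ih t hs
    obtain ⟨s₁, h4, h5, h6⟩ := runs_inp hs h1 h2 h3
    exact ⟨s₁, h4.mono (by simp [Expr.weight]), h5, h6⟩
  | get A e ih =>
    obtain ⟨s', h1, h2, h3⟩ := ih t hs
    obtain ⟨s₁, h4, h5, h6⟩ := runs_address A hs h1 h2 h3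
    have hs₁ := hs.of_sameUpTo h6
    refine ⟨_, (h4 _ _ _ (Runs.instr _ s₁)).mono (by simp [Expr.weight, Instr.weight]),
      ?_, ?_⟩
    · simp [Instr.exec, h5, hs₁.arr, Expr.eval]
    · exact h6.setReg _ (by omega) (by omega)
  | add a b iha ihb =>
    obtain ⟨s', h1, h2, h3⟩ := iha t hs
    obtain ⟨s'', h4, h5, h6⟩ := ihb (t + 1) (hs.of_sameUpTo h3)
    obtain ⟨s₁, h7, h8, h9⟩ := runs_binary (w := 1) (f := fun x y => x + y)
      (i := .add (2 * t + 2) (2 * t + 2) (2 * t + 4)) h1 h2 h3 h4 h5 h6 rfl le_rfl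
    exact ⟨s₁, h7.mono (by simp [Expr.weight]), h8, h9⟩
  | sub a b iha ihb =>
    obtain ⟨s', h1, h2, h3⟩ := iha t hs
    obtain ⟨s'', h4, h5, h6⟩ := ihb (t + 1) (hs.of_sameUpTo h3)
    obtain ⟨s₁, h7, h8, h9⟩ := runs_binary (w := 1) (f := fun x y => x - y)
      (i := .sub (2 * t + 2) (2 * t + 2) (2 * t + 4)) h1 h2 h3 h4 h5 h6 rfl le_rfl
    exact ⟨s₁, h7.mono (by simp [Expr.weight]), h8, h9⟩
  | div a b iha ihb =>
    obtain ⟨s', h1, h2, h3⟩ := iha t hs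
    obtain ⟨s'', h4, h5, h6⟩ := ihb (t + 1) (hs.of_sameUpTo h3)
    obtain ⟨s₁, h7, h8, h9⟩ := runs_binary (w := 1) (f := fun x y => x / y)
      (i := .div (2 * t + 2) (2 * t + 2) (2 * t + 4)) h1 h2 h3 h4 h5 h6 rfl le_rfl
    exact ⟨s₁, h7.mono (by simp [Expr.weight]), h8, h9⟩
  | mulInp a e iha ihe =>
    obtain ⟨s', h1, h2, h3⟩ := iha t hs
    have hs' := hs.of_sameUpTo h3
    obtain ⟨s'', h4, h5, h6⟩ := ihe (t + 1) hs'
    obtain ⟨s₂, h7, h8, h9⟩ := runs_inp hs' h4 h5 h6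
    obtain ⟨s₁, h10, h11, h12⟩ := runs_binary (w := 1 + m) (f := fun x y => x * y)
      (i := .mul (2 * t + 2) (2 * t + 2) (2 * t + 4)) h1 h2 h3 h7 h8 h9 rfl
      (by
        have := hm' (e.eval inp h)
        simp only [Instr.weight]
        rw [show 2 * t + 4 = 2 * (t + 1) + 2 by ring, h8]
        omega)
    exact ⟨s₁, h10.mono (by simp [Expr.weight]; omega), h11, h12⟩

/-- A loop keeps its bound in temporary `t` and its counter in `t + 1`, and its body uses
temporaries from `t + 2` on. The loop variable is only a copy of the counter, so the number of
rounds does not depend on what the body assigns. -/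
def Cmd.compile (t : ℕ) : Cmd → Program
  | .skip => .instr (.const (2 * t + 2) 0)
  | .set x e => e.compile t ;; .instr (.const (2 * x + 1) 0) ;;
      .instr (.add (2 * x + 1) (2 * x + 1) (2 * t + 2))
  | .put A i e => e.compile t ;; (i.compile (t + 1) ;; .instr (.const (2 * (t + 1) + 4) 16) ;;
      .instr (.mul (2 * (t + 1) + 2) (2 * (t + 1) + 2) (2 * (t + 1) + 4)) ;;
      .instr (.const (2 * (t + 1) + 4) A) ;;
      .instr (.add (2 * (t + 1) + 2) (2 * (t + 1) + 2) (2 * (t + 1) + 4)) ;;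
      .instr (.add (2 * (t + 1) + 2) 0 (2 * (t + 1) + 2)) ;;
      .instr (.store (2 * (t + 1) + 2) (2 * t + 2)))
  | .write e => e.compile t ;; .instr (.write (2 * t + 2))
  | .seq c c' => c.compile t ;; c'.compile t
  | .ifLt a b c c' => a.compile t ;; b.compile (t + 1) ;;
      .ifLt (2 * t + 2) (2 * t + 4) (c.compile t) (c'.compile t)
  | .forN x c => (Expr.inp (.const 0)).compile t ;; .instr (.const (2 * t + 4) 0) ;;
      .whileLt (2 * t + 4) (2 * t + 2)
        (.instr (.const (2 * x + 1) 0) ;;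
          .instr (.add (2 * x + 1) (2 * x + 1) (2 * t + 4)) ;;
          c.compile (t + 2) ;; .instr (.const (2 * t + 6) 1) ;;
          .instr (.add (2 * t + 4) (2 * t + 4) (2 * t + 6)))

open Polynomial in
noncomputable def Cmd.weight : Cmd → ℕ[X]
  | .skip => 1
  | .set _ e => e.weight + 2
  | .put A i e => e.weight + i.weight + (16 + ((A : ℕ).size : ℕ[X]))
  | .write e => e.weight + 1
  | .seq c c' => c.weight + c'.weight
  | .ifLt a b c c' => a.weight + b.weight + (c.weight + c'.weight) + 1
  -- The indeterminate stands for the bit length of the input, which also bounds the number of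
  -- rounds.
  | .forN _ c => X * (c.weight + 6) + 5

theorem Represents.setVar {inp : List ℕ} {h : Store} {s : RAMState} (hs : Represents inp h s)
    (x v : ℕ) : Represents inp (h.setVar x v) (s.setReg (2 * x + 1) v) where
  len := by rw [RAMState.setReg_reg_ne _ _ (by omega), hs.len]
  var y := by
    by_cases hy : y = x
    · subst hy; simp [Store.setVar]
    · rw [RAMState.setReg_reg_ne _ _ (by omega), hs.var]
      simp [Store.setVar, hy]
  mem_inp := hs.mem_inp
  arr := hs.arr
  out := hs.out

theorem Represents.setReg_temp {inp : List ℕ} {h : Store} {s : RAMState} (hs : Represents inp h s)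
    (t v : ℕ) : Represents inp h (s.setReg (2 * t + 2) v) :=
  hs.of_sameUpTo ((SameUpTo.refl 0 s).setReg v (by omega) (by omega))

/-- The last clause, that lower temporaries are preserved, protects the counters of enclosing loops
in the induction. -/
theorem Cmd.compile_spec {inp : List ℕ} {m : ℕ} (hm : ∀ v ∈ inp, v.size ≤ m)
    (hn : inp.getD 0 0 ≤ m) (c : Cmd) (t : ℕ) {h : Store} {s : RAMState}
    (hs : Represents inp h s) :
    ∃ s', Runs (c.compile t) s s' (c.weight.eval m) ∧ Represents inp (c.eval inp h) s' ∧
      ∀ r, r % 2 = 0 → r < 2 * t + 2 → s'.reg r = s.reg r := by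
  induction c generalizing t h s with
  | skip =>
    refine ⟨_, (Runs.instr _ s).mono (by simp [Cmd.weight, Instr.weight]), hs.setReg_temp t 0, ?_⟩
    intro r _ hr
    exact RAMState.setReg_reg_ne _ _ (by omega)
  | set x e =>
    obtain ⟨s', h1, h2, h3⟩ := e.compile_spec hm t hs
    refine ⟨_, (h1.seq ((Runs.instr _ _).seq (Runs.instr _ _))).mono
      (by simp [Cmd.weight, Instr.weight]), ?_, ?_⟩
    · have h4 : 2 * t + 2 ≠ 2 * x + 1 := by omega
      have h5 := ((hs.of_sameUpTo h3).setVar x 0).setVar x (e.eval inp h)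
      convert h5 using 1
      · simp [Cmd.eval, Store.setVar]
      · simp [Instr.exec, RAMState.setReg_reg_ne, h4, h2]
    · intro r _ hr
      simp only [Instr.exec]
      rw [RAMState.setReg_reg_ne _ _ (by omega), RAMState.setReg_reg_ne _ _ (by omega),
        h3.reg r (by omega)]
  | put A i e =>
    obtain ⟨s', h1, h2, h3⟩ := e.compile_spec hm t hs
    have hs' := hs.of_sameUpTo h3
    obtain ⟨s'', h4, h5, h6⟩ := i.compile_spec hm (t + 1) hs'
    obtain ⟨s₁, h7, h8, h9⟩ := runs_address A hs' h4 h5 h6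
    have hs₁ := hs'.of_sameUpTo h9
    have h10 : s₁.reg (2 * t + 2) = e.eval inp h := by rw [h9.reg _ (by omega), h2]
    refine ⟨_, (h1.seq (h7 _ _ _ (Runs.instr _ s₁))).mono
      (by simp [Cmd.weight, Instr.weight]; omega), ?_, ?_⟩
    · simp only [Instr.exec, h8, h10, Cmd.eval]
      refine ⟨hs₁.len, hs₁.var, fun k hk => ?_, fun B j => ?_, hs₁.out⟩
      · simp only
        rw [Function.update_of_ne (by omega), hs₁.mem_inp k hk]
      · have hA := A.2
        have hB := B.2
        simp only [Store.setArr]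
        by_cases hBA : B = A
        · subst hBA
          by_cases hj : j = i.eval inp h
          · subst hj; simp
          · rw [Function.update_of_ne (by omega), hs₁.arr]
            simp [hj]
        · have : (B : ℕ) ≠ A := fun h => hBA (Fin.ext h)
          rw [Function.update_of_ne (by omega), hs₁.arr]
          simp [hBA]
    · intro r _ hr
      simp only [Instr.exec]
      rw [h9.reg r (by omega), h3.reg r (by omega)]
  | write e =>
    obtain ⟨s', h1, h2, h3⟩ := e.compile_spec hm t hs
    have hs' := hs.of_sameUpTo h3
    refine ⟨_, (h1.seq (Runs.instr _ _)).mono (by simp [Cmd.weight, Instr.weight]), ?_, ?_⟩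
    · exact ⟨hs'.len, hs'.var, hs'.mem_inp, hs'.arr, by simp [Instr.exec, Cmd.eval, h2, hs'.out]⟩
    · intro r _ hr
      exact h3.reg r (by omega)
  | seq c c' ih ih' =>
    obtain ⟨s', h1, h2, h3⟩ := ih t hs
    obtain ⟨s'', h4, h5, h6⟩ := ih' t h2
    exact ⟨s'', (h1.seq h4).mono (by simp [Cmd.weight]), h5,
      fun r h hr => (h6 r h hr).trans (h3 r h hr)⟩
  | ifLt a b c c' ih ih' =>
    obtain ⟨s', h1, h2, h3⟩ := a.compile_spec hm t hs
    have hs' := hs.of_sameUpTo h3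
    obtain ⟨s'', h4, h5, h6⟩ := b.compile_spec hm (t + 1) hs'
    have hs'' := hs'.of_sameUpTo h6
    have h7 : s''.reg (2 * t + 2) = a.eval inp h := by rw [h6.reg _ (by omega), h2]
    by_cases hab : a.eval inp h < b.eval inp h
    · obtain ⟨s₁, h8, h9, h10⟩ := ih t hs''
      refine ⟨s₁, (h1.seq (h4.seq (Runs.ifTrue (by rw [h7]; exact hab.trans_eq h5.symm) h8))).mono
        (by simp [Cmd.weight]; omega), by simpa [Cmd.eval, hab] using h9, fun r h hr => ?_⟩
      rw [h10 r h hr, h6.reg r (by omega), h3.reg r (by omega)]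
    · obtain ⟨s₁, h8, h9, h10⟩ := ih' t hs''
      refine ⟨s₁, (h1.seq (h4.seq (Runs.ifFalse (fun hc => hab ?_) h8))).mono
        (by simp [Cmd.weight]; omega), by simpa [Cmd.eval, hab] using h9, fun r h hr => ?_⟩
      · rw [h7] at hc; exact hc.trans_eq h5
      · rw [h10 r h hr, h6.reg r (by omega), h3.reg r (by omega)]
  | forN x c ih =>
    obtain ⟨s', h1, h2, h3⟩ := (Expr.inp (.const 0)).compile_spec hm t hs
    have hs' := hs.of_sameUpTo h3
    -- Induction on the number `j` of rounds still to be run, after `i` rounds.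
    have key : ∀ j i, i + j = inp.getD 0 0 → ∀ s : RAMState,
        Represents inp (loop (fun i h => c.eval inp (h.setVar x i)) i h) s →
        s.reg (2 * t + 4) = i → s.reg (2 * t + 2) = inp.getD 0 0 →
        ∃ s', Runs (.whileLt (2 * t + 4) (2 * t + 2)
          (.instr (.const (2 * x + 1) 0) ;;
            .instr (.add (2 * x + 1) (2 * x + 1) (2 * t + 4)) ;;
            c.compile (t + 2) ;; .instr (.const (2 * t + 6) 1) ;;
            .instr (.add (2 * t + 4) (2 * t + 4) (2 * t + 6)))) s s'
            (j * (c.weight.eval m + 6) + 1) ∧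
          Represents inp (loop (fun i h => c.eval inp (h.setVar x i)) (i + j) h) s' ∧
          ∀ r, r % 2 = 0 → r < 2 * t + 2 → s'.reg r = s.reg r := by
      intro j
      induction j with
      | zero =>
        intro i hi s hr hc hb
        exact ⟨s, (Runs.whileFalse (by omega)).mono (by omega), hr, fun r _ _ => rfl⟩
      | succ j ihj =>
        intro i hi s hr hc hb
        have hne : 2 * t + 4 ≠ 2 * x + 1 := by omega
        have hr1 := (hr.setVar x 0).setVar x i
        rw [show ((loop (fun i h => c.eval inp (h.setVar x i)) i h).setVar x 0).setVar x i =
          (loop (fun i h => c.eval inp (h.setVar x i)) i h).setVar x i by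
            simp [Store.setVar]] at hr1
        obtain ⟨s₁, h8, h9, h10⟩ := ih (t + 2) hr1
        have hr2 := (h9.setReg_temp (t + 2) 1).setReg_temp (t + 1) (i + 1)
        have h11 : s₁.reg (2 * t + 4) = i := by
          rw [h10 _ (by omega) (by omega), RAMState.setReg_reg_ne _ _ (by omega),
            RAMState.setReg_reg_ne _ _ (by omega), hc]
        have h12 : s₁.reg (2 * t + 2) = inp.getD 0 0 := by
          rw [h10 _ (by omega) (by omega), RAMState.setReg_reg_ne _ _ (by omega),
            RAMState.setReg_reg_ne _ _ (by omega), hb]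
        have hne6 : 2 * t + 4 ≠ 2 * t + 6 := by omega
        have hne7 : 2 * t + 2 ≠ 2 * t + 6 := by omega
        obtain ⟨s₂, h13, h14, h15⟩ := ihj (i + 1) (by omega) _ hr2
          (by rw [show 2 * t + 4 = 2 * (t + 1) + 2 by ring]; simp)
          (by
            rw [RAMState.setReg_reg_ne _ _ (by omega), RAMState.setReg_reg_ne _ _ (by omega), h12])
        refine ⟨s₂, ?_, by rwa [show i + (j + 1) = i + 1 + j by ring], ?_⟩
        · have hbody := (Runs.instr (.const (2 * x + 1) 0) s).seq
            ((Runs.instr (.add (2 * x + 1) (2 * x + 1) (2 * t + 4)) _).seq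
            ((show Runs (c.compile (t + 2)) _ s₁ (c.weight.eval m) by
              convert h8 using 1
              simp [Instr.exec, hc, RAMState.setReg_reg_ne, hne]).seq
            ((Runs.instr (.const (2 * t + 6) 1) s₁).seq
              (Runs.instr (.add (2 * t + 4) (2 * t + 4) (2 * t + 6)) _))))
          refine (Runs.whileTrue (by omega) hbody (N' := j * (c.weight.eval m + 6) + 1) ?_).mono ?_
          · convert h13 using 1
            simp only [Instr.exec, RAMState.setReg_reg_self]
            rw [RAMState.setReg_reg_ne _ _ hne6, h11]
            rfl
          · simp [Instr.weight]
            ring_nf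
            omega
        · intro r hr0 hr
          rw [h15 r hr0 hr, RAMState.setReg_reg_ne _ _ (by omega),
            RAMState.setReg_reg_ne _ _ (by omega), h10 _ hr0 (by omega),
            RAMState.setReg_reg_ne _ _ (by omega), RAMState.setReg_reg_ne _ _ (by omega)]
    obtain ⟨s₁, h4, h5, h6⟩ := key (inp.getD 0 0) 0 (by omega) (s'.setReg (2 * t + 4) 0)
      (hs'.setReg_temp (t + 1) 0) (by simp)
      (by rw [RAMState.setReg_reg_ne _ _ (by omega), h2]; rfl)
    refine ⟨s₁, (h1.seq ((Runs.instr _ _).seq h4)).mono ?_, ?_, ?_⟩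
    · simp only [Expr.weight, Cmd.weight, Instr.weight]
      have := Nat.mul_le_mul_right (c.weight.eval m + 6) hn
      simp only [Polynomial.eval_add, Polynomial.eval_mul, Polynomial.eval_X,
        Polynomial.eval_ofNat, Polynomial.eval_one, Polynomial.eval_zero, Nat.size_zero,
        Nat.cast_zero]
      omega
    · rwa [zero_add] at h5
    · intro r hr0 hr
      rw [h6 r hr0 hr, RAMState.setReg_reg_ne _ _ (by omega), h3.reg r (by omega)]

def Store.empty : Store := ⟨fun _ => 0, fun _ _ => 0, []⟩

theorem size_le_bitLength {l : List ℕ} {v : ℕ} (hv : v ∈ l) : v.size ≤ bitLength l := by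
  have : v.size + 1 ≤ bitLength l :=
    List.single_le_sum (by simp) _ (List.mem_map_of_mem hv)
  omega

theorem length_le_bitLength (l : List ℕ) : l.length ≤ bitLength l := by
  induction l with
  | nil => simp
  | cons a l ih => simp [bitLength] at ih ⊢; omega

open Polynomial in
/-- Programs of the imperative language run in polynomial time on inputs that are at least as long
as the number `n` they start with. -/
theorem Cmd.outputsWithin (c : Cmd) : ∃ p : ℕ[X], ∀ inp : List ℕ,
    inp.getD 0 0 ≤ bitLength inp →
    (c.compile 0).OutputsWithin inp (c.eval inp Store.empty).out (p.eval (bitLength inp)) := by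
  -- This is the time bound in `Runs`, with the bit length of the input as the initial bound on the
  -- register sizes.
  refine ⟨c.weight * (2 * (X + c.weight) + 3), fun inp hn => ?_⟩
  have hinit : Represents inp Store.empty (initState inp) := by
    refine ⟨by simp [initState], fun x => ?_, fun k _ => rfl, fun A i => ?_, rfl⟩
    · simp [initState, Store.empty]
    · simp only [initState, Store.empty]
      exact List.getD_eq_default _ _ (by omega)
  obtain ⟨s', h1, h2, -⟩ := c.compile_spec (fun v => size_le_bitLength) hn 0 hinit
  have hfit : (initState inp).Fits (bitLength inp) := by
    constructor
    · intro k
      by_cases hk : k = 0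
      · subst hk
        simp only [initState, Function.update_self]
        exact (Nat.size_le.2 Nat.lt_two_pow_self).trans (length_le_bitLength inp)
      · simp [initState, hk]
    · intro k
      simp only [initState]
      by_cases hk : k < inp.length
      · rw [List.getD_eq_getElem _ _ hk]
        exact size_le_bitLength (List.getElem_mem hk)
      · rw [List.getD_eq_default _ _ (not_lt.1 hk)]
        simp
  obtain ⟨-, t, h3, h4⟩ := h1 _ hfit
  refine ⟨s', t, h3, h2.out, h4.trans (by simp)⟩

end EPR

/-! ### Monogamy of entanglement and a dual bound for the largest eigenvalue. -/

namespace EPR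

/-! ## The upper bound -/

/-- `x` with the values at `i` and `j` replaced by `b`. -/
def pairSet {n : ℕ} (x : Fin n → Fin 2) (i j : Fin n) (b : Fin 2) : Fin n → Fin 2 :=
  Function.update (Function.update x i b) j b

theorem pairSet_apply {n : ℕ} (x : Fin n → Fin 2) (i j : Fin n) (b : Fin 2) (k : Fin n) :
    pairSet x i j b k = if k = i ∨ k = j then b else x k := by
  unfold pairSet
  by_cases hj : k = j
  · subst hj; simp
  · by_cases hi : k = i
    · subst hi; simp [hj]
    · simp [hi, hj]

theorem eprVec_mul_star (a b c d : Fin 2) :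
    eprVec a b * star (eprVec c d) = if a = b ∧ c = d then 1 / 2 else 0 := by
  unfold eprVec
  have h : ((1 / Real.sqrt 2 : ℝ) : ℂ) * ((1 / Real.sqrt 2 : ℝ) : ℂ) = 1 / 2 := by
    rw [← Complex.ofReal_mul, div_mul_div_comm, Real.mul_self_sqrt (by norm_num)]
    norm_num
  by_cases h1 : a = b <;> by_cases h2 : c = d <;>
    simp only [h1, h2, if_true, if_false, star_zero, mul_zero, zero_mul, and_self, and_true,
      and_false, Complex.star_def, Complex.conj_ofReal, h]

theorem eprProj_apply {n : ℕ} {i j : Fin n} (x y : Fin n → Fin 2) :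
    eprProj i j x y = ∑ b, if x i = x j ∧ y = pairSet x i j b then (1 / 2 : ℂ) else 0 := by
  unfold eprProj
  rw [eprVec_mul_star]
  by_cases hx : x i = x j
  · by_cases hy : ∀ k, k ≠ i → k ≠ j → x k = y k
    · by_cases hyy : y i = y j
      · have : ∀ b, y = pairSet x i j b ↔ b = y i := by
          intro b
          constructor
          · intro h; rw [h, pairSet_apply]; simp
          · rintro rfl
            funext k
            rw [pairSet_apply]
            split_ifs with hk
            · rcases hk with rfl | rfl
              · rfl
              · exact hyy.symm
            · exact (hy k (fun h => hk (Or.inl h)) (fun h => hk (Or.inr h))).symm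
        simpa [hx, hyy, this] using hy
      · have : ∀ b, y ≠ pairSet x i j b := by
          rintro b rfl
          exact hyy (by simp [pairSet_apply])
        simp [hyy, this]
    · have : ∀ b, y ≠ pairSet x i j b := by
        rintro b rfl
        exact hy fun k h1 h2 => by simp [pairSet_apply, h1, h2]
      simp [hy, this]
  · simp [hx]

theorem eprProj_mulVec {n : ℕ} (i j : Fin n) (f : (Fin n → Fin 2) → ℂ) (x : Fin n → Fin 2) :
    (eprProj i j).mulVec f x = if x i = x j then 1 / 2 * ∑ b, f (pairSet x i j b) else 0 := by
  simp only [Matrix.mulVec, dotProduct, eprProj_apply, Finset.sum_mul]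
  rw [Finset.sum_comm]
  by_cases hx : x i = x j
  · simp [hx, ite_mul]
    ring
  · simp [hx]

theorem pairSet_comm {n : ℕ} (x : Fin n → Fin 2) (i j : Fin n) (b : Fin 2) :
    pairSet x i j b = pairSet x j i b := by
  funext k
  simp [pairSet_apply, or_comm]

theorem eprProj_comm {n : ℕ} (i j : Fin n) : eprProj i j = (eprProj j i : Op n) := by
  funext x y
  simp only [eprProj_apply, pairSet_comm x i j, eq_comm (a := x i)]

theorem eprProj_isHermitian {n : ℕ} (i j : Fin n) : (eprProj i j : Op n).IsHermitian := by
  ext x y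
  rw [Matrix.conjTranspose_apply]
  unfold eprProj
  simp only [eprVec_mul_star, eq_comm (a := y _) (b := x _)]
  split_ifs <;> simp_all

theorem eprProj_mul_self_mulVec {n : ℕ} (i j : Fin n) (f : (Fin n → Fin 2) → ℂ) :
    (eprProj i j).mulVec ((eprProj i j).mulVec f) = (eprProj i j).mulVec f := by
  funext x
  simp only [eprProj_mulVec]
  have h : ∀ b c, pairSet (pairSet x i j b) i j c = pairSet x i j c := by
    intro b c
    funext k
    by_cases hk : k = i ∨ k = j <;> simp [pairSet_apply, hk]
  split_ifs with hx
  · have h' : ∀ b, pairSet x i j b i = pairSet x i j b j := by simp [pairSet_apply]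
    simp only [h, h', if_true, Fin.sum_univ_two]
    ring
  · rfl

/-- A Temperley–Lieb relation. Equality tests force the bits summed over by the first two
projections to equal the bit of `k`; only the last sum remains, with the factor 1/8 instead of 1/2.
-/
theorem eprProj_triple_mulVec {n : ℕ} {i j k : Fin n} (hij : i ≠ j) (hik : i ≠ k) (hjk : j ≠ k)
    (f : (Fin n → Fin 2) → ℂ) :
    (eprProj i j).mulVec ((eprProj i k).mulVec ((eprProj i j).mulVec f)) =
      (1 / 4 : ℂ) • (eprProj i j).mulVec f := by
  funext x
  simp only [eprProj_mulVec, Pi.smul_apply, smul_eq_mul]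
  have h : ∀ b, pairSet (pairSet (pairSet x i j (x k)) i k (x k)) i j b = pairSet x i j b := by
    intro b
    funext l
    by_cases hl : l = i ∨ l = j
    · simp [pairSet_apply, hl]
    · by_cases hlk : l = k
      · subst hlk; simp [pairSet_apply, hl]
      · push Not at hl
        simp [pairSet_apply, hl, hlk]
  have h1 : ∀ b, pairSet x i j b i = b := by simp [pairSet_apply]
  have h2 : ∀ b, pairSet x i j b k = x k := by simp [pairSet_apply, hik.symm, hjk.symm]
  have h3 : ∀ b c, pairSet (pairSet x i j b) i k c i = c := by simp [pairSet_apply]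
  have h4 : ∀ b c, pairSet (pairSet x i j b) i k c j = b := by
    simp [pairSet_apply, hij.symm, hjk]
  simp only [h1, h2, h3, h4, Finset.sum_ite_eq', Finset.mem_univ, if_true, h]
  split_ifs with hx
  · ring
  · ring

open scoped InnerProductSpace in
/-- Projections with `P j P k P j = P j / 4` for `j ≠ k`: the sum of `k` of them is at most
`(k + 1) / 2`. -/
theorem sum_inner_proj_le {V ι : Type*} [NormedAddCommGroup V] [InnerProductSpace ℂ V]
    [DecidableEq ι] (A : Finset ι) (P : ι → V →ₗ[ℂ] V) (hs : ∀ j ∈ A, (P j).IsSymmetric)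
    (hi : ∀ j ∈ A, ∀ v, P j (P j v) = P j v)
    (ht : ∀ j ∈ A, ∀ k ∈ A, j ≠ k → ∀ v, P j (P k (P j v)) = (1 / 4 : ℂ) • P j v) (ψ : V) :
    ∑ j ∈ A, (⟪ψ, P j ψ⟫_ℂ).re ≤ ((A.card : ℝ) + 1) / 2 * ‖ψ‖ ^ 2 := by
  have hdiag : ∀ j ∈ A, (⟪ψ, P j ψ⟫_ℂ).re = ‖P j ψ‖ ^ 2 := by
    intro j hj
    rw [← hi j hj ψ, ← hs j hj, hi j hj, inner_self_eq_norm_sq_to_K]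
    norm_cast
  have hoff : ∀ j ∈ A, ∀ k ∈ A, j ≠ k →
      (⟪P j ψ, P k ψ⟫_ℂ).re ≤ 1 / 2 * (‖P j ψ‖ * ‖P k ψ‖) := by
    intro j hj k hk hjk
    -- The squared norm is the inner product of ψ with P_j P_k P_j ψ, so the triple relation gives a
    -- quarter of ‖P_j ψ‖².
    have h1 : ‖P k (P j ψ)‖ ^ 2 = (1 / 2 * ‖P j ψ‖) ^ 2 := by
      have : ((‖P k (P j ψ)‖ ^ 2 : ℝ) : ℂ) = ((1 / 4 * ‖P j ψ‖ ^ 2 : ℝ) : ℂ) := by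
        push_cast
        have e1 := inner_self_eq_norm_sq_to_K (𝕜 := ℂ) (P k (P j ψ))
        have e2 := inner_self_eq_norm_sq_to_K (𝕜 := ℂ) (P j ψ)
        simp only [Complex.coe_algebraMap] at e1 e2
        rw [← e1, ← e2, hs k hk, hi k hk]
        nth_rewrite 1 [← hi j hj ψ]
        rw [hs j hj, ht j hj k hk hjk, inner_smul_right]
      rw [Complex.ofReal_inj] at this
      rw [this]
      ring
    have h2 : ‖P k (P j ψ)‖ = 1 / 2 * ‖P j ψ‖ := by
      rwa [sq_eq_sq₀ (norm_nonneg _) (by positivity)] at h1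
    calc (⟪P j ψ, P k ψ⟫_ℂ).re ≤ ‖⟪P j ψ, P k ψ⟫_ℂ‖ := Complex.re_le_norm _
      _ = ‖⟪P k (P j ψ), P k ψ⟫_ℂ‖ := by rw [hs k hk, hi k hk]
      _ ≤ ‖P k (P j ψ)‖ * ‖P k ψ‖ := norm_inner_le_norm _ _
      _ = _ := by rw [h2]; ring
  set s := ∑ j ∈ A, ‖P j ψ‖ ^ 2 with hsdef
  have hs0 : 0 ≤ s := Finset.sum_nonneg fun _ _ => by positivity
  rw [Finset.sum_congr rfl hdiag, ← hsdef]
  -- The required bound on s follows by playing s ≤ ‖ψ‖·‖ΣP_jψ‖ against an upper bound for ‖ΣP_jψ‖²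
  -- that is linear in s, and dividing by s.
  have h1 : s ≤ ‖ψ‖ * ‖∑ j ∈ A, P j ψ‖ := by
    calc s = (⟪ψ, ∑ j ∈ A, P j ψ⟫_ℂ).re := by
          rw [inner_sum, Complex.re_sum, Finset.sum_congr rfl hdiag]
      _ ≤ ‖⟪ψ, ∑ j ∈ A, P j ψ⟫_ℂ‖ := Complex.re_le_norm _
      _ ≤ _ := norm_inner_le_norm _ _
  -- Expanding the square, the off-diagonal bound gives s/2 + (Σ‖P_jψ‖)²/2, and Cauchy–Schwarz
  -- bounds the second square by s times the number of projections.
  have h2 : ‖∑ j ∈ A, P j ψ‖ ^ 2 ≤ s * ((A.card + 1) / 2) := by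
    have e : ‖∑ j ∈ A, P j ψ‖ ^ 2 = ∑ j ∈ A, ∑ k ∈ A, (⟪P j ψ, P k ψ⟫_ℂ).re := by
      have : (⟪∑ j ∈ A, P j ψ, ∑ j ∈ A, P j ψ⟫_ℂ).re = ‖∑ j ∈ A, P j ψ‖ ^ 2 := by
        rw [inner_self_eq_norm_sq_to_K]
        norm_cast
      rw [← this, sum_inner, Complex.re_sum]
      exact Finset.sum_congr rfl fun j _ => by rw [inner_sum, Complex.re_sum]
    have e2 : ∀ j ∈ A, ∀ k ∈ A, (⟪P j ψ, P k ψ⟫_ℂ).re ≤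
        1 / 2 * (‖P j ψ‖ * ‖P k ψ‖) + if j = k then 1 / 2 * ‖P j ψ‖ ^ 2 else 0 := by
      intro j hj k hk
      by_cases hjk : j = k
      · subst hjk
        rw [inner_self_eq_norm_sq_to_K]
        simp only [if_true]
        refine le_of_eq ?_
        norm_cast
        have e3 : (((‖P j ψ‖ ^ 2 : ℝ) : ℂ)).re = ‖P j ψ‖ ^ 2 := Complex.ofReal_re _
        refine e3.trans ?_
        ring
      · simpa [hjk] using hoff j hj k hk hjk
    rw [e]
    refine (Finset.sum_le_sum fun j hj => Finset.sum_le_sum fun k hk => e2 j hj k hk).trans ?_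
    have e3 : ∑ j ∈ A, ∑ k ∈ A, (1 / 2 * (‖P j ψ‖ * ‖P k ψ‖) +
        if j = k then 1 / 2 * ‖P j ψ‖ ^ 2 else 0) = 1 / 2 * (∑ j ∈ A, ‖P j ψ‖) ^ 2 + 1 / 2 * s := by
      simp only [Finset.sum_add_distrib]
      congr 1
      · rw [sq, Finset.sum_mul_sum, Finset.mul_sum]
        exact Finset.sum_congr rfl fun j _ => by rw [Finset.mul_sum]
      · rw [hsdef, Finset.mul_sum]
        exact Finset.sum_congr rfl fun j hj => by simp [hj]
    rw [e3]
    have e4 := sq_sum_le_card_mul_sum_sq (s := A) (f := fun j => ‖P j ψ‖)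
    rw [← hsdef] at e4
    nlinarith
  by_cases hs1 : s = 0
  · rw [hs1]; positivity
  · have hspos : 0 < s := lt_of_le_of_ne hs0 (Ne.symm hs1)
    have h3 : s ^ 2 ≤ ‖ψ‖ ^ 2 * (s * ((A.card + 1) / 2)) := by
      calc s ^ 2 ≤ (‖ψ‖ * ‖∑ j ∈ A, P j ψ‖) ^ 2 := by gcongr
        _ = ‖ψ‖ ^ 2 * ‖∑ j ∈ A, P j ψ‖ ^ 2 := by ring
        _ ≤ _ := by gcongr
    have : s * s ≤ s * (((A.card : ℝ) + 1) / 2 * ‖ψ‖ ^ 2) := by nlinarith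
    exact le_of_mul_le_mul_left this hspos

/-- The expectation of `H` in a (not normalized) vector. -/
noncomputable def expect {n : ℕ} (ψ : (Fin n → Fin 2) → ℂ) (H : Op n) : ℝ :=
  (star ψ ⬝ᵥ H.mulVec ψ).re

noncomputable def sqNorm {n : ℕ} (ψ : (Fin n → Fin 2) → ℂ) : ℝ := (star ψ ⬝ᵥ ψ).re

/-- Monogamy of entanglement on a star. -/
theorem sum_expect_eprProj_le {n : ℕ} (ψ : (Fin n → Fin 2) → ℂ) (i : Fin n) (A : Finset (Fin n))
    (hA : i ∉ A) :
    ∑ j ∈ A, expect ψ (eprProj i j) ≤ ((A.card : ℝ) + 1) / 2 * sqNorm ψ := by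
  have hne : ∀ j ∈ A, i ≠ j := fun j hj h => hA (h ▸ hj)
  have key := sum_inner_proj_le A
    (fun j => Matrix.toEuclideanLin (eprProj i j : Op n))
    (fun j _ => Matrix.isSymmetric_toEuclideanLin_iff.2 (eprProj_isHermitian i j))
    (fun j _ v => by
      simp only [Matrix.toLpLin_apply, eprProj_mul_self_mulVec])
    (fun j hj k hk hjk v => by
      simp only [Matrix.toLpLin_apply, eprProj_triple_mulVec (hne j hj) (hne k hk) hjk,
        WithLp.toLp_smul])
    (WithLp.toLp 2 ψ)
  have h1 : ∀ H : Op n, inner ℂ (WithLp.toLp 2 ψ) (Matrix.toEuclideanLin H (WithLp.toLp 2 ψ)) =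
      star ψ ⬝ᵥ H.mulVec ψ := by
    intro H
    rw [EuclideanSpace.inner_eq_star_dotProduct, dotProduct_comm]
    rfl
  have h2 : ‖(WithLp.toLp 2 ψ : EuclideanSpace ℂ (Fin n → Fin 2))‖ ^ 2 = sqNorm ψ := by
    have := inner_self_eq_norm_sq_to_K (𝕜 := ℂ)
      (WithLp.toLp 2 ψ : EuclideanSpace ℂ (Fin n → Fin 2))
    rw [EuclideanSpace.inner_eq_star_dotProduct, dotProduct_comm] at this
    unfold sqNorm
    rw [this]
    norm_cast
  rw [h2] at key
  simpa only [h1, expect] using key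

theorem sqNorm_pos {n : ℕ} {ψ : (Fin n → Fin 2) → ℂ} (h : ψ ≠ 0) : 0 < sqNorm ψ := by
  have : sqNorm ψ = ∑ x, Complex.normSq (ψ x) := by
    simp [sqNorm, dotProduct, Complex.normSq_apply]
  rw [this]
  obtain ⟨x, hx⟩ := Function.ne_iff.1 h
  exact Finset.sum_pos' (fun _ _ => Complex.normSq_nonneg _)
    ⟨x, Finset.mem_univ _, Complex.normSq_pos.2 hx⟩

theorem sum_Ioi_add_swap {n : ℕ} (f : Fin n → Fin n → ℝ) :
    ∑ i, ∑ j ∈ Finset.Ioi i, (f i j + f j i) = ∑ i, ∑ j ∈ Finset.univ.erase i, f i j := by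
  have h : ∀ i : Fin n, ∑ j ∈ Finset.univ.erase i, f i j =
      ∑ j ∈ Finset.Ioi i, f i j + ∑ j ∈ Finset.Iio i, f i j := by
    intro i
    rw [← Finset.sum_union]
    · refine Finset.sum_congr ?_ fun _ _ => rfl
      ext j
      simp only [Finset.mem_erase, Finset.mem_univ, and_true, Finset.mem_union, Finset.mem_Ioi,
        Finset.mem_Iio]
      exact ⟨fun h => (lt_or_gt_of_ne h).symm, fun h => h.elim (fun h => h.ne') fun h => h.ne⟩
    · rw [Finset.disjoint_left]
      intro j h1 h2
      exact lt_asymm (Finset.mem_Ioi.1 h1) (Finset.mem_Iio.1 h2)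
  simp only [h, Finset.sum_add_distrib]
  congr 1
  exact Finset.sum_comm' (by simp)

theorem expect_ham {I : Instance} (ψ : (Fin I.n → Fin 2) → ℂ) :
    expect ψ I.ham = ∑ i, ∑ j ∈ Finset.Ioi i, (I.w i j : ℝ) * expect ψ (eprProj i j) := by
  unfold expect Instance.ham
  simp only [Matrix.sum_mulVec, dotProduct_sum, Complex.re_sum, Matrix.smul_mulVec,
    dotProduct_smul, smul_eq_mul]
  refine Finset.sum_congr rfl fun i _ => Finset.sum_congr rfl fun j _ => ?_
  rw [show ((I.w i j : ℚ≥0) : ℂ) = ((I.w i j : ℝ) : ℂ) by push_cast; rfl, Complex.re_ofReal_mul]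

/-- Half the total weight plus half the value of a fractional vertex cover bounds the energy. -/
theorem lambdaMax_ham_le (I : Instance) (y : Fin I.n → ℝ) (hy : ∀ i, 0 ≤ y i)
    (hw : ∀ i j, i ≠ j → (I.w i j : ℝ) ≤ y i + y j) :
    lambdaMax I.ham ≤ 1 / 2 * (∑ i, ∑ j ∈ Finset.Ioi i, (I.w i j : ℝ)) + 1 / 2 * ∑ i, y i := by
  have hpos : (0 : ℝ) ≤ ∑ i, ∑ j ∈ Finset.Ioi i, (I.w i j : ℝ) :=
    Finset.sum_nonneg fun _ _ => Finset.sum_nonneg fun _ _ => by positivity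
  have hpos' : 0 ≤ ∑ i, y i := Finset.sum_nonneg fun i _ => hy i
  -- Nonnegativity of the bound covers the convention that the supremum of the empty set is 0.
  refine Real.sSup_le (fun μ hμ => ?_) (by positivity)
  obtain ⟨ψ, hψ⟩ := Module.End.HasEigenvalue.exists_hasEigenvector hμ
  have hN := sqNorm_pos hψ.2
  have h1 : expect ψ I.ham = μ * sqNorm ψ := by
    have := hψ.apply_eq_smul
    rw [Matrix.toLin'_apply] at this
    unfold expect sqNorm
    rw [this, dotProduct_smul, smul_eq_mul, Complex.re_ofReal_mul]
  set e : Fin I.n → Fin I.n → ℝ := fun i j => expect ψ (eprProj i j) with he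
  -- Up to the normalization of ψ, this is the fractional matching to be paired with the cover `y`.
  set x : Fin I.n → Fin I.n → ℝ := fun i j => max 0 (2 * e i j - sqNorm ψ) with hx
  have hxc : ∀ i j, x i j = x j i := by
    intro i j
    simp only [hx, he, eprProj_comm i j]
  have hx1 : ∀ i, ∑ j ∈ Finset.univ.erase i, x i j ≤ sqNorm ψ := by
    intro i
    -- The star bound is applied to the neighbours of nonnegative excess only: on a set A of them
    -- the sum of 2⟨E_ij⟩ - 1 is at most (|A|+1) - |A| = 1.
    have h2 := sum_expect_eprProj_le ψ i
      ((Finset.univ.erase i).filter fun j => 0 ≤ 2 * e i j - sqNorm ψ) (by simp)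
    have h3 : ∑ j ∈ Finset.univ.erase i, x i j =
        ∑ j ∈ (Finset.univ.erase i).filter (fun j => 0 ≤ 2 * e i j - sqNorm ψ),
          (2 * e i j - sqNorm ψ) := by
      rw [Finset.sum_filter]
      refine Finset.sum_congr rfl fun j _ => ?_
      simp only [hx]
      split_ifs with h
      · exact max_eq_right h
      · exact max_eq_left (le_of_not_ge h)
    rw [h3, Finset.sum_sub_distrib, ← Finset.mul_sum, Finset.sum_const, nsmul_eq_mul]
    linarith
  -- Weak duality between the fractional matching `x` and the cover `y`.
  have h4 : ∑ i, ∑ j ∈ Finset.Ioi i, (I.w i j : ℝ) * (2 * e i j - sqNorm ψ) ≤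
      (∑ i, y i) * sqNorm ψ := by
    calc ∑ i, ∑ j ∈ Finset.Ioi i, (I.w i j : ℝ) * (2 * e i j - sqNorm ψ)
        ≤ ∑ i, ∑ j ∈ Finset.Ioi i, (y i * x i j + y j * x j i) := by
          refine Finset.sum_le_sum fun i _ => Finset.sum_le_sum fun j hj => ?_
          have hij := hw i j (Finset.mem_Ioi.1 hj).ne
          rw [hxc j i, ← add_mul]
          have hx0 : 0 ≤ x i j := le_max_left _ _
          calc (I.w i j : ℝ) * (2 * e i j - sqNorm ψ) ≤ (I.w i j : ℝ) * x i j := by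
                gcongr
                exact le_max_right _ _
            _ ≤ _ := by gcongr
      _ = ∑ i, y i * ∑ j ∈ Finset.univ.erase i, x i j := by
          rw [sum_Ioi_add_swap fun i j => y i * x i j]
          simp only [Finset.mul_sum]
      _ ≤ ∑ i, y i * sqNorm ψ :=
          Finset.sum_le_sum fun i _ => mul_le_mul_of_nonneg_left (hx1 i) (hy i)
      _ = _ := by rw [Finset.sum_mul]
  rw [expect_ham] at h1
  have h5 : ∑ i, ∑ j ∈ Finset.Ioi i, (I.w i j : ℝ) * (2 * e i j - sqNorm ψ) =
      2 * (∑ i, ∑ j ∈ Finset.Ioi i, (I.w i j : ℝ) * e i j) -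
        (∑ i, ∑ j ∈ Finset.Ioi i, (I.w i j : ℝ)) * sqNorm ψ := by
    simp only [Finset.mul_sum, Finset.sum_mul, ← Finset.sum_sub_distrib]
    exact Finset.sum_congr rfl fun _ _ => Finset.sum_congr rfl fun _ _ => by ring
  rw [h5, h1] at h4
  have : μ * sqNorm ψ ≤ (1 / 2 * (∑ i, ∑ j ∈ Finset.Ioi i, (I.w i j : ℝ)) +
      1 / 2 * ∑ i, y i) * sqNorm ψ := by linarith
  exact le_of_mul_le_mul_right this hN

end EPR

/-! ### Biases and pair energies of tensor products and mixtures. -/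

namespace EPR

/-! ## Sums over the cube -/

/-- The sum over the coordinates in `S` of a function that depends on these coordinates only. -/
noncomputable def localSum {n : ℕ} (S : Finset (Fin n)) (f : (Fin n → Fin 2) → ℝ) : ℝ :=
  2 ^ S.card / 2 ^ n * ∑ x, f x

theorem card_cube (n : ℕ) : Fintype.card (Fin n → Fin 2) = 2 ^ n := by simp

/-- Exchanging the coordinates in T between two points of the cube is an involution; it moves the
argument of `g` to the point at which `f` is evaluated, without affecting `f`. -/
theorem sum_mul_sum_of_disjoint {n : ℕ} {S T : Finset (Fin n)} (hST : Disjoint S T)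
    {f g : (Fin n → Fin 2) → ℝ} (hf : DependsOn f S) (hg : DependsOn g T) :
    (∑ x, f x) * ∑ y, g y = 2 ^ n * ∑ x, f x * g x := by
  let e : ((Fin n → Fin 2) × (Fin n → Fin 2)) ≃ ((Fin n → Fin 2) × (Fin n → Fin 2)) :=
    { toFun := fun p => (T.piecewise p.2 p.1, T.piecewise p.1 p.2)
      invFun := fun p => (T.piecewise p.2 p.1, T.piecewise p.1 p.2)
      left_inv := fun p => by
        ext i <;> by_cases hi : i ∈ T <;> simp [hi]
      right_inv := fun p => by
        ext i <;> by_cases hi : i ∈ T <;> simp [hi] }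
  have h1 : ∀ p : (Fin n → Fin 2) × (Fin n → Fin 2),
      f p.1 * g p.2 = f (e p).1 * g (e p).1 := by
    intro p
    congr 1
    · refine hf fun i hi => ?_
      simp [e, Finset.disjoint_left.1 hST hi]
    · refine hg fun i hi => ?_
      have : i ∈ T := hi
      simp [e, this]
  rw [Finset.sum_mul_sum, ← Finset.sum_product', Finset.univ_product_univ,
    Finset.sum_congr rfl fun p _ => h1 p, e.sum_comp fun p => f p.1 * g p.1,
    ← Finset.univ_product_univ, Finset.sum_product]
  simp [Finset.mul_sum]

theorem localSum_mul {n : ℕ} {S T : Finset (Fin n)} (hST : Disjoint S T)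
    {f g : (Fin n → Fin 2) → ℝ} (hf : DependsOn f S) (hg : DependsOn g T) :
    localSum (S ∪ T) (fun x => f x * g x) = localSum S f * localSum T g := by
  have h := sum_mul_sum_of_disjoint hST hf hg
  unfold localSum
  rw [Finset.card_union_of_disjoint hST, pow_add]
  field_simp
  rw [← h]

/-- Exchanging the coordinates selected by `q` with a point of the small cube is an involution of
the product of the two cubes. -/
theorem localSum_comp {n m : ℕ} (q : Fin m ↪ Fin n) (f : (Fin m → Fin 2) → ℝ) :
    localSum (Finset.univ.map q) (fun x => f (x ∘ q)) = ∑ x, f x := by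
  let e : ((Fin n → Fin 2) × (Fin m → Fin 2)) ≃ ((Fin n → Fin 2) × (Fin m → Fin 2)) :=
    { toFun := fun p => (Function.extend q p.2 p.1, p.1 ∘ q)
      invFun := fun p => (Function.extend q p.2 p.1, p.1 ∘ q)
      left_inv := fun p => by
        ext i
        · by_cases hi : ∃ k, q k = i
          · obtain ⟨k, rfl⟩ := hi
            simp [q.injective.extend_apply]
          · simp [Function.extend_apply' _ _ _ hi]
        · simp [q.injective.extend_apply]
      right_inv := fun p => by
        ext i
        · by_cases hi : ∃ k, q k = i
          · obtain ⟨k, rfl⟩ := hi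
            simp [q.injective.extend_apply]
          · simp [Function.extend_apply' _ _ _ hi]
        · simp [q.injective.extend_apply] }
  have h : ∑ p : (Fin n → Fin 2) × (Fin m → Fin 2), f (p.1 ∘ q) =
      ∑ p : (Fin n → Fin 2) × (Fin m → Fin 2), f p.2 := e.sum_comp fun p => f p.2
  rw [← Finset.univ_product_univ, Finset.sum_product, Finset.sum_product] at h
  simp only [Finset.sum_const, Finset.card_univ, card_cube, nsmul_eq_mul] at h
  unfold localSum
  rw [Finset.card_map, Finset.card_univ, Fintype.card_fin]
  rw [← Finset.mul_sum] at h
  push_cast at h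
  rw [div_mul_eq_mul_div, h]
  field_simp

theorem localSum_combination {n : ℕ} (S : Finset (Fin n)) (p q : ℝ)
    (f g : (Fin n → Fin 2) → ℝ) :
    localSum S (fun x => p * f x + q * g x) = p * localSum S f + q * localSum S g := by
  unfold localSum
  rw [Finset.sum_add_distrib, ← Finset.mul_sum, ← Finset.mul_sum]
  ring

/-! ## Descriptions of states with real, parity preserving matrices -/

namespace StateDesc

variable {n : ℕ}

theorem toOp_congr {d : StateDesc n} (hd : d.Valid) {x x' y y' : Fin n → Fin 2}
    (hx : ∀ i ∈ d.qubits, x i = x' i) (hy : ∀ i ∈ d.qubits, y i = y' i) :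
    d.toOp x y = d.toOp x' y' := by
  induction d with
  | block m q A =>
    have h1 : x ∘ q = x' ∘ q := funext fun k => hx _ (by simp [qubits])
    have h2 : y ∘ q = y' ∘ q := funext fun k => hy _ (by simp [qubits])
    simp only [toOp, h1, h2]
  | tensor a b iha ihb =>
    simp only [toOp]
    rw [iha hd.1 (fun i hi => hx i (Finset.mem_union_left _ hi))
      (fun i hi => hy i (Finset.mem_union_left _ hi)),
      ihb hd.2.1 (fun i hi => hx i (Finset.mem_union_right _ hi))
      (fun i hi => hy i (Finset.mem_union_right _ hi))]
  | mix p a b iha ihb =>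
    simp only [toOp]
    have hab : a.qubits = b.qubits := hd.2.2.1
    rw [iha hd.1 hx hy, ihb hd.2.1 (fun i hi => hx i (by rwa [qubits, hab]))
      (fun i hi => hy i (by rwa [qubits, hab]))]

-- On full bit strings a tensor product acts as an entrywise product, so positivity is the Schur
-- product theorem; a block is a submatrix with repeated rows and columns.
open scoped ComplexOrder in
theorem posSemidef_toOp {d : StateDesc n} (hd : d.Valid) : d.toOp.PosSemidef := by
  induction d with
  | block m q A => exact hd.2.1.submatrix fun x : Fin n → Fin 2 => x ∘ q
  | tensor a b iha ihb => exact (iha hd.1).hadamard (ihb hd.2.1)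
  | mix p a b iha ihb =>
    have hp : (0 : ℂ) ≤ (p : ℂ) := by
      rw [← Complex.ofReal_ratCast, Complex.zero_le_real]
      exact_mod_cast hd.2.2.2.1
    have hp' : (0 : ℂ) ≤ 1 - (p : ℂ) := by
      rw [← Complex.ofReal_ratCast, ← Complex.ofReal_one, ← Complex.ofReal_sub,
        Complex.zero_le_real]
      exact sub_nonneg.2 (by exact_mod_cast hd.2.2.2.2)
    exact ((iha hd.1).smul hp).add ((ihb hd.2.1).smul hp')

/-- The real part of the entries of the density matrix. -/
noncomputable def amp (d : StateDesc n) (x y : Fin n → Fin 2) : ℝ := (d.toOp x y).re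

/-- The expectation of the Pauli matrix `Z` on qubit `i`. -/
noncomputable def bias (d : StateDesc n) (i : Fin n) : ℝ :=
  localSum d.qubits fun x => (if x i = 0 then 1 else -1) * d.amp x x

/-- The expectation of the projection `E_ij`. -/
noncomputable def pairEnergy (d : StateDesc n) (i j : Fin n) : ℝ :=
  localSum d.qubits fun x =>
    if x i = x j then 1 / 2 * ∑ b, d.amp x (pairSet x i j b) else 0

/-- Valid descriptions of states with real entries that do not mix even and odd parities. -/
structure Tame (d : StateDesc n) : Prop where
  valid : d.Valid
  real : ∀ x y, (d.toOp x y).im = 0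
  -- Entries between strings differing in one bit vanish, so every single-qubit marginal is diagonal
  -- and its X and Y expectations are zero.
  parity : ∀ i ∈ d.qubits, ∀ x b, b ≠ x i → d.toOp x (Function.update x i b) = 0
  mass : localSum d.qubits (fun x => d.amp x x) = 1

theorem amp_congr {d : StateDesc n} (hd : d.Valid) {x x' y y' : Fin n → Fin 2}
    (hx : ∀ i ∈ d.qubits, x i = x' i) (hy : ∀ i ∈ d.qubits, y i = y' i) :
    d.amp x y = d.amp x' y' := by
  unfold amp
  rw [toOp_congr hd hx hy]

theorem dependsOn_amp {d : StateDesc n} (hd : d.Valid) :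
    DependsOn (fun x => d.amp x x) (d.qubits : Set (Fin n)) :=
  fun _ _ h => amp_congr hd (fun i hi => h i hi) (fun i hi => h i hi)

theorem amp_tensor {a b : StateDesc n} (ha : a.Tame) (x y : Fin n → Fin 2) :
    (tensor a b).amp x y = a.amp x y * b.amp x y := by
  simp [amp, toOp, ha.real]

theorem amp_mix (p : ℚ) (a b : StateDesc n) (x y : Fin n → Fin 2) :
    (mix p a b).amp x y = p * a.amp x y + (1 - p) * b.amp x y := by
  simp [amp, toOp]

theorem Tame.tensor {a b : StateDesc n} (ha : a.Tame) (hb : b.Tame)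
    (hab : Disjoint a.qubits b.qubits) : (tensor a b).Tame where
  valid := ⟨ha.valid, hb.valid, hab⟩
  real x y := by simp [toOp, ha.real, hb.real]
  parity i hi x c hc := by
    simp only [toOp]
    rcases Finset.mem_union.1 hi with h | h
    · rw [ha.parity i h x c hc, zero_mul]
    · rw [hb.parity i h x c hc, mul_zero]
  mass := by
    simp only [amp_tensor ha, qubits]
    rw [localSum_mul hab (dependsOn_amp ha.valid) (dependsOn_amp hb.valid), ha.mass, hb.mass,
      one_mul]

theorem Tame.mix {a b : StateDesc n} (ha : a.Tame) (hb : b.Tame) (hab : a.qubits = b.qubits)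
    {p : ℚ} (hp : 0 ≤ p) (hp' : p ≤ 1) : (mix p a b).Tame where
  valid := ⟨ha.valid, hb.valid, hab, hp, hp'⟩
  real x y := by simp [toOp, ha.real, hb.real]
  parity i hi x c hc := by
    simp only [toOp]
    rw [ha.parity i hi x c hc, hb.parity i (by rwa [← hab]) x c hc]
    simp
  mass := by
    simp only [amp_mix, qubits]
    rw [localSum_combination, ha.mass, hab, hb.mass]
    ring

theorem bias_mix {a b : StateDesc n} (hab : a.qubits = b.qubits) (p : ℚ) (i : Fin n) :
    (mix p a b).bias i = p * a.bias i + (1 - p) * b.bias i := by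
  unfold bias
  rw [← hab, ← localSum_combination]
  simp only [amp_mix, qubits]
  congr 1
  funext x
  ring

theorem pairEnergy_mix {a b : StateDesc n} (hab : a.qubits = b.qubits) (p : ℚ) (i j : Fin n) :
    (mix p a b).pairEnergy i j = p * a.pairEnergy i j + (1 - p) * b.pairEnergy i j := by
  unfold pairEnergy
  rw [← hab, ← localSum_combination]
  simp only [amp_mix, qubits]
  congr 1
  funext x
  split_ifs
  · simp only [Fin.sum_univ_two]
    ring
  · ring

theorem pairEnergy_comm (d : StateDesc n) (i j : Fin n) : d.pairEnergy i j = d.pairEnergy j i := by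
  unfold pairEnergy
  congr 1
  funext x
  simp only [pairSet_comm x i j, eq_comm (a := x i)]

theorem amp_tensor_comm (a b : StateDesc n) : (tensor a b).amp = (tensor b a).amp := by
  funext x y
  simp only [amp, toOp, mul_comm]

theorem bias_tensor_comm (a b : StateDesc n) (i : Fin n) :
    (tensor a b).bias i = (tensor b a).bias i := by
  unfold bias
  rw [amp_tensor_comm, qubits, qubits, Finset.union_comm]

theorem pairEnergy_tensor_comm (a b : StateDesc n) (i j : Fin n) :
    (tensor a b).pairEnergy i j = (tensor b a).pairEnergy i j := by
  unfold pairEnergy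
  rw [amp_tensor_comm, qubits, qubits, Finset.union_comm]

theorem dependsOn_bias {d : StateDesc n} (hd : d.Valid) {i : Fin n} (hi : i ∈ d.qubits) :
    DependsOn (fun x => (if x i = 0 then (1 : ℝ) else -1) * d.amp x x)
      (d.qubits : Set (Fin n)) := by
  intro x y h
  simp only
  rw [h i hi, amp_congr hd (fun i hi => h i hi) (fun i hi => h i hi)]

theorem bias_tensor_left {a b : StateDesc n} (ha : a.Tame) (hb : b.Tame)
    (hab : Disjoint a.qubits b.qubits) {i : Fin n} (hi : i ∈ a.qubits) :
    (tensor a b).bias i = a.bias i := by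
  have h := localSum_mul hab (dependsOn_bias ha.valid hi) (dependsOn_amp hb.valid)
  rw [hb.mass, mul_one] at h
  unfold bias
  rw [← h]
  simp only [amp_tensor ha, qubits, mul_assoc]

theorem bias_tensor_right {a b : StateDesc n} (ha : a.Tame) (hb : b.Tame)
    (hab : Disjoint a.qubits b.qubits) {i : Fin n} (hi : i ∈ b.qubits) :
    (tensor a b).bias i = b.bias i := by
  rw [bias_tensor_comm, bias_tensor_left hb ha hab.symm hi]

theorem pairEnergy_tensor_left {a b : StateDesc n} (ha : a.Tame) (hb : b.Tame)
    (hab : Disjoint a.qubits b.qubits) {i j : Fin n} (hi : i ∈ a.qubits) (hj : j ∈ a.qubits) :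
    (tensor a b).pairEnergy i j = a.pairEnergy i j := by
  have hdep : DependsOn (fun x => if x i = x j then 1 / 2 * ∑ b, a.amp x (pairSet x i j b) else 0)
      (a.qubits : Set (Fin n)) := by
    intro x y h
    simp only
    rw [h i hi, h j hj]
    congr 2
    refine Finset.sum_congr rfl fun b _ => amp_congr ha.valid (fun i hi => h i hi) fun k hk => ?_
    rw [pairSet_apply, pairSet_apply, h k hk]
  have h := localSum_mul hab hdep (dependsOn_amp hb.valid)
  rw [hb.mass, mul_one] at h
  unfold pairEnergy
  rw [← h]
  simp only [amp_tensor ha, qubits]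
  congr 1
  funext x
  rw [ite_mul, zero_mul]
  congr 1
  rw [mul_assoc, Finset.sum_mul]
  congr 1
  refine Finset.sum_congr rfl fun c _ => ?_
  congr 1
  refine amp_congr hb.valid (fun _ _ => rfl) fun k hk => ?_
  have h1 : k ≠ i := fun h => Finset.disjoint_left.1 hab hi (h ▸ hk)
  have h2 : k ≠ j := fun h => Finset.disjoint_left.1 hab hj (h ▸ hk)
  simp [pairSet_apply, h1, h2]

theorem pairEnergy_tensor_right {a b : StateDesc n} (ha : a.Tame) (hb : b.Tame)
    (hab : Disjoint a.qubits b.qubits) {i j : Fin n} (hi : i ∈ b.qubits) (hj : j ∈ b.qubits) :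
    (tensor a b).pairEnergy i j = b.pairEnergy i j := by
  rw [pairEnergy_tensor_comm, pairEnergy_tensor_left hb ha hab.symm hi hj]

/-- The projection is (1 + XX - YY + ZZ)/4. In a product state of tame factors the XX and YY terms
vanish by parity, and the ZZ term is the product of the biases. -/
theorem pairEnergy_tensor_cross {a b : StateDesc n} (ha : a.Tame) (hb : b.Tame)
    (hab : Disjoint a.qubits b.qubits) {i j : Fin n} (hi : i ∈ a.qubits) (hj : j ∈ b.qubits) :
    (tensor a b).pairEnergy i j = (1 + a.bias i * b.bias j) / 4 := by
  have hij : i ∉ b.qubits := Finset.disjoint_left.1 hab hi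
  have hji : j ∉ a.qubits := Finset.disjoint_right.1 hab hj
  have h1 := localSum_mul hab (dependsOn_bias ha.valid hi) (dependsOn_bias hb.valid hj)
  have h2 := localSum_mul hab (dependsOn_amp ha.valid) (dependsOn_amp hb.valid)
  rw [ha.mass, hb.mass] at h2
  have h3 := localSum_combination (a.qubits ∪ b.qubits) (1 / 4) (1 / 4)
    (fun x => a.amp x x * b.amp x x) (fun x => (if x i = 0 then (1 : ℝ) else -1) * a.amp x x *
      ((if x j = 0 then (1 : ℝ) else -1) * b.amp x x))
  rw [h1, h2] at h3
  rw [show (1 + a.bias i * b.bias j) / 4 = 1 / 4 * (1 * 1) + 1 / 4 * (a.bias i * b.bias j) by ring]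
  unfold bias
  rw [← h3]
  unfold pairEnergy
  simp only [qubits]
  congr 1
  funext x
  -- Changing the common bit flips exactly one qubit of the factor `a`, so parity kills every term
  -- except the diagonal one.
  have h4 : x i = x j → ∀ c, (tensor a b).amp x (pairSet x i j c) =
      if c = x i then a.amp x x * b.amp x x else 0 := by
    intro hx c
    rw [amp_tensor ha]
    by_cases hc : c = x i
    · have : pairSet x i j c = x := by
        funext k
        rw [pairSet_apply]
        split_ifs with hk
        · rcases hk with rfl | rfl
          · exact hc
          · exact hc.trans hx
        · rfl
      rw [this, if_pos hc]
    · have : a.amp x (pairSet x i j c) = a.amp x (Function.update x i c) := by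
        refine amp_congr ha.valid (fun _ _ => rfl) fun k hk => ?_
        have : k ≠ j := fun h => hji (h ▸ hk)
        unfold pairSet
        rw [Function.update_of_ne this]
      rw [this]
      simp [hc, amp, ha.parity i hi x c hc]
  by_cases hx : x i = x j
  · rw [if_pos hx]
    simp only [h4 hx, Finset.sum_ite_eq', Finset.mem_univ, if_true, hx]
    split_ifs <;> ring
  · rw [if_neg hx]
    have : (if x i = 0 then (1 : ℝ) else -1) * (if x j = 0 then (1 : ℝ) else -1) = -1 := by
      generalize x i = p at *
      generalize x j = q at *
      fin_cases p <;> fin_cases q <;> simp_all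
    linear_combination -(1 / 4) * (a.amp x x * b.amp x x) * this

open scoped ComplexOrder in
theorem describes_of_tame {d : StateDesc n} (hd : d.Tame) (hq : d.qubits = Finset.univ) :
    d.Describes d.toOp := by
  refine ⟨hd.valid, hq, rfl, posSemidef_toOp hd.valid, ?_⟩
  have h := hd.mass
  rw [hq] at h
  simp only [localSum, Finset.card_univ, Fintype.card_fin] at h
  rw [div_self (by positivity), one_mul] at h
  apply Complex.ext
  · rw [Matrix.trace, Complex.re_sum]
    exact h
  · rw [Matrix.trace, Complex.im_sum]
    exact Finset.sum_eq_zero fun x _ => hd.real x x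

theorem energy_eprProj {d : StateDesc n} (hq : d.qubits = Finset.univ) (i j : Fin n) :
    energy d.toOp (eprProj i j) = d.pairEnergy i j := by
  have h : (d.toOp * eprProj i j).trace = ∑ x, (eprProj i j).mulVec (d.toOp x) x := by
    simp only [Matrix.trace, Matrix.diag, Matrix.mul_apply, Matrix.mulVec, dotProduct]
    refine Finset.sum_congr rfl fun x _ => Finset.sum_congr rfl fun y _ => ?_
    rw [mul_comm]
    congr 1
    unfold eprProj
    simp only [eprVec_mul_star, eq_comm (a := y _) (b := x _), and_comm]
  unfold energy pairEnergy localSum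
  rw [h, hq, Finset.card_univ, Fintype.card_fin, div_self (by positivity), one_mul, Complex.re_sum]
  refine Finset.sum_congr rfl fun x _ => ?_
  rw [eprProj_mulVec]
  by_cases hx : x i = x j
  · simp [hx, amp]
  · simp [hx]

theorem energy_ham {I : Instance} {d : StateDesc I.n} (hq : d.qubits = Finset.univ) :
    energy d.toOp I.ham = ∑ i, ∑ j ∈ Finset.Ioi i, (I.w i j : ℝ) * d.pairEnergy i j := by
  simp only [← energy_eprProj hq]
  unfold energy Instance.ham
  simp only [Finset.mul_sum, Matrix.trace_sum, Complex.re_sum, Matrix.mul_smul,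
    Matrix.trace_smul, smul_eq_mul]
  refine Finset.sum_congr rfl fun i _ => Finset.sum_congr rfl fun j _ => ?_
  rw [show ((I.w i j : ℚ≥0) : ℂ) = ((I.w i j : ℝ) : ℂ) by push_cast; rfl, Complex.re_ofReal_mul]

end StateDesc

end EPR

/-! ### The blocks: one, two and three qubits with golden-ratio bias bounds. -/

namespace EPR

/-! ## Pure real states on a few qubits -/

theorem sum_cube_one (f : (Fin 1 → Fin 2) → ℝ) : ∑ x, f x = f ![0] + f ![1] := by
  rw [show (Finset.univ : Finset (Fin 1 → Fin 2)) = {![0], ![1]} by decide,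
    Finset.sum_insert (by decide), Finset.sum_singleton]

theorem sum_cube_two (f : (Fin 2 → Fin 2) → ℝ) :
    ∑ x, f x = f ![0, 0] + f ![0, 1] + f ![1, 0] + f ![1, 1] := by
  rw [show (Finset.univ : Finset (Fin 2 → Fin 2)) = {![0, 0], ![0, 1], ![1, 0], ![1, 1]} by decide,
    Finset.sum_insert (by decide), Finset.sum_insert (by decide), Finset.sum_insert (by decide),
    Finset.sum_singleton]
  ring

namespace StateDesc

variable {n m : ℕ}

def realBlock (q : Fin m ↪ Fin n) (A : (Fin m → Fin 2) → (Fin m → Fin 2) → Radical) :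
    StateDesc n :=
  .block m q fun x y => (A x y, .rat 0)

theorem qubits_realBlock (q : Fin m ↪ Fin n) (A : (Fin m → Fin 2) → (Fin m → Fin 2) → Radical) :
    (realBlock q A).qubits = Finset.univ.map q := rfl

theorem amp_realBlock (q : Fin m ↪ Fin n) {A : (Fin m → Fin 2) → (Fin m → Fin 2) → Radical}
    {ψ : (Fin m → Fin 2) → ℝ} (hA : ∀ x y, (A x y).Legal ∧ (A x y).val = ψ x * ψ y)
    (x y : Fin n → Fin 2) : (realBlock q A).amp x y = ψ (x ∘ q) * ψ (y ∘ q) :=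
  (hA _ _).2

theorem toOp_realBlock (q : Fin m ↪ Fin n) {A : (Fin m → Fin 2) → (Fin m → Fin 2) → Radical}
    {ψ : (Fin m → Fin 2) → ℝ} (hA : ∀ x y, (A x y).Legal ∧ (A x y).val = ψ x * ψ y)
    (x y : Fin n → Fin 2) :
    (realBlock q A).toOp x y = ((ψ (x ∘ q) * ψ (y ∘ q) : ℝ) : ℂ) := by
  apply Complex.ext
  · exact (hA _ _).2
  · simp [realBlock, toOp, Entry.val, Radical.val]

open scoped ComplexOrder in
theorem tame_realBlock (q : Fin m ↪ Fin n) {A : (Fin m → Fin 2) → (Fin m → Fin 2) → Radical}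
    {ψ : (Fin m → Fin 2) → ℝ} (hA : ∀ x y, (A x y).Legal ∧ (A x y).val = ψ x * ψ y)
    (hψ : ∑ x, ψ x * ψ x = 1)
    (hpar : ∀ x k b, b ≠ x k → ψ x * ψ (Function.update x k b) = 0) : (realBlock q A).Tame where
  valid := by
    have hM : (Matrix.map (fun x y => (A x y, Radical.rat 0)) Entry.val :
        Matrix (Fin m → Fin 2) (Fin m → Fin 2) ℂ) =
        Matrix.vecMulVec (fun x => (ψ x : ℂ)) (star fun x => (ψ x : ℂ)) := by
      ext x y
      apply Complex.ext
      · change (A x y).val = _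
        simp [Matrix.vecMulVec_apply, (hA x y).2]
      · change (Radical.rat 0).val = _
        simp [Matrix.vecMulVec_apply, Radical.val]
    refine ⟨fun x y => ⟨(hA x y).1, trivial⟩, ?_, ?_⟩
    · rw [hM]
      exact Matrix.posSemidef_vecMulVec_self_star _
    · rw [hM, Matrix.trace]
      simp only [Matrix.diag, Matrix.vecMulVec_apply, Pi.star_apply, Complex.star_def,
        Complex.conj_ofReal]
      rw [← Complex.ofReal_one, ← hψ]
      push_cast
      rfl
  real x y := by rw [toOp_realBlock q hA, Complex.ofReal_im]
  parity i hi x b hb := by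
    obtain ⟨k, -, rfl⟩ := Finset.mem_map.1 hi
    rw [toOp_realBlock q hA, Function.update_comp_eq_of_injective _ q.injective,
      hpar _ _ _ hb, Complex.ofReal_zero]
  mass := by
    simp only [amp_realBlock q hA]
    rw [qubits_realBlock, localSum_comp q fun x => ψ x * ψ x, hψ]

theorem bias_realBlock (q : Fin m ↪ Fin n) {A : (Fin m → Fin 2) → (Fin m → Fin 2) → Radical}
    {ψ : (Fin m → Fin 2) → ℝ} (hA : ∀ x y, (A x y).Legal ∧ (A x y).val = ψ x * ψ y)
    (k : Fin m) :
    (realBlock q A).bias (q k) = ∑ x, (if x k = 0 then 1 else -1) * (ψ x * ψ x) := by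
  unfold bias
  simp only [amp_realBlock q hA]
  exact localSum_comp q fun x => (if x k = 0 then 1 else -1) * (ψ x * ψ x)

theorem pairEnergy_realBlock (q : Fin m ↪ Fin n)
    {A : (Fin m → Fin 2) → (Fin m → Fin 2) → Radical}
    {ψ : (Fin m → Fin 2) → ℝ} (hA : ∀ x y, (A x y).Legal ∧ (A x y).val = ψ x * ψ y)
    (k l : Fin m) :
    (realBlock q A).pairEnergy (q k) (q l) =
      ∑ x, if x k = x l then 1 / 2 * ∑ b, ψ x * ψ (pairSet x k l b) else 0 := by
  have h : ∀ (x : Fin n → Fin 2) b, pairSet x (q k) (q l) b ∘ q = pairSet (x ∘ q) k l b := by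
    intro x b
    funext i
    simp [pairSet_apply]
  unfold pairEnergy
  simp only [amp_realBlock q hA, h]
  exact localSum_comp q fun x => if x k = x l then 1 / 2 * ∑ b, ψ x * ψ (pairSet x k l b) else 0

/-- A block on the qubits `v 0, …, v (m-1)` if they are distinct. -/
noncomputable def blockOn (v : Fin m → Fin n)
    (A : (Fin m → Fin 2) → (Fin m → Fin 2) → Radical) : StateDesc n :=
  open scoped Classical in
  if h : Function.Injective v then realBlock ⟨v, h⟩ A
  else realBlock (Function.Embedding.ofIsEmpty : Fin 0 ↪ Fin n) fun _ _ => .rat 1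

theorem blockOn_of_injective {v : Fin m → Fin n} (h : Function.Injective v)
    (A : (Fin m → Fin 2) → (Fin m → Fin 2) → Radical) :
    blockOn v A = realBlock ⟨v, h⟩ A := by
  simp [blockOn, h]

end StateDesc

/-! ## The constants -/

noncomputable def ratio : ℝ := (1 + Real.sqrt 5) / 4

/-- The single-qubit bias of the states used. -/
noncomputable def tilt : ℝ := Real.sqrt ((Real.sqrt 5 - 1) / 2)

theorem sqrt_five_bounds : 2.236 < Real.sqrt 5 ∧ Real.sqrt 5 < 2.2361 :=
  ⟨Real.lt_sqrt_of_sq_lt (by norm_num), (Real.sqrt_lt' (by norm_num)).2 (by norm_num)⟩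

theorem tilt_sq : tilt ^ 2 = (Real.sqrt 5 - 1) / 2 :=
  Real.sq_sqrt (by have := sqrt_five_bounds.1; linarith)

theorem tilt_nonneg : 0 ≤ tilt := Real.sqrt_nonneg _

theorem tilt_bounds : 0.7861 < tilt ∧ tilt < 0.7862 := by
  have h := tilt_sq
  have h1 := sqrt_five_bounds.1
  have h2 := sqrt_five_bounds.2
  have h3 := tilt_nonneg
  constructor <;> by_contra! hc <;> nlinarith

/-- One of the two equations that fix the tilt: qubits in different factors, both of bias `tilt`,
keep exactly the fraction `ratio` of the value 1/2. The other one is `pairEnergy_pairDesc`. -/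
theorem one_add_tilt_sq : (1 + tilt ^ 2) / 4 = ratio / 2 := by
  rw [tilt_sq, ratio]
  ring

theorem ratio_bounds : 0.809 < ratio ∧ ratio < 0.80903 := by
  have h1 := sqrt_five_bounds.1
  have h2 := sqrt_five_bounds.2
  unfold ratio
  constructor <;> linarith

/-- `√(1 - tilt²)`. -/
theorem sq_sub_one_half : ((Real.sqrt 5 - 1) / 2) ^ 2 = 1 - tilt ^ 2 := by
  rw [tilt_sq]
  have := Real.sq_sqrt (show (0 : ℝ) ≤ 5 by norm_num)
  linarith

namespace StateDesc

/-- The two-qubit state `√((1+tilt)/2) |00⟩ + √((1-tilt)/2) |11⟩`. -/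
noncomputable def pairState (x : Fin 2 → Fin 2) : ℝ :=
  if x 0 = x 1 then if x 0 = 0 then Real.sqrt ((1 + tilt) / 2) else Real.sqrt ((1 - tilt) / 2)
  else 0

def tiltRadical : Radical :=
  .sqrt (.mul (.rat (1 / 2)) (.add (.sqrt (.rat 5)) (.rat (-1))))

/-- The off-diagonal entry is √(1 - t²)/2 with t the tilt, which simplifies to (√5-1)/4 because
(√5-1)/2 is a root of g² = 1 - g. -/
def pairMatrix (x y : Fin 2 → Fin 2) : Radical :=
  if x 0 = x 1 ∧ y 0 = y 1 then
    if x 0 = y 0 then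
      if x 0 = 0 then .mul (.rat (1 / 2)) (.add (.rat 1) tiltRadical)
      else .mul (.rat (1 / 2)) (.add (.rat 1) (.mul (.rat (-1)) tiltRadical))
    else .mul (.rat (1 / 4)) (.add (.sqrt (.rat 5)) (.rat (-1)))
  else .rat 0

/-- The three-qubit state `281 |000⟩ + 68 |110⟩ + 68 |011⟩`, which has norm `297`. -/
def tripleState (x : Fin 3 → Fin 2) : ℤ :=
  if x 1 = 0 then if x 0 = 0 ∧ x 2 = 0 then 281 else 0
  else if x 0 = x 2 then 0 else 68

def tripleMatrix (x y : Fin 3 → Fin 2) : Radical :=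
  .rat (((tripleState x * tripleState y : ℤ) : ℚ) / 88209)

def singleMatrix (x y : Fin 1 → Fin 2) : Radical := .rat (if x 0 = 0 ∧ y 0 = 0 then 1 else 0)

theorem tiltRadical_spec : tiltRadical.Legal ∧ tiltRadical.val = tilt := by
  have h1 := sqrt_five_bounds.1
  refine ⟨⟨⟨trivial, ⟨trivial, ?_⟩, trivial⟩, ?_⟩, ?_⟩
  · simp [Radical.val]
  · simp only [Radical.val]; push_cast; linarith
  · simp only [tiltRadical, Radical.val, tilt]
    push_cast
    congr 1
    ring

theorem pairMatrix_spec (x y : Fin 2 → Fin 2) :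
    (pairMatrix x y).Legal ∧ (pairMatrix x y).val = pairState x * pairState y := by
  obtain ⟨h1, h2⟩ := tiltRadical_spec
  have ht := tilt_bounds
  have h5 : (Radical.sqrt (.rat 5)).Legal := ⟨trivial, by simp [Radical.val]⟩
  have hp : (0 : ℝ) ≤ (1 + tilt) / 2 := by linarith
  have hm : (0 : ℝ) ≤ (1 - tilt) / 2 := by linarith
  have hpm : Real.sqrt ((1 + tilt) / 2) * Real.sqrt ((1 - tilt) / 2) = (Real.sqrt 5 - 1) / 4 := by
    rw [← Real.sqrt_mul hp, show (1 + tilt) / 2 * ((1 - tilt) / 2) =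
      ((Real.sqrt 5 - 1) / 4) ^ 2 by linear_combination -(1 / 4) * sq_sub_one_half]
    exact Real.sqrt_sq (by linarith [sqrt_five_bounds.1])
  unfold pairMatrix pairState
  by_cases hx : x 0 = x 1
  · by_cases hy : y 0 = y 1
    · rw [if_pos ⟨hx, hy⟩, if_pos hx, if_pos hy]
      by_cases hxy : x 0 = y 0
      · rw [if_pos hxy]
        by_cases hx0 : x 0 = 0
        · rw [if_pos hx0, if_pos hx0, if_pos (hxy ▸ hx0)]
          refine ⟨⟨trivial, trivial, h1⟩, ?_⟩
          rw [Real.mul_self_sqrt hp]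
          simp only [Radical.val, h2]
          push_cast
          ring
        · rw [if_neg hx0, if_neg hx0, if_neg (hxy ▸ hx0)]
          refine ⟨⟨trivial, trivial, trivial, h1⟩, ?_⟩
          rw [Real.mul_self_sqrt hm]
          simp only [Radical.val, h2]
          push_cast
          ring
      · rw [if_neg hxy]
        refine ⟨⟨trivial, h5, trivial⟩, ?_⟩
        have hv : (Radical.mul (.rat (1 / 4)) (.add (.sqrt (.rat 5)) (.rat (-1)))).val =
            (Real.sqrt 5 - 1) / 4 := by
          simp only [Radical.val]
          push_cast
          ring
        rw [hv]
        by_cases hx0 : x 0 = 0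
        · have hy0 : y 0 ≠ 0 := fun h => hxy (hx0.trans h.symm)
          rw [if_pos hx0, if_neg hy0, hpm]
        · have hy0 : y 0 = 0 := by
            generalize x 0 = p at *
            generalize y 0 = q at *
            omega
          rw [if_neg hx0, if_pos hy0, mul_comm, hpm]
    · simp [hy, Radical.val, Radical.Legal]
  · simp [hx, Radical.val, Radical.Legal]

theorem tripleMatrix_spec (x y : Fin 3 → Fin 2) : (tripleMatrix x y).Legal ∧
    (tripleMatrix x y).val = (tripleState x / 297 : ℝ) * (tripleState y / 297 : ℝ) :=
  ⟨trivial, by simp only [tripleMatrix, Radical.val]; push_cast; ring⟩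

theorem singleMatrix_spec (x y : Fin 1 → Fin 2) : (singleMatrix x y).Legal ∧
    (singleMatrix x y).val = (if x 0 = 0 then (1 : ℝ) else 0) * (if y 0 = 0 then 1 else 0) :=
  ⟨trivial, by simp only [singleMatrix, Radical.val]; split_ifs <;> simp_all⟩

/-- States that are at least as good as needed, up to the qubits that are matched. -/
structure Good {n : ℕ} (d : StateDesc n) : Prop extends d.Tame where
  tilt_le : ∀ i ∈ d.qubits, tilt ≤ d.bias i
  le_pairEnergy : ∀ i ∈ d.qubits, ∀ j ∈ d.qubits, i ≠ j → ratio / 2 ≤ d.pairEnergy i j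

variable {n : ℕ}

theorem Good.cross {a b : StateDesc n} (ha : a.Good) (hb : b.Good)
    (hab : Disjoint a.qubits b.qubits) {i j : Fin n} (hi : i ∈ a.qubits) (hj : j ∈ b.qubits) :
    ratio / 2 ≤ (tensor a b).pairEnergy i j := by
  rw [pairEnergy_tensor_cross ha.toTame hb.toTame hab hi hj, ← one_add_tilt_sq]
  have := mul_le_mul (ha.tilt_le i hi) (hb.tilt_le j hj) tilt_nonneg
    (tilt_nonneg.trans (ha.tilt_le i hi))
  nlinarith

theorem Good.tensor {a b : StateDesc n} (ha : a.Good) (hb : b.Good)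
    (hab : Disjoint a.qubits b.qubits) : (tensor a b).Good where
  toTame := ha.toTame.tensor hb.toTame hab
  tilt_le i hi := by
    rcases Finset.mem_union.1 hi with h | h
    · rw [bias_tensor_left ha.toTame hb.toTame hab h]
      exact ha.tilt_le i h
    · rw [bias_tensor_right ha.toTame hb.toTame hab h]
      exact hb.tilt_le i h
  le_pairEnergy i hi j hj hij := by
    rcases Finset.mem_union.1 hi with h | h <;> rcases Finset.mem_union.1 hj with h' | h'
    · rw [pairEnergy_tensor_left ha.toTame hb.toTame hab h h']
      exact ha.le_pairEnergy i h j h' hij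
    · exact ha.cross hb hab h h'
    · rw [pairEnergy_comm]
      exact ha.cross hb hab h' h
    · rw [pairEnergy_tensor_right ha.toTame hb.toTame hab h h']
      exact hb.le_pairEnergy i h j h' hij

/-- Both requirements are lower bounds on quantities linear in the state. -/
theorem Good.mix {a b : StateDesc n} (ha : a.Good) (hb : b.Good) (hab : a.qubits = b.qubits)
    {p : ℚ} (hp : 0 ≤ p) (hp' : p ≤ 1) : (mix p a b).Good where
  toTame := ha.toTame.mix hb.toTame hab hp hp'
  tilt_le i hi := by
    have h1 := ha.tilt_le i hi
    have h2 := hb.tilt_le i (hab ▸ hi)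
    have h3 : (0 : ℝ) ≤ p := by exact_mod_cast hp
    have h4 : (0 : ℝ) ≤ 1 - p := sub_nonneg.2 (by exact_mod_cast hp')
    rw [bias_mix hab]
    nlinarith
  le_pairEnergy i hi j hj hij := by
    have h1 := ha.le_pairEnergy i hi j hj hij
    have h2 := hb.le_pairEnergy i (hab ▸ hi) j (hab ▸ hj) hij
    have h3 : (0 : ℝ) ≤ p := by exact_mod_cast hp
    have h4 : (0 : ℝ) ≤ 1 - p := sub_nonneg.2 (by exact_mod_cast hp')
    rw [pairEnergy_mix hab]
    nlinarith

noncomputable def emptyDesc : StateDesc n := blockOn ![] fun _ _ => .rat 1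

noncomputable def singleDesc (u : Fin n) : StateDesc n := blockOn ![u] singleMatrix

noncomputable def pairDesc (u v : Fin n) : StateDesc n := blockOn ![u, v] pairMatrix

noncomputable def tripleDesc (u v w : Fin n) : StateDesc n := blockOn ![u, v, w] tripleMatrix

theorem qubits_blockOn {m : ℕ} {v : Fin m → Fin n} (h : Function.Injective v)
    (A : (Fin m → Fin 2) → (Fin m → Fin 2) → Radical) :
    (blockOn v A).qubits = Finset.univ.image v := by
  rw [blockOn_of_injective h, qubits_realBlock, Finset.map_eq_image]
  rfl

theorem qubits_emptyDesc : (emptyDesc : StateDesc n).qubits = ∅ := by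
  rw [emptyDesc, qubits_blockOn (Function.injective_of_subsingleton _)]
  simp

theorem good_emptyDesc : (emptyDesc : StateDesc n).Good where
  toTame := by
    rw [emptyDesc, blockOn_of_injective (Function.injective_of_subsingleton _)]
    refine tame_realBlock _ (ψ := fun _ => 1) (fun x y => ⟨trivial, by simp [Radical.val]⟩) ?_ ?_
    · simp
    · exact fun x k => k.elim0
  tilt_le i hi := by simp [qubits_emptyDesc] at hi
  le_pairEnergy i hi := by simp [qubits_emptyDesc] at hi

theorem qubits_singleDesc (u : Fin n) : (singleDesc u).qubits = {u} := by
  rw [singleDesc, qubits_blockOn (Function.injective_of_subsingleton _)]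
  ext; simp [eq_comm]

theorem good_singleDesc (u : Fin n) : (singleDesc u).Good where
  toTame := by
    rw [singleDesc, blockOn_of_injective (Function.injective_of_subsingleton _)]
    refine tame_realBlock _ singleMatrix_spec ?_ ?_
    · rw [sum_cube_one]; simp
    · intro x k b hb
      obtain rfl : k = 0 := Subsingleton.elim _ _
      simp only [Function.update_self]
      split_ifs <;> simp_all
  tilt_le i hi := by
    obtain rfl : i = u := by simpa [qubits_singleDesc] using hi
    have h := bias_realBlock ⟨![i], Function.injective_of_subsingleton _⟩ singleMatrix_spec 0
    rw [sum_cube_one] at h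
    rw [singleDesc, blockOn_of_injective (Function.injective_of_subsingleton _)]
    refine le_of_le_of_eq ?_ h.symm
    simp
    linarith [tilt_bounds.2]
  le_pairEnergy i hi j hj hij := by
    rw [qubits_singleDesc, Finset.mem_singleton] at hi hj
    exact absurd (hi.trans hj.symm) hij

theorem injective_pair {u v : Fin n} (h : u ≠ v) : Function.Injective ![u, v] := by
  intro i j
  fin_cases i <;> fin_cases j <;> simp [h, h.symm]

theorem qubits_pairDesc {u v : Fin n} (h : u ≠ v) : (pairDesc u v).qubits = {u, v} := by
  rw [pairDesc, qubits_blockOn (injective_pair h)]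
  ext i
  simp [Fin.exists_fin_two, eq_comm]

theorem pairState_values : pairState ![0, 0] * pairState ![0, 0] = (1 + tilt) / 2 ∧
    pairState ![1, 1] * pairState ![1, 1] = (1 - tilt) / 2 ∧
    pairState ![0, 0] * pairState ![1, 1] = (Real.sqrt 5 - 1) / 4 ∧
    pairState ![0, 1] = 0 ∧ pairState ![1, 0] = 0 := by
  have h1 := (pairMatrix_spec ![0, 0] ![0, 0]).2
  have h2 := (pairMatrix_spec ![1, 1] ![1, 1]).2
  have h3 := (pairMatrix_spec ![0, 0] ![1, 1]).2
  rw [← h1, ← h2, ← h3]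
  refine ⟨?_, ?_, ?_, by simp [pairState], by simp [pairState]⟩
  · simp [pairMatrix, Radical.val, tiltRadical_spec.2]
    ring
  · simp [pairMatrix, Radical.val, tiltRadical_spec.2]
    ring
  · simp [pairMatrix, Radical.val]
    ring

theorem pairSet_two (x : Fin 2 → Fin 2) (b : Fin 2) : pairSet x 0 1 b = ![b, b] := by
  funext k
  fin_cases k <;> simp [pairSet_apply]

/-- Half the square of the sum of the two amplitudes, that is (1 + √(1 - t²))/2 with t the tilt. -/
theorem pairEnergy_pairDesc {u v : Fin n} (h : u ≠ v) : (pairDesc u v).pairEnergy u v = ratio := by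
  have key := pairEnergy_realBlock ⟨![u, v], injective_pair h⟩ pairMatrix_spec 0 1
  rw [sum_cube_two] at key
  rw [pairDesc, blockOn_of_injective (injective_pair h)]
  refine key.trans ?_
  obtain ⟨h1, h2, h3, h4, h5⟩ := pairState_values
  simp only [pairSet_two, Fin.sum_univ_two, Matrix.cons_val_zero, Matrix.cons_val_one, if_true,
    h4, h5]
  simp
  rw [h1, h2, h3, mul_comm (pairState ![1, 1]), h3, ratio]
  ring

theorem good_pairDesc {u v : Fin n} (h : u ≠ v) : (pairDesc u v).Good where
  toTame := by
    obtain ⟨h1, h2, h3, h4, h5⟩ := pairState_values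
    rw [pairDesc, blockOn_of_injective (injective_pair h)]
    refine tame_realBlock _ pairMatrix_spec ?_ ?_
    · rw [sum_cube_two, h1, h2, h4, h5]
      ring
    · intro x k b hb
      unfold pairState
      by_cases hx : x 0 = x 1
      · fin_cases k
        · have : b ≠ x 1 := hx ▸ hb
          simp [this]
        · have : x 0 ≠ b := fun h => hb (by simp [← h, hx])
          simp [this]
      · simp [hx]
  tilt_le i hi := by
    obtain ⟨h1, h2, h3, h4, h5⟩ := pairState_values
    have key := bias_realBlock ⟨![u, v], injective_pair h⟩ pairMatrix_spec
    rw [qubits_pairDesc h] at hi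
    rw [pairDesc, blockOn_of_injective (injective_pair h)]
    have h0 := key 0
    have h1' := key 1
    rw [sum_cube_two] at h0 h1'
    simp [h1, h2, h4, h5] at h0 h1'
    rcases Finset.mem_insert.1 hi with rfl | hi
    · rw [h0]; linarith
    · obtain rfl := Finset.mem_singleton.1 hi
      rw [h1']; linarith
  le_pairEnergy i hi j hj hij := by
    have hr := ratio_bounds.1
    have := pairEnergy_pairDesc h
    rw [qubits_pairDesc h] at hi hj
    simp only [Finset.mem_insert, Finset.mem_singleton] at hi hj
    rcases hi with rfl | rfl <;> rcases hj with rfl | rfl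
    · exact absurd rfl hij
    · rw [this]; linarith
    · rw [pairEnergy_comm, this]; linarith
    · exact absurd rfl hij

theorem injective_triple {u v w : Fin n} (h1 : u ≠ v) (h2 : u ≠ w) (h3 : v ≠ w) :
    Function.Injective ![u, v, w] := by
  intro i j
  fin_cases i <;> fin_cases j <;> simp [h1, h1.symm, h2, h2.symm, h3, h3.symm]

theorem qubits_tripleDesc {u v w : Fin n} (h1 : u ≠ v) (h2 : u ≠ w) (h3 : v ≠ w) :
    (tripleDesc u v w).qubits = {u, v, w} := by
  rw [tripleDesc, qubits_blockOn (injective_triple h1 h2 h3)]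
  ext i
  simp [Fin.exists_fin_succ, eq_comm]

/-- The integer amplitudes satisfy 281² + 2·68² = 297², so norm, biases and energies are rational
and `decide` can evaluate the sums. The middle qubit has bias about 0.7903, just above the tilt; the
surplus at the two ends, about 0.895, is used for the edges leaving the triple. -/
theorem bias_tripleDesc {u v w : Fin n} (h1 : u ≠ v) (h2 : u ≠ w) (h3 : v ≠ w) :
    (tripleDesc u v w).bias u = 281 ^ 2 / 297 ^ 2 ∧
    (tripleDesc u v w).bias v = (281 ^ 2 - 2 * 68 ^ 2) / 297 ^ 2 ∧
    (tripleDesc u v w).bias w = 281 ^ 2 / 297 ^ 2 := by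
  have key : ∀ k, (tripleDesc u v w).bias (![u, v, w] k) = ((∑ x : Fin 3 → Fin 2,
      (if x k = 0 then 1 else -1) * (tripleState x * tripleState x) : ℤ) : ℝ) / 297 ^ 2 := by
    intro k
    rw [tripleDesc, blockOn_of_injective (injective_triple h1 h2 h3)]
    refine (bias_realBlock ⟨![u, v, w], injective_triple h1 h2 h3⟩ tripleMatrix_spec k).trans ?_
    push_cast
    rw [Finset.sum_div]
    exact Finset.sum_congr rfl fun x _ => by split_ifs <;> ring
  refine ⟨(key 0).trans ?_, (key 1).trans ?_, (key 2).trans ?_⟩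
  · rw [show (∑ x : Fin 3 → Fin 2, (if x 0 = 0 then 1 else -1) *
      (tripleState x * tripleState x)) = 281 ^ 2 by decide]
    norm_num
  · rw [show (∑ x : Fin 3 → Fin 2, (if x 1 = 0 then 1 else -1) *
      (tripleState x * tripleState x)) = 281 ^ 2 - 2 * 68 ^ 2 by decide]
    norm_num
  · rw [show (∑ x : Fin 3 → Fin 2, (if x 2 = 0 then 1 else -1) *
      (tripleState x * tripleState x)) = 281 ^ 2 by decide]
    norm_num

theorem pairEnergy_tripleDesc {u v w : Fin n} (h1 : u ≠ v) (h2 : u ≠ w) (h3 : v ≠ w) :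
    (tripleDesc u v w).pairEnergy u v = 349 ^ 2 / (2 * 297 ^ 2) ∧
    (tripleDesc u v w).pairEnergy v w = 349 ^ 2 / (2 * 297 ^ 2) ∧
    (tripleDesc u v w).pairEnergy u w = 281 ^ 2 / (2 * 297 ^ 2) := by
  have key : ∀ k l, (tripleDesc u v w).pairEnergy (![u, v, w] k) (![u, v, w] l) =
      ((∑ x : Fin 3 → Fin 2, if x k = x l then
        ∑ b, tripleState x * tripleState (pairSet x k l b) else 0 : ℤ) : ℝ) / (2 * 297 ^ 2) := by
    intro k l
    rw [tripleDesc, blockOn_of_injective (injective_triple h1 h2 h3)]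
    refine (pairEnergy_realBlock ⟨![u, v, w], injective_triple h1 h2 h3⟩ tripleMatrix_spec
      k l).trans ?_
    push_cast
    rw [Finset.sum_div]
    refine Finset.sum_congr rfl fun x _ => ?_
    split_ifs
    · simp only [Fin.sum_univ_two]
      ring
    · simp
  refine ⟨(key 0 1).trans ?_, (key 1 2).trans ?_, (key 0 2).trans ?_⟩
  · rw [show (∑ x : Fin 3 → Fin 2, if x 0 = x 1 then
      ∑ b, tripleState x * tripleState (pairSet x 0 1 b) else 0) = 349 ^ 2 by decide]
    norm_num
  · rw [show (∑ x : Fin 3 → Fin 2, if x 1 = x 2 then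
      ∑ b, tripleState x * tripleState (pairSet x 1 2 b) else 0) = 349 ^ 2 by decide]
    norm_num
  · rw [show (∑ x : Fin 3 → Fin 2, if x 0 = x 2 then
      ∑ b, tripleState x * tripleState (pairSet x 0 2 b) else 0) = 281 ^ 2 by decide]
    norm_num

theorem good_tripleDesc {u v w : Fin n} (h1 : u ≠ v) (h2 : u ≠ w) (h3 : v ≠ w) :
    (tripleDesc u v w).Good where
  toTame := by
    rw [tripleDesc, blockOn_of_injective (injective_triple h1 h2 h3)]
    refine tame_realBlock _ tripleMatrix_spec ?_ ?_
    · have h : (∑ x, tripleState x * tripleState x) = 297 ^ 2 := by decide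
      have h' : ∑ x, (tripleState x / 297 : ℝ) * (tripleState x / 297 : ℝ) =
          ((∑ x, tripleState x * tripleState x : ℤ) : ℝ) / 297 ^ 2 := by
        push_cast
        rw [Finset.sum_div]
        exact Finset.sum_congr rfl fun x _ => by ring
      rw [h', h]
      norm_num
    · have : ∀ x k b, b ≠ x k → tripleState x * tripleState (Function.update x k b) = 0 := by
        decide
      intro x k b hb
      rw [div_mul_div_comm, ← Int.cast_mul, this x k b hb]
      simp
  tilt_le i hi := by
    obtain ⟨b1, b2, b3⟩ := bias_tripleDesc h1 h2 h3
    have ht := tilt_bounds.2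
    rw [qubits_tripleDesc h1 h2 h3] at hi
    simp only [Finset.mem_insert, Finset.mem_singleton] at hi
    rcases hi with rfl | rfl | rfl
    · rw [b1]; norm_num; linarith
    · rw [b2]; norm_num; linarith
    · rw [b3]; norm_num; linarith
  le_pairEnergy i hi j hj hij := by
    obtain ⟨e1, e2, e3⟩ := pairEnergy_tripleDesc h1 h2 h3
    have hr := ratio_bounds.2
    rw [qubits_tripleDesc h1 h2 h3] at hi hj
    simp only [Finset.mem_insert, Finset.mem_singleton] at hi hj
    have e1' : ratio / 2 ≤ (tripleDesc u v w).pairEnergy u v := by rw [e1]; norm_num; linarith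
    have e2' : ratio / 2 ≤ (tripleDesc u v w).pairEnergy v w := by rw [e2]; norm_num; linarith
    have e3' : ratio / 2 ≤ (tripleDesc u v w).pairEnergy u w := by rw [e3]; norm_num; linarith
    rcases hi with rfl | rfl | rfl <;> rcases hj with rfl | rfl | rfl <;>
      first
        | exact absurd rfl hij
        | assumption
        | (rw [pairEnergy_comm]; assumption)

end StateDesc

end EPR

/-! ### Nearly perfect matchings of cycles, averaged over rotations, and permutations. -/

namespace EPR

namespace StateDesc

variable {n : ℕ}

/-! ## States on cycles -/

/-- Matched pairs `(v 0, v 1), (v 2, v 3), …`. -/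
noncomputable def pairsDesc : ℕ → (ℕ → Fin n) → StateDesc n
  | 0, _ => emptyDesc
  | k + 1, v => tensor (pairDesc (v 0) (v 1)) (pairsDesc k fun p => v (p + 2))

/-- A nearly perfect matching of the path `v 0, …, v (m-1)`, starting with a triple if `m` is
odd. -/
noncomputable def rotationDesc (m : ℕ) (v : ℕ → Fin n) : StateDesc n :=
  if m % 2 = 0 then pairsDesc (m / 2) v
  -- For `m = 1` the truncated subtraction below yields no pairs.
  else tensor (if m = 1 then singleDesc (v 0) else tripleDesc (v 0) (v 1) (v 2))
    (pairsDesc ((m - 3) / 2) fun p => v (p + 3))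

/-- The uniform mixture of `r 0, …, r (k-1)`, where `t` only fills an empty place. -/
noncomputable def mixDesc : ℕ → (ℕ → StateDesc n) → StateDesc n → StateDesc n
  | 0, _, t => t
  | k + 1, r, t => mix (1 / ((k : ℚ) + 1)) (r 0) (mixDesc k (fun p => r (p + 1)) t)

/-- The mixture over all rotations of the cycle `v 0, …, v (m-1)`. -/
noncomputable def cycleDesc (m : ℕ) (v : ℕ → Fin n) : StateDesc n :=
  mixDesc m (fun k => rotationDesc m fun p => v (k + p)) (rotationDesc m v)

theorem image_range_union (v : ℕ → Fin n) (c m : ℕ) :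
    (Finset.range c).image v ∪ (Finset.range m).image (fun p => v (p + c)) =
      (Finset.range (m + c)).image v := by
  ext i
  simp only [Finset.mem_union, Finset.mem_image, Finset.mem_range]
  constructor
  · rintro (⟨p, hp, rfl⟩ | ⟨p, hp, rfl⟩)
    · exact ⟨p, by omega, rfl⟩
    · exact ⟨p + c, by omega, rfl⟩
  · rintro ⟨p, hp, rfl⟩
    by_cases h : p < c
    · exact Or.inl ⟨p, h, rfl⟩
    · exact Or.inr ⟨p - c, by omega, by rw [Nat.sub_add_cancel (not_lt.1 h)]⟩

theorem disjoint_image_range {v : ℕ → Fin n} {c m : ℕ} (hv : Set.InjOn v (Set.Iio (m + c))) :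
    Disjoint ((Finset.range c).image v) ((Finset.range m).image fun p => v (p + c)) := by
  rw [Finset.disjoint_left]
  intro i hi hi'
  simp only [Finset.mem_image, Finset.mem_range] at hi hi'
  obtain ⟨p, hp, rfl⟩ := hi
  obtain ⟨q, hq, hqp⟩ := hi'
  have := hv (Set.mem_Iio.2 (by omega)) (Set.mem_Iio.2 (by omega)) hqp
  omega

theorem injOn_add {v : ℕ → Fin n} {c m : ℕ} (hv : Set.InjOn v (Set.Iio (m + c))) :
    Set.InjOn (fun p => v (p + c)) (Set.Iio m) := by
  intro p hp q hq h
  have hp' : p < m := hp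
  have hq' : q < m := hq
  have := hv (Set.mem_Iio.2 (by omega)) (Set.mem_Iio.2 (by omega)) h
  omega

theorem ne_of_injOn {v : ℕ → Fin n} {m p q : ℕ} (hv : Set.InjOn v (Set.Iio m)) (hp : p < m)
    (hq : q < m) (hpq : p ≠ q) : v p ≠ v q :=
  fun h => hpq (hv hp hq h)

theorem pairsDesc_spec (k : ℕ) {v : ℕ → Fin n} (hv : Set.InjOn v (Set.Iio (2 * k))) :
    (pairsDesc k v).qubits = (Finset.range (2 * k)).image v ∧ (pairsDesc k v).Good ∧
      ∀ p < k, (pairsDesc k v).pairEnergy (v (2 * p)) (v (2 * p + 1)) = ratio := by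
  induction k generalizing v with
  | zero => exact ⟨by simp [pairsDesc, qubits_emptyDesc], good_emptyDesc, by simp⟩
  | succ k ih =>
    obtain ⟨h1, h2, h3⟩ := ih (injOn_add (c := 2) hv)
    have hne : v 0 ≠ v 1 := ne_of_injOn hv (by omega) (by omega) (by omega)
    have hq : (pairDesc (v 0) (v 1)).qubits = (Finset.range 2).image v := by
      rw [qubits_pairDesc hne]
      simp [Finset.range_add_one, Finset.pair_comm]
    have hd : Disjoint (pairDesc (v 0) (v 1)).qubits (pairsDesc k fun p => v (p + 2)).qubits := by
      rw [hq, h1]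
      exact disjoint_image_range hv
    have hg := good_pairDesc hne
    refine ⟨?_, hg.tensor h2 hd, fun p hp => ?_⟩
    · rw [pairsDesc, qubits, hq, h1, image_range_union]
      rfl
    · rw [pairsDesc]
      cases p with
      | zero =>
        rw [pairEnergy_tensor_left hg.toTame h2.toTame hd, ← pairEnergy_pairDesc hne]
        · rw [qubits_pairDesc hne]; simp
        · rw [qubits_pairDesc hne]; simp
      | succ p =>
        rw [pairEnergy_tensor_right hg.toTame h2.toTame hd, ← h3 p (by omega)]
        · rw [show 2 * (p + 1) = 2 * p + 2 by ring, show 2 * p + 2 + 1 = 2 * p + 1 + 2 by ring]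
        · rw [h1]
          exact Finset.mem_image.2 ⟨2 * p, Finset.mem_range.2 (by omega), rfl⟩
        · rw [h1]
          exact Finset.mem_image.2 ⟨2 * p + 1, Finset.mem_range.2 (by omega), rfl⟩

/-- Lower bound for the energy of the edge `v p, v (p+1)` of a cycle of length `m` in the state
`rotationDesc m v`. -/
noncomputable def edgeBound (m p : ℕ) : ℝ :=
  -- For `m = 2` the second edge runs back along the matched pair.
  if m % 2 = 0 then if p % 2 = 0 ∨ m = 2 then ratio else ratio / 2
  else if p < 2 then 349 ^ 2 / (2 * 297 ^ 2)
  -- Here the remaining edge joins the two ends of the triple.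
  else if m = 3 then 281 ^ 2 / (2 * 297 ^ 2)
  -- An edge between an end of the triple and a qubit of a pair, which has bias at least `tilt`.
  else if p = 2 ∨ p + 1 = m then (1 + 281 ^ 2 / 297 ^ 2 * tilt) / 4
  else if p % 2 = 1 then ratio else ratio / 2

theorem rotationDesc_even {m : ℕ} (hm : m % 2 = 0) {v : ℕ → Fin n}
    (hv : Set.InjOn v (Set.Iio m)) :
    (rotationDesc m v).qubits = (Finset.range m).image v ∧ (rotationDesc m v).Good ∧
      (v m = v 0 → ∀ p < m, edgeBound m p ≤ (rotationDesc m v).pairEnergy (v p) (v (p + 1))) := by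
  obtain ⟨k, rfl⟩ : ∃ k, m = 2 * k := ⟨m / 2, by omega⟩
  obtain ⟨h1, h2, h3⟩ := pairsDesc_spec k hv
  have hrot : rotationDesc (2 * k) v = pairsDesc k v := by simp [rotationDesc]
  rw [hrot]
  refine ⟨h1, h2, fun hper p hp => ?_⟩
  have hmem : ∀ q < 2 * k, v q ∈ (pairsDesc k v).qubits := fun q hq => by
    rw [h1]; exact Finset.mem_image_of_mem v (Finset.mem_range.2 hq)
  simp only [edgeBound, hm, if_true]
  by_cases hp0 : p % 2 = 0
  · obtain ⟨q, rfl⟩ : ∃ q, p = 2 * q := ⟨p / 2, by omega⟩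
    simp only [hp0, true_or, if_true]
    exact (h3 q (by omega)).ge
  · by_cases hk : 2 * k = 2
    · obtain rfl : k = 1 := by omega
      obtain rfl : p = 1 := by omega
      have := h3 0 (by omega)
      simp only [or_true, if_true]
      rw [hper, pairEnergy_comm]
      exact this.ge
    · simp only [hp0, hk, or_self, if_false]
      by_cases hlast : p + 1 = 2 * k
      · rw [hlast, hper]
        exact h2.le_pairEnergy _ (hmem p hp) _ (hmem 0 (by omega))
          (ne_of_injOn hv hp (by omega) (by omega))
      · exact h2.le_pairEnergy _ (hmem p hp) _ (hmem (p + 1) (by omega))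
          (ne_of_injOn hv hp (by omega) (by omega))

theorem rotationDesc_one (v : ℕ → Fin n) :
    (rotationDesc 1 v).qubits = (Finset.range 1).image v ∧ (rotationDesc 1 v).Good := by
  have hrot : rotationDesc 1 v = tensor (singleDesc (v 0)) emptyDesc := by
    simp [rotationDesc, pairsDesc]
  rw [hrot]
  refine ⟨?_, (good_singleDesc _).tensor good_emptyDesc ?_⟩
  · rw [qubits, qubits_singleDesc, qubits_emptyDesc]
    simp
  · rw [qubits_emptyDesc]
    simp

theorem rotationDesc_odd (k : ℕ) {v : ℕ → Fin n} (hv : Set.InjOn v (Set.Iio (2 * k + 3))) :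
    (rotationDesc (2 * k + 3) v).qubits = (Finset.range (2 * k + 3)).image v ∧
      (rotationDesc (2 * k + 3) v).Good ∧
      (v (2 * k + 3) = v 0 → ∀ p < 2 * k + 3,
        edgeBound (2 * k + 3) p ≤ (rotationDesc (2 * k + 3) v).pairEnergy (v p) (v (p + 1))) := by
  obtain ⟨h1, h2, h3⟩ := pairsDesc_spec k (injOn_add (c := 3) hv)
  have hrot : rotationDesc (2 * k + 3) v =
      tensor (tripleDesc (v 0) (v 1) (v 2)) (pairsDesc k fun p => v (p + 3)) := by
    have e1 : (2 * k + 3) % 2 ≠ 0 := by omega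
    have e2 : 2 * k + 3 ≠ 1 := by omega
    simp only [rotationDesc, e1, e2, if_false]
    rw [show (2 * k + 3 - 3) / 2 = k by omega]
  have n01 : v 0 ≠ v 1 := ne_of_injOn hv (by omega) (by omega) (by omega)
  have n02 : v 0 ≠ v 2 := ne_of_injOn hv (by omega) (by omega) (by omega)
  have n12 : v 1 ≠ v 2 := ne_of_injOn hv (by omega) (by omega) (by omega)
  set a := tripleDesc (v 0) (v 1) (v 2) with ha
  set b := pairsDesc k fun p => v (p + 3) with hb
  have hga : a.Good := good_tripleDesc n01 n02 n12
  have hqa : a.qubits = (Finset.range 3).image v := by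
    rw [ha, qubits_tripleDesc n01 n02 n12]
    ext i
    simp [Finset.range_add_one]
    tauto
  have hd : Disjoint a.qubits b.qubits := by
    rw [hqa, h1]
    exact disjoint_image_range hv
  have ma : ∀ p < 3, v p ∈ a.qubits := fun p hp => by
    rw [hqa]; exact Finset.mem_image_of_mem v (Finset.mem_range.2 hp)
  have mb : ∀ p < 2 * k, v (p + 3) ∈ b.qubits := fun p hp => by
    rw [h1]; exact Finset.mem_image.2 ⟨p, Finset.mem_range.2 hp, rfl⟩
  obtain ⟨b0, -, b2⟩ := bias_tripleDesc n01 n02 n12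
  obtain ⟨e01, e12, e02⟩ := pairEnergy_tripleDesc n01 n02 n12
  have hodd : (2 * k + 3) % 2 ≠ 0 := by omega
  rw [hrot]
  refine ⟨?_, hga.tensor h2 hd, fun hper p hp => ?_⟩
  · rw [qubits, hqa, h1, image_range_union]
  · simp only [edgeBound, hodd, if_false]
    by_cases hp2 : p < 2
    · rw [if_pos hp2, pairEnergy_tensor_left hga.toTame h2.toTame hd (ma p (by omega))
        (ma (p + 1) (by omega))]
      obtain rfl | rfl : p = 0 ∨ p = 1 := by omega
      · exact e01.ge
      · exact e12.ge
    rw [if_neg hp2]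
    by_cases hk : 2 * k + 3 = 3
    · obtain rfl : k = 0 := by omega
      obtain rfl : p = 2 := by omega
      rw [if_pos hk]
      rw [show v (2 + 1) = v 0 from hper, pairEnergy_tensor_left hga.toTame h2.toTame hd
        (ma 2 (by omega)) (ma 0 (by omega)), pairEnergy_comm]
      exact e02.ge
    rw [if_neg hk]
    by_cases hps : p = 2
    · subst hps
      have hm := mb 0 (by omega)
      rw [if_pos (Or.inl rfl), pairEnergy_tensor_cross hga.toTame h2.toTame hd (ma 2 (by omega))
        hm, b2]
      have := h2.tilt_le _ hm
      gcongr
    by_cases hlast : p + 1 = 2 * k + 3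
    · have hm := mb (p - 3) (by omega)
      rw [show p - 3 + 3 = p by omega] at hm
      rw [if_pos (Or.inr hlast), hlast, hper, pairEnergy_comm,
        pairEnergy_tensor_cross hga.toTame h2.toTame hd (ma 0 (by omega)) hm, b0]
      have := h2.tilt_le _ hm
      gcongr
    rw [if_neg (by tauto)]
    have hm := mb (p - 3) (by omega)
    have hm' := mb (p + 1 - 3) (by omega)
    rw [show p - 3 + 3 = p by omega] at hm
    rw [show p + 1 - 3 + 3 = p + 1 by omega] at hm'
    rw [pairEnergy_tensor_right hga.toTame h2.toTame hd hm hm']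
    split_ifs with hp1
    · have := h3 ((p - 3) / 2) (by omega)
      rw [show 2 * ((p - 3) / 2) + 3 = p by omega,
        show 2 * ((p - 3) / 2) + 1 + 3 = p + 1 by omega] at this
      exact this.ge
    · exact h2.le_pairEnergy _ hm _ hm' (ne_of_injOn hv hp (by omega) (by omega))

theorem rotationDesc_spec {m : ℕ} (hm : 1 ≤ m) {v : ℕ → Fin n} (hv : Set.InjOn v (Set.Iio m)) :
    (rotationDesc m v).qubits = (Finset.range m).image v ∧ (rotationDesc m v).Good ∧
      (2 ≤ m → v m = v 0 → ∀ p < m,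
        edgeBound m p ≤ (rotationDesc m v).pairEnergy (v p) (v (p + 1))) := by
  by_cases h0 : m % 2 = 0
  · obtain ⟨h1, h2, h3⟩ := rotationDesc_even h0 hv
    exact ⟨h1, h2, fun _ => h3⟩
  · by_cases h1 : m = 1
    · subst h1
      obtain ⟨h1, h2⟩ := rotationDesc_one v
      exact ⟨h1, h2, by omega⟩
    · obtain ⟨k, rfl⟩ : ∃ k, m = 2 * k + 3 := ⟨(m - 3) / 2, by omega⟩
      obtain ⟨h1, h2, h3⟩ := rotationDesc_odd k hv
      exact ⟨h1, h2, fun _ => h3⟩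

/-- Lower bound for the energy of the edges of a cycle of length `m`. -/
noncomputable def cycleBound (m : ℕ) : ℝ := if m = 2 then ratio else 3 / 4 * ratio

theorem sum_alternating (k : ℕ) (f : ℕ → ℝ) (hf : ∀ p < 2 * k, (if p % 2 = 0 then ratio
    else ratio / 2) ≤ f p) : 3 / 2 * ratio * k ≤ ∑ p ∈ Finset.range (2 * k), f p := by
  induction k with
  | zero => simp
  | succ k ih =>
    rw [show 2 * (k + 1) = 2 * k + 1 + 1 by ring, Finset.sum_range_succ, Finset.sum_range_succ]
    have h1 := ih fun p hp => hf p (by omega)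
    have h2 := hf (2 * k) (by omega)
    have h3 := hf (2 * k + 1) (by omega)
    rw [if_pos (by omega)] at h2
    rw [if_neg (by omega)] at h3
    push_cast
    linarith

/-- For even m > 2 the values r and r/2 alternate, with average exactly 3r/4. For m = 3 the sum is
about 1.828, while 9r/4 is about 1.820. For odd m ≥ 5, once the alternating part is accounted for,
the four edges touching the triple must supply 11r/4, about 2.225, and supply about 2.233. -/
theorem sum_edgeBound {m : ℕ} (hm : 2 ≤ m) :
    m * cycleBound m ≤ ∑ p ∈ Finset.range m, edgeBound m p := by
  have hr := ratio_bounds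
  have ht := tilt_bounds
  by_cases h0 : m % 2 = 0
  · obtain ⟨k, rfl⟩ : ∃ k, m = 2 * k := ⟨m / 2, by omega⟩
    by_cases hk : k = 1
    · subst hk
      simp [cycleBound, edgeBound]
    · have : 2 * k ≠ 2 := by omega
      have key := sum_alternating k (edgeBound (2 * k)) fun p hp => by
        simp only [edgeBound, h0, if_true, this, or_false]
        exact le_rfl
      simp only [cycleBound, this, if_false]
      push_cast
      linarith
  · obtain ⟨k, rfl⟩ : ∃ k, m = 2 * k + 3 := ⟨(m - 3) / 2, by omega⟩
    have hne : 2 * k + 3 ≠ 2 := by omega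
    have hodd : (2 * k + 3) % 2 = 1 := by omega
    simp only [cycleBound, hne, if_false]
    cases k with
    | zero =>
      simp [edgeBound, Finset.sum_range_succ]
      norm_num
      linarith
    | succ k =>
      have hne3 : 2 * (k + 1) + 3 ≠ 3 := by omega
      have e0 : ∀ p < 2, edgeBound (2 * (k + 1) + 3) p = 349 ^ 2 / (2 * 297 ^ 2) := by
        intro p hp
        simp [edgeBound, hodd, hp]
      have e2 : edgeBound (2 * (k + 1) + 3) 2 = (1 + 281 ^ 2 / 297 ^ 2 * tilt) / 4 := by
        simp [edgeBound, hodd]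
      have elast : edgeBound (2 * (k + 1) + 3) (3 + (2 * k + 1)) =
          (1 + 281 ^ 2 / 297 ^ 2 * tilt) / 4 := by
        have h1 : ¬ 3 + (2 * k + 1) < 2 := by omega
        have h2 : 3 + (2 * k + 1) = 2 ∨ 3 + (2 * k + 1) + 1 = 2 * (k + 1) + 3 := by omega
        have h3 : ¬ (2 * (k + 1) + 3) % 2 = 0 := by omega
        rw [edgeBound, if_neg h3, if_neg h1, if_neg hne3, if_pos h2]
      have key := sum_alternating (k + 1) (fun p => if p = 2 * k + 1 then ratio / 2 else
          edgeBound (2 * (k + 1) + 3) (3 + p)) fun p hp => by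
        by_cases hpk : p = 2 * k + 1
        · simp [hpk]
        · have h1 : ¬ 3 + p < 2 := by omega
          have h2 : ¬ (3 + p = 2 ∨ 3 + p + 1 = 2 * (k + 1) + 3) := by omega
          have h3 : ¬ (2 * (k + 1) + 3) % 2 = 0 := by omega
          rw [if_neg hpk, edgeBound, if_neg h3, if_neg h1, if_neg hne3, if_neg h2]
          apply le_of_eq
          congr 1
          exact propext (by omega)
      rw [show Finset.range (2 * (k + 1)) = Finset.range (2 * k + 1 + 1) from rfl,
        Finset.sum_range_succ] at key
      rw [show 2 * (k + 1) + 3 = 3 + (2 * k + 1 + 1) by ring, Finset.sum_range_add,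
        Finset.sum_range_succ _ (2 * k + 1), Finset.sum_range_succ, Finset.sum_range_succ,
        Finset.sum_range_one]
      rw [show 3 + (2 * k + 1 + 1) = 2 * (k + 1) + 3 by ring, e0 0 (by omega), e0 1 (by omega), e2,
        elast]
      have hcongr : ∑ p ∈ Finset.range (2 * k + 1), (if p = 2 * k + 1 then ratio / 2 else
          edgeBound (2 * (k + 1) + 3) (3 + p)) =
          ∑ p ∈ Finset.range (2 * k + 1), edgeBound (2 * (k + 1) + 3) (3 + p) :=
        Finset.sum_congr rfl fun p hp => if_neg (by have := Finset.mem_range.1 hp; omega)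
      rw [hcongr] at key
      simp only [if_true] at key
      push_cast at key ⊢
      norm_num
      linarith

/-- The first state gets weight 1/(k+1) and the uniform mixture of the others the rest; the
innermost weight is 1, so the filler `t` has weight 0 as soon as there is a state to mix. -/
theorem mixDesc_spec {S : Finset (Fin n)} (k : ℕ) {r : ℕ → StateDesc n} {t : StateDesc n}
    (hr : ∀ p < k, (r p).Good ∧ (r p).qubits = S) (ht : t.Good ∧ t.qubits = S) :
    (mixDesc k r t).Good ∧ (mixDesc k r t).qubits = S ∧
      ∀ i j, k * (mixDesc k r t).pairEnergy i j =
        ∑ p ∈ Finset.range k, (r p).pairEnergy i j := by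
  induction k generalizing r with
  | zero => exact ⟨ht.1, ht.2, by simp⟩
  | succ k ih =>
    obtain ⟨h1, h2, h3⟩ := ih (r := fun p => r (p + 1)) fun p hp => hr (p + 1) (by omega)
    obtain ⟨hr0, hq0⟩ := hr 0 (by omega)
    have hq : (r 0).qubits = (mixDesc k (fun p => r (p + 1)) t).qubits := hq0.trans h2.symm
    refine ⟨hr0.mix h1 hq (by positivity) ?_, hq0, fun i j => ?_⟩
    · rw [div_le_one (by positivity)]
      simp
    · rw [Finset.sum_range_succ', mixDesc, pairEnergy_mix hq, ← h3]
      push_cast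
      have : ((k : ℝ) + 1) ≠ 0 := by positivity
      field_simp
      ring

/-- In the rotation starting at k, the edge at a has position a - k modulo m. Over all rotations it
takes every position once, so its energy is at least the average of `edgeBound`. -/
theorem cycleDesc_spec {m : ℕ} (hm : 1 ≤ m) {v : ℕ → Fin n} (hv : Set.InjOn v (Set.Iio m))
    (hper : ∀ p, v (p + m) = v p) :
    (cycleDesc m v).Good ∧ (cycleDesc m v).qubits = (Finset.range m).image v ∧
      (2 ≤ m → ∀ a < m, cycleBound m ≤ (cycleDesc m v).pairEnergy (v a) (v (a + 1))) := by
  have hinj : ∀ k < m, Set.InjOn (fun p => v (k + p)) (Set.Iio m) := by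
    intro k hk p hp q hq h
    have hp' : p < m := hp
    have hq' : q < m := hq
    have hred : ∀ p < m, v (k + p) = v (if k + p < m then k + p else k + p - m) := by
      intro p hp
      split_ifs with h
      · rfl
      · rw [← hper (k + p - m), Nat.sub_add_cancel (not_lt.1 h)]
    simp only at h
    rw [hred p hp', hred q hq'] at h
    have h' := hv (Set.mem_Iio.2 (by split_ifs <;> omega)) (Set.mem_Iio.2 (by split_ifs <;> omega))
      h
    split_ifs at h' <;> omega
  have himg : ∀ k < m, (Finset.range m).image (fun p => v (k + p)) = (Finset.range m).image v := by
    intro k hk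
    apply Finset.eq_of_subset_of_card_le
    · intro i hi
      simp only [Finset.mem_image, Finset.mem_range] at hi ⊢
      obtain ⟨p, hp, rfl⟩ := hi
      by_cases h : k + p < m
      · exact ⟨k + p, h, rfl⟩
      · exact ⟨k + p - m, by omega, by
          rw [← hper (k + p - m), Nat.sub_add_cancel (not_lt.1 h)]⟩
    · rw [Finset.card_image_of_injOn (s := Finset.range m) (f := fun p => v (k + p))
        (by simpa using hinj k hk)]
      exact Finset.card_image_le
  have hrot : ∀ k < m, (rotationDesc m fun p => v (k + p)).Good ∧
      (rotationDesc m fun p => v (k + p)).qubits = (Finset.range m).image v := by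
    intro k hk
    obtain ⟨h1, h2, -⟩ := rotationDesc_spec hm (hinj k hk)
    exact ⟨h2, h1.trans (himg k hk)⟩
  have hrot0 := hrot 0 (by omega)
  simp only [zero_add] at hrot0
  obtain ⟨h1, h2, h3⟩ := mixDesc_spec m hrot hrot0
  refine ⟨h1, h2, fun hm2 a ha => ?_⟩
  have hm0 : (0 : ℝ) < m := by exact_mod_cast hm
  refine le_of_mul_le_mul_left ?_ hm0
  unfold cycleDesc
  rw [h3]
  refine (sum_edgeBound hm2).trans ?_
  -- The map taking k to a - k modulo m is its own inverse on the positions.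
  rw [← Finset.sum_nbij' (i := fun k => if k ≤ a then a - k else a + m - k)
    (j := fun k => if k ≤ a then a - k else a + m - k)
    (f := fun k => edgeBound m (if k ≤ a then a - k else a + m - k))
    (s := Finset.range m)]
  · refine Finset.sum_le_sum fun k hk => ?_
    have hk' := Finset.mem_range.1 hk
    obtain ⟨-, -, h4⟩ := rotationDesc_spec hm (hinj k hk')
    have h5 := h4 hm2 (by rw [hper k, add_zero]) (if k ≤ a then a - k else a + m - k)
      (by split_ifs <;> omega)
    split_ifs at h5 ⊢ with hka
    · rw [show k + (a - k) = a by omega, show k + (a - k + 1) = a + 1 by omega] at h5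
      exact h5
    · rw [show k + (a + m - k) = a + m by omega,
        show k + (a + m - k + 1) = a + 1 + m by omega, hper, hper] at h5
      exact h5
  · intro k hk
    have := Finset.mem_range.1 hk
    rw [Finset.mem_range]
    split_ifs <;> omega
  · intro k hk
    have := Finset.mem_range.1 hk
    rw [Finset.mem_range]
    split_ifs <;> omega
  · intro k hk
    have := Finset.mem_range.1 hk
    split_ifs <;> omega
  · intro k hk
    have := Finset.mem_range.1 hk
    split_ifs <;> omega
  · intro k hk
    rfl

noncomputable def tensorList : List (StateDesc n) → StateDesc n
  | [] => emptyDesc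
  | c :: l => tensor c (tensorList l)

theorem tensorList_spec {l : List (StateDesc n)} (hg : ∀ c ∈ l, c.Good)
    (hd : l.Pairwise fun c c' => Disjoint c.qubits c'.qubits) :
    (tensorList l).Good ∧ (∀ i, i ∈ (tensorList l).qubits ↔ ∃ c ∈ l, i ∈ c.qubits) ∧
      ∀ c ∈ l, ∀ i ∈ c.qubits, ∀ j ∈ c.qubits,
        (tensorList l).pairEnergy i j = c.pairEnergy i j := by
  induction l with
  | nil => exact ⟨good_emptyDesc, by simp [tensorList, qubits_emptyDesc], by simp⟩
  | cons c l ih =>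
    rw [List.pairwise_cons] at hd
    obtain ⟨h1, h2, h3⟩ := ih (fun c hc => hg c (List.mem_cons_of_mem _ hc)) hd.2
    have hc := hg c List.mem_cons_self
    have hdis : Disjoint c.qubits (tensorList l).qubits := by
      rw [Finset.disjoint_left]
      intro i hi hi'
      obtain ⟨c', hc', hic'⟩ := (h2 i).1 hi'
      exact Finset.disjoint_left.1 (hd.1 c' hc') hi hic'
    refine ⟨hc.tensor h1 hdis, fun i => ?_, fun c' hc' i hi j hj => ?_⟩
    · simp [tensorList, qubits, h2]
    · rcases List.mem_cons.1 hc' with rfl | hc'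
      · exact pairEnergy_tensor_left hc.toTame h1.toTame hdis hi hj
      · rw [← h3 c' hc' i hi j hj]
        exact pairEnergy_tensor_right hc.toTame h1.toTame hdis ((h2 i).2 ⟨c', hc', hi⟩)
          ((h2 j).2 ⟨c', hc', hj⟩)

/-! ## The state of a permutation -/

/-- The smallest elements of the cycles of a permutation. -/
noncomputable def cycleHeads (σ : Equiv.Perm (Fin n)) : List (Fin n) :=
  open scoped Classical in (List.finRange n).filter fun r => ∀ k, r ≤ σ^[k] r

noncomputable def permDesc (σ : Equiv.Perm (Fin n)) : StateDesc n :=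
  tensorList ((cycleHeads σ).map fun r => cycleDesc (Function.minimalPeriod σ r) fun p => σ^[p] r)

theorem minimalPeriod_perm_pos (σ : Equiv.Perm (Fin n)) (r : Fin n) :
    0 < Function.minimalPeriod σ r :=
  Function.minimalPeriod_pos_of_mem_periodicPts (σ.injective.mem_periodicPts r)

theorem cycleDesc_orbit (σ : Equiv.Perm (Fin n)) (r : Fin n) :
    (cycleDesc (Function.minimalPeriod σ r) fun p => σ^[p] r).Good ∧
    (∀ i, i ∈ (cycleDesc (Function.minimalPeriod σ r) fun p => σ^[p] r).qubits ↔
      ∃ k, σ^[k] r = i) ∧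
    ∀ k, σ^[k + 1] r ≠ σ^[k] r → cycleBound (Function.minimalPeriod σ r) ≤
      (cycleDesc (Function.minimalPeriod σ r) fun p => σ^[p] r).pairEnergy
        (σ^[k] r) (σ^[k + 1] r) := by
  have hpos := minimalPeriod_perm_pos σ r
  have hper : ∀ p, σ^[p + Function.minimalPeriod σ r] r = σ^[p] r := by
    intro p
    rw [Function.iterate_add_apply, Function.iterate_minimalPeriod]
  obtain ⟨h1, h2, h3⟩ := cycleDesc_spec hpos (v := fun p => σ^[p] r)
    Function.iterate_injOn_Iio_minimalPeriod hper
  refine ⟨h1, fun i => ?_, fun k hk => ?_⟩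
  · rw [h2, Finset.mem_image]
    constructor
    · rintro ⟨p, -, h⟩
      exact ⟨p, h⟩
    · rintro ⟨k, rfl⟩
      exact ⟨k % Function.minimalPeriod σ r, Finset.mem_range.2 (Nat.mod_lt _ hpos),
        Function.iterate_mod_minimalPeriod_eq⟩
  · have hm : 2 ≤ Function.minimalPeriod σ r := by
      by_contra hlt
      have : Function.minimalPeriod σ r = 1 := by omega
      rw [this] at hper
      exact hk (hper k)
    have := h3 hm (k % Function.minimalPeriod σ r) (Nat.mod_lt _ hpos)
    simp only [Function.iterate_succ_apply', Function.iterate_mod_minimalPeriod_eq] at this ⊢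
    exact this

theorem sameCycle_iff_iterate (σ : Equiv.Perm (Fin n)) (r i : Fin n) :
    σ.SameCycle r i ↔ ∃ k, σ^[k] r = i := by
  constructor
  · intro h
    obtain ⟨k, -, -, hk⟩ := h.exists_pow_eq''
    exact ⟨k, by rw [Equiv.Perm.iterate_eq_pow, hk]⟩
  · rintro ⟨k, rfl⟩
    exact ⟨k, by rw [Equiv.Perm.iterate_eq_pow]; rfl⟩

theorem mem_cycleHeads (σ : Equiv.Perm (Fin n)) (r : Fin n) :
    r ∈ cycleHeads σ ↔ ∀ k, r ≤ σ^[k] r := by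
  simp [cycleHeads]

theorem exists_cycleHead (σ : Equiv.Perm (Fin n)) (i : Fin n) :
    ∃ r ∈ cycleHeads σ, σ.SameCycle r i := by
  classical
  have hne : (Finset.univ.filter fun r => σ.SameCycle i r).Nonempty :=
    ⟨i, Finset.mem_filter.2 ⟨Finset.mem_univ _, Equiv.Perm.SameCycle.refl _ _⟩⟩
  obtain ⟨r, hr, hmin⟩ := Finset.exists_min_image _ id hne
  simp only [Finset.mem_filter, Finset.mem_univ, true_and, id] at hr hmin
  exact ⟨r, (mem_cycleHeads σ r).2 fun k =>
    hmin _ (hr.trans ((sameCycle_iff_iterate σ _ _).2 ⟨k, rfl⟩)), hr.symm⟩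

/-- A transposed pair collects both indicators, and its cycle has length 2, with energy at least
`ratio`. An edge of a longer cycle collects one indicator and has at least 3/4 of `ratio`; all other
pairs only need `Good`. -/
theorem permDesc_spec (σ : Equiv.Perm (Fin n)) :
    (permDesc σ).Good ∧ (permDesc σ).qubits = Finset.univ ∧
      ∀ i j, i ≠ j → ratio / 2 + ratio / 4 *
        ((if σ i = j then 1 else 0) + (if σ j = i then 1 else 0)) ≤
          (permDesc σ).pairEnergy i j := by
  have hrepr : ∀ r ∈ cycleHeads σ, ∀ r' ∈ cycleHeads σ, σ.SameCycle r r' → r = r' := by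
    intro r hr r' hr' h
    rw [mem_cycleHeads] at hr hr'
    obtain ⟨k, hk⟩ := (sameCycle_iff_iterate σ _ _).1 h
    obtain ⟨k', hk'⟩ := (sameCycle_iff_iterate σ _ _).1 h.symm
    exact le_antisymm (hk ▸ hr k) (hk' ▸ hr' k')
  have hnodup : (cycleHeads σ).Nodup := (List.nodup_finRange n).filter _
  obtain ⟨h1, h2, h3⟩ := tensorList_spec (l := (cycleHeads σ).map fun r =>
      cycleDesc (Function.minimalPeriod σ r) fun p => σ^[p] r)
    (by
      intro c hc
      obtain ⟨r, -, rfl⟩ := List.mem_map.1 hc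
      exact (cycleDesc_orbit σ r).1)
    (by
      rw [List.pairwise_map]
      refine List.Pairwise.imp_of_mem ?_ hnodup
      intro r r' hr hr' hne
      rw [Finset.disjoint_left]
      intro i hi hi'
      rw [(cycleDesc_orbit σ r).2.1, ← sameCycle_iff_iterate] at hi
      rw [(cycleDesc_orbit σ r').2.1, ← sameCycle_iff_iterate] at hi'
      exact hne (hrepr r hr r' hr' (hi.trans hi'.symm)))
  have hq : (permDesc σ).qubits = Finset.univ := by
    ext i
    simp only [Finset.mem_univ, iff_true]
    obtain ⟨r, hr, hri⟩ := exists_cycleHead σ i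
    exact (h2 i).2 ⟨_, List.mem_map_of_mem hr,
      ((cycleDesc_orbit σ r).2.1 i).2 ((sameCycle_iff_iterate σ _ _).1 hri)⟩
  refine ⟨h1, hq, ?_⟩
  have hr0 := ratio_bounds.1
  have hedge : ∀ i, σ i ≠ i → (if σ (σ i) = i then ratio else 3 / 4 * ratio) ≤
      (permDesc σ).pairEnergy i (σ i) := by
    intro i hi
    obtain ⟨r, hr, hri⟩ := exists_cycleHead σ i
    obtain ⟨k, rfl⟩ := (sameCycle_iff_iterate σ _ _).1 hri
    obtain ⟨g1, g2, g3⟩ := cycleDesc_orbit σ r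
    have h5 := g3 k (by rwa [Function.iterate_succ_apply'])
    rw [← h3 _ (List.mem_map_of_mem hr) _ ((g2 _).2 ⟨k, rfl⟩) _ ((g2 _).2 ⟨k + 1, rfl⟩),
      Function.iterate_succ_apply'] at h5
    refine le_trans ?_ h5
    unfold cycleBound
    split_ifs with hs hm hm
    · exact le_rfl
    · exfalso
      -- σ² fixes the k-th iterate of r, hence r itself, since the iterates of σ are injective.
      have hdvd : Function.minimalPeriod σ r ∣ 2 := by
        apply Function.IsPeriodicPt.minimalPeriod_dvd
        have : σ^[k] (σ (σ r)) = σ^[k] r := by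
          rw [← Function.iterate_succ_apply, ← Function.iterate_succ_apply,
            Function.iterate_succ_apply' σ, Function.iterate_succ_apply' σ, hs]
        exact (σ.injective.iterate k) this
      have h1' : Function.minimalPeriod σ r ≠ 1 := by
        intro h1'
        rw [Function.minimalPeriod_eq_one_iff_isFixedPt] at h1'
        apply hi
        rw [← Function.iterate_succ_apply' σ, Function.iterate_succ_apply, h1'.eq]
      have := Nat.le_of_dvd (by omega) hdvd
      have := minimalPeriod_perm_pos σ r
      omega
    · linarith
    · exact le_rfl
  intro i j hij
  by_cases h4 : σ i = j
  · subst h4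
    have := hedge i (Ne.symm hij)
    simp only [if_true]
    split_ifs at this ⊢ <;> linarith
  · by_cases h5 : σ j = i
    · subst h5
      have := hedge j hij
      rw [if_neg h4] at this ⊢
      rw [pairEnergy_comm]
      simp only [if_true]
      linarith
    · simp only [h4, h5, if_false]
      have := h1.le_pairEnergy i (by
        rw [show tensorList _ = permDesc σ from rfl, hq]; simp) j (by
        rw [show tensorList _ = permDesc σ from rfl, hq]; simp) hij
      rw [show tensorList _ = permDesc σ from rfl] at this
      linarith

theorem energy_permDesc (I : Instance) (σ : Equiv.Perm (Fin I.n)) :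
    ratio * (1 / 2 * (∑ i, ∑ j ∈ Finset.Ioi i, (I.w i j : ℝ)) +
      1 / 4 * ∑ i, if σ i = i then 0 else (I.w i (σ i) : ℝ)) ≤
        energy (permDesc σ).toOp I.ham := by
  obtain ⟨-, hq, h⟩ := permDesc_spec σ
  rw [energy_ham hq]
  -- Each arc from i to σ(i) is charged to its unordered pair, using the symmetry of the weights.
  have h1 : ∑ i, (if σ i = i then 0 else (I.w i (σ i) : ℝ)) =
      ∑ i, ∑ j ∈ Finset.Ioi i, (I.w i j : ℝ) *
        ((if σ i = j then 1 else 0) + (if σ j = i then 1 else 0)) := by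
    have h2 : ∀ i j, (I.w i j : ℝ) * ((if σ i = j then 1 else 0) + (if σ j = i then 1 else 0)) =
        (I.w i j : ℝ) * (if σ i = j then 1 else 0) +
          (I.w j i : ℝ) * (if σ j = i then 1 else 0) := by
      intro i j
      rw [mul_add, I.symm.apply i j]
    simp only [h2]
    rw [sum_Ioi_add_swap fun i j => (I.w i j : ℝ) * (if σ i = j then 1 else 0)]
    refine Finset.sum_congr rfl fun i _ => ?_
    simp only [mul_ite, mul_one, mul_zero, Finset.sum_ite_eq, Finset.mem_erase, Finset.mem_univ,
      and_true]
    by_cases hi : σ i = i <;> simp [hi]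
  rw [h1]
  have h3 : ratio * (1 / 2 * (∑ i, ∑ j ∈ Finset.Ioi i, (I.w i j : ℝ)) +
      1 / 4 * ∑ i, ∑ j ∈ Finset.Ioi i, (I.w i j : ℝ) *
        ((if σ i = j then 1 else 0) + (if σ j = i then 1 else 0))) =
      ∑ i, ∑ j ∈ Finset.Ioi i, (I.w i j : ℝ) * (ratio / 2 + ratio / 4 *
        ((if σ i = j then 1 else 0) + (if σ j = i then 1 else 0))) := by
    simp only [Finset.mul_sum, ← Finset.sum_add_distrib]
    exact Finset.sum_congr rfl fun i _ => Finset.sum_congr rfl fun j _ => by ring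
  rw [h3]
  refine Finset.sum_le_sum fun i _ => Finset.sum_le_sum fun j hj => ?_
  have := h i j (Finset.mem_Ioi.1 hj).ne
  gcongr

end StateDesc

end EPR

/-! ### The primal-dual method for the assignment problem: invariants. -/

namespace EPR

/-! ## Reasoning about programs -/

theorem loop_induct {α : Type} {f : ℕ → α → α} {n : ℕ} {a : α} (P : ℕ → α → Prop) (h0 : P 0 a)
    (hs : ∀ i < n, ∀ a, P i a → P (i + 1) (f i a)) : P n (loop f n a) := by
  induction n with
  | zero => exact h0
  | succ n ih => exact hs n (Nat.lt_succ_self n) _ (ih fun i hi => hs i (by omega))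

@[simp] theorem Store.setVar_var (h : Store) (x v y : ℕ) :
    (h.setVar x v).var y = if y = x then v else h.var y := by
  simp [Store.setVar, Function.update_apply]

@[simp] theorem Store.setVar_arr (h : Store) (x v : ℕ) : (h.setVar x v).arr = h.arr := rfl

@[simp] theorem Store.setVar_out (h : Store) (x v : ℕ) : (h.setVar x v).out = h.out := rfl

@[simp] theorem Store.setArr_var (h : Store) (A : Fin 16) (i v : ℕ) :
    (h.setArr A i v).var = h.var := rfl

@[simp] theorem Store.setArr_arr (h : Store) (A B : Fin 16) (i v : ℕ) :
    (h.setArr A i v).arr B = if B = A then Function.update (h.arr A) i v else h.arr B := by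
  simp [Store.setArr, Function.update_apply]

def Cmd.setsVar (x : ℕ) : Cmd → Bool
  | .set y _ => x == y
  | .seq c c' => c.setsVar x || c'.setsVar x
  | .ifLt _ _ c c' => c.setsVar x || c'.setsVar x
  | .forN y c => x == y || c.setsVar x
  | _ => false

def Cmd.setsArr (A : Fin 16) : Cmd → Bool
  | .put B _ _ => A == B
  | .seq c c' => c.setsArr A || c'.setsArr A
  | .ifLt _ _ c c' => c.setsArr A || c'.setsArr A
  | .forN _ c => c.setsArr A
  | _ => false

def Cmd.writes : Cmd → Bool
  | .write _ => true
  | .seq c c' => c.writes || c'.writes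
  | .ifLt _ _ c c' => c.writes || c'.writes
  | .forN _ c => c.writes
  | _ => false

variable {inp : List ℕ}

theorem Cmd.eval_var {x : ℕ} {c : Cmd} (hc : c.setsVar x = false) (h : Store) :
    (c.eval inp h).var x = h.var x := by
  induction c generalizing h with
  | skip => rfl
  | set y e =>
    have : x ≠ y := by simpa [Cmd.setsVar] using hc
    simp [Cmd.eval, this]
  | put A i e => rfl
  | write e => rfl
  | seq c c' ih ih' =>
    simp only [Cmd.setsVar, Bool.or_eq_false_iff] at hc
    simp only [Cmd.eval]
    rw [ih' hc.2, ih hc.1]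
  | ifLt a b c c' ih ih' =>
    simp only [Cmd.setsVar, Bool.or_eq_false_iff] at hc
    simp only [Cmd.eval]
    split_ifs
    · exact ih hc.1 h
    · exact ih' hc.2 h
  | forN y c ih =>
    simp only [Cmd.setsVar, Bool.or_eq_false_iff, beq_eq_false_iff_ne] at hc
    refine loop_induct (fun _ (g : Store) => g.var x = h.var x) rfl fun i _ g hg => ?_
    rw [ih hc.2]
    simpa [hc.1] using hg

theorem Cmd.eval_arr {A : Fin 16} {c : Cmd} (hc : c.setsArr A = false) (h : Store) :
    (c.eval inp h).arr A = h.arr A := by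
  induction c generalizing h with
  | skip => rfl
  | set y e => rfl
  | put B i e =>
    have : A ≠ B := by simpa [Cmd.setsArr] using hc
    simp [Cmd.eval, this]
  | write e => rfl
  | seq c c' ih ih' =>
    simp only [Cmd.setsArr, Bool.or_eq_false_iff] at hc
    simp only [Cmd.eval]
    rw [ih' hc.2, ih hc.1]
  | ifLt a b c c' ih ih' =>
    simp only [Cmd.setsArr, Bool.or_eq_false_iff] at hc
    simp only [Cmd.eval]
    split_ifs
    · exact ih hc.1 h
    · exact ih' hc.2 h
  | forN y c ih =>
    refine loop_induct (fun _ (g : Store) => g.arr A = h.arr A) rfl fun i _ g hg => ?_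
    rw [ih hc]
    exact hg

theorem Cmd.eval_out {c : Cmd} (hc : c.writes = false) (h : Store) :
    (c.eval inp h).out = h.out := by
  induction c generalizing h with
  | skip => rfl
  | set y e => rfl
  | put B i e => rfl
  | write e => simp [Cmd.writes] at hc
  | seq c c' ih ih' =>
    simp only [Cmd.writes, Bool.or_eq_false_iff] at hc
    simp only [Cmd.eval]
    rw [ih' hc.2, ih hc.1]
  | ifLt a b c c' ih ih' =>
    simp only [Cmd.writes, Bool.or_eq_false_iff] at hc
    simp only [Cmd.eval]
    split_ifs
    · exact ih hc.1 h
    · exact ih' hc.2 h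
  | forN y c ih =>
    refine loop_induct (fun _ (g : Store) => g.out = h.out) rfl fun i _ g hg => ?_
    rw [ih hc]
    exact hg

/-! ## The Hungarian method: invariants

Rows and columns are numbered from `0`; the entries of `RM` and `CM` are the partners plus one, or
`0` for unmatched rows and columns. The dual variables are `-P` and `V`. -/

/-- The rows below `r` are matched along tight edges. -/
structure Matched (n : ℕ) (C : ℕ → ℕ → ℕ) (P V RM CM : ℕ → ℕ) (r : ℕ) : Prop where
  feasible : ∀ i < n, ∀ j < n, P i ≤ C i j + V j
  row : ∀ i < r, ∃ j < n, RM i = j + 1 ∧ CM j = i + 1 ∧ P i = C i j + V j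
  col : ∀ j < n, CM j ≠ 0 → ∃ i < r, CM j = i + 1 ∧ RM i = j + 1
  free : ∀ i, r ≤ i → RM i = 0

/-- The rows `S` and columns `T` form a tree of alternating paths from row `r`. -/
structure Tree (n : ℕ) (C : ℕ → ℕ → ℕ) (P V RM CM S T PAR : ℕ → ℕ) (r k : ℕ) (ord : ℕ → ℕ) :
    Prop where
  mem_row : ∀ i < n, S i ≠ 0 ↔ i = r ∨ ∃ j < n, T j ≠ 0 ∧ CM j = i + 1
  parent : ∀ j < n, T j ≠ 0 → PAR j < n ∧ S (PAR j) ≠ 0 ∧ P (PAR j) = C (PAR j) j + V j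
  rank : ∀ j < n, T j ≠ 0 → ord j < k ∧
    (PAR j = r ∨ ∃ j' < n, T j' ≠ 0 ∧ RM (PAR j) = j' + 1 ∧ ord j' < ord j)

/-- Flipping an alternating path: column `cur` is still to be given to its parent. -/
structure Flipping (n : ℕ) (C : ℕ → ℕ → ℕ) (P V RM CM T PAR : ℕ → ℕ) (r cur : ℕ)
    (ord : ℕ → ℕ) : Prop where
  feasible : ∀ i < n, ∀ j < n, P i ≤ C i j + V j
  cur_lt : cur < n
  cur_mem : T cur ≠ 0
  row : ∀ i < r, ∃ j < n, j ≠ cur ∧ RM i = j + 1 ∧ CM j = i + 1 ∧ P i = C i j + V j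
  -- The entry of `CM` at `cur` may be stale: it may still name the row that has just moved to
  -- another column.
  col : ∀ j < n, j ≠ cur → CM j ≠ 0 → ∃ i < r, CM j = i + 1 ∧ RM i = j + 1
  free : ∀ i, r ≤ i → RM i = 0
  tight : ∀ j < n, T j ≠ 0 → P (PAR j) = C (PAR j) j + V j
  -- Restricted to columns of rank at most that of `cur`, because flipping changes the partners of
  -- parents of later columns.
  rank : ∀ j < n, T j ≠ 0 → ord j ≤ ord cur →
    (PAR j = r ∨ ∃ j' < n, T j' ≠ 0 ∧ RM (PAR j) = j' + 1 ∧ ord j' < ord j)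

variable {n r k : ℕ} {C : ℕ → ℕ → ℕ} {P V RM CM S T PAR ord : ℕ → ℕ}

/-- If all n columns were matched, their partners would inject them into the r < n matched rows. -/
theorem Matched.exists_free (h : Matched n C P V RM CM r) (hr : r < n) : ∃ j < n, CM j = 0 := by
  by_contra! hc
  have : (Finset.range n).card ≤ (Finset.range r).card := by
    refine Finset.card_le_card_of_injOn (fun j => CM j - 1) (fun j hj => ?_)
      (fun j hj j' hj' heq => ?_)
    · have hj := Finset.mem_range.1 hj
      obtain ⟨i, hi, h1, -⟩ := h.col j hj (hc j hj)
      simp only [Finset.coe_range, Set.mem_Iio]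
      omega
    · have hj := Finset.mem_range.1 hj
      have hj' := Finset.mem_range.1 hj'
      obtain ⟨i, hi, h1, h2⟩ := h.col j hj (hc j hj)
      obtain ⟨i', hi', h1', h2'⟩ := h.col j' hj' (hc j' hj')
      have : i = i' := by
        simp only at heq
        omega
      subst this
      omega
  simp at this
  omega

theorem Tree.init (hS : ∀ i < n, S i ≠ 0 ↔ i = r) (hT : ∀ j < n, T j = 0) :
    Tree n C P V RM CM S T PAR r 0 ord where
  mem_row i hi := by
    rw [hS i hi]
    refine ⟨Or.inl, fun h => h.elim id ?_⟩
    rintro ⟨j, hj, h1, -⟩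
    exact absurd (hT j hj) h1
  parent j hj h := absurd (hT j hj) h
  rank j hj h := absurd (hT j hj) h

/-- Matched partners are in the tree together, so a dual shift leaves matched edges tight. -/
theorem Matched.mem_tree_iff (hm : Matched n C P V RM CM r)
    (ht : Tree n C P V RM CM S T PAR r k ord) (hr : r < n) {i j : ℕ} (hi : i < r) (hj : j < n)
    (hRM : RM i = j + 1) (hCM : CM j = i + 1) : S i ≠ 0 ↔ T j ≠ 0 := by
  rw [ht.mem_row i (by omega)]
  constructor
  · rintro (h | ⟨j', hj', h1, h2⟩)
    · omega
    · obtain ⟨i', hi', h3, h4⟩ := hm.col j' hj' (by omega)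
      have : i' = i := by omega
      subst this
      have : j' = j := by omega
      exact this ▸ h1
  · exact fun h => Or.inr ⟨j, hj, h, hCM⟩

/-- The dual variables are moved by `δ` along the tree. -/
theorem Matched.shift (hm : Matched n C P V RM CM r)
    (ht : Tree n C P V RM CM S T PAR r k ord) (hr : r < n) {δ : ℕ} {P' V' : ℕ → ℕ}
    (hP : ∀ i < n, P' i = if S i ≠ 0 then P i + δ else P i)
    (hV : ∀ j < n, V' j = if T j ≠ 0 then V j + δ else V j)
    (hδ : ∀ i < n, ∀ j < n, S i ≠ 0 → T j = 0 → δ ≤ C i j + V j - P i) :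
    Matched n C P' V' RM CM r where
  -- Slack is lost only on edges from a tree row to a column outside the tree, and δ is at most
  -- their slack; by the old feasibility the truncated subtraction in `hδ` is exact.
  feasible i hi j hj := by
    have h1 := hm.feasible i hi j hj
    have h2 := hδ i hi j hj
    rw [hP i hi, hV j hj]
    by_cases hS : S i = 0 <;> by_cases hT : T j = 0 <;> simp [hS, hT] at h2 ⊢ <;> omega
  row i hi := by
    obtain ⟨j, hj, h1, h2, h3⟩ := hm.row i hi
    refine ⟨j, hj, h1, h2, ?_⟩
    have := hm.mem_tree_iff ht hr hi hj h1 h2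
    rw [hP i (by omega), hV j hj]
    by_cases hT : T j = 0
    · have hS : S i = 0 := by tauto
      simp [hS, hT, h3]
    · have hS : S i ≠ 0 := by tauto
      simp [hS, hT, h3]
      omega
  col := hm.col
  free := hm.free

/-- A tight edge from the tree to a new column. -/
theorem Tree.extend (hm : Matched n C P V RM CM r) (ht : Tree n C P V RM CM S T PAR r k ord)
    {δ a b : ℕ} {P' V' S' T' PAR' : ℕ → ℕ} (ha : a < n) (hb : b < n)
    (hSa : S a ≠ 0) (hTb : T b = 0) (hδ : δ = C a b + V b - P a)
    (hP : ∀ i < n, P' i = if S i ≠ 0 then P i + δ else P i)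
    (hV : ∀ j < n, V' j = if T j ≠ 0 then V j + δ else V j)
    (hT : ∀ j, T' j = if j = b then 1 else T j)
    (hPAR : ∀ j, PAR' j = if j = b then a else PAR j)
    (hS : ∀ i < n, S' i ≠ 0 ↔ S i ≠ 0 ∨ CM b = i + 1) :
    Tree n C P' V' RM CM S' T' PAR' r (k + 1) (Function.update ord b k) where
  mem_row i hi := by
    rw [hS i hi, ht.mem_row i hi]
    constructor
    · rintro ((h | ⟨j, hj, h1, h2⟩) | h)
      · exact Or.inl h
      · exact Or.inr ⟨j, hj, by rw [hT]; split_ifs <;> simp [h1], h2⟩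
      · exact Or.inr ⟨b, hb, by simp [hT], h⟩
    · rintro (h | ⟨j, hj, h1, h2⟩)
      · exact Or.inl (Or.inl h)
      · rw [hT] at h1
        by_cases hjb : j = b
        · subst hjb
          exact Or.inr h2
        · rw [if_neg hjb] at h1
          exact Or.inl (Or.inr ⟨j, hj, h1, h2⟩)
  parent j hj h := by
    rw [hT] at h
    rw [hPAR]
    by_cases hjb : j = b
    · subst hjb
      rw [if_pos rfl]
      refine ⟨ha, (hS a ha).2 (Or.inl hSa), ?_⟩
      have := hm.feasible a ha j hj
      rw [hP a ha, hV j hj, if_pos hSa, if_neg (not_not.2 hTb)]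
      omega
    · rw [if_neg hjb] at h ⊢
      obtain ⟨h1, h2, h3⟩ := ht.parent j hj h
      refine ⟨h1, (hS _ h1).2 (Or.inl h2), ?_⟩
      rw [hP _ h1, hV j hj, if_pos h2, if_pos h]
      omega
  -- The new column receives rank `k`, above all ranks given so far; its parent is the root or was
  -- brought in by an earlier column.
  rank j hj h := by
    rw [hT] at h
    rw [hPAR]
    by_cases hjb : j = b
    · subst hjb
      rw [if_pos rfl, Function.update_self]
      refine ⟨Nat.lt_succ_self k, ?_⟩
      rcases (ht.mem_row a ha).1 hSa with h1 | ⟨j', hj', h1, h2⟩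
      · exact Or.inl h1
      · have hne : j' ≠ j := fun h => h1 (h ▸ hTb)
        refine Or.inr ⟨j', hj', by rwa [hT, if_neg hne], ?_, ?_⟩
        · obtain ⟨i, hi, h3, h4⟩ := hm.col j' hj' (by omega)
          have : i = a := by omega
          exact this ▸ h4
        · rw [Function.update_of_ne hne]
          exact (ht.rank j' hj' h1).1
    · rw [if_neg hjb] at h ⊢
      rw [Function.update_of_ne hjb]
      obtain ⟨h1, h2⟩ := ht.rank j hj h
      refine ⟨by omega, h2.imp id ?_⟩
      rintro ⟨j', hj', h3, h4, h5⟩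
      have hne : j' ≠ b := fun h => h3 (h ▸ hTb)
      exact ⟨j', hj', by rwa [hT, if_neg hne], h4, by rwa [Function.update_of_ne hne]⟩

theorem Tree.flipping (hm : Matched n C P V RM CM r) (ht : Tree n C P V RM CM S T PAR r k ord)
    {cur : ℕ} (hc : cur < n) (hT : T cur ≠ 0) (hCM : CM cur = 0) :
    Flipping n C P V RM CM T PAR r cur ord where
  feasible := hm.feasible
  cur_lt := hc
  cur_mem := hT
  row i hi := by
    obtain ⟨j, hj, h1, h2, h3⟩ := hm.row i hi
    exact ⟨j, hj, by rintro rfl; omega, h1, h2, h3⟩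
  col j hj _ h := hm.col j hj h
  free := hm.free
  tight j hj h := (ht.parent j hj h).2.2
  rank j hj h _ := (ht.rank j hj h).2

/-- A parent without a partner can only be the root, since any other parent was brought in by a
column matched to it. -/
theorem Flipping.finish {cur : ℕ} (hf : Flipping n C P V RM CM T PAR r cur ord)
    (hRM : RM (PAR cur) = 0) :
    Matched n C P V (Function.update RM (PAR cur) (cur + 1))
      (Function.update CM cur (PAR cur + 1)) (r + 1) := by
  have hpar : PAR cur = r := by
    rcases hf.rank cur hf.cur_lt hf.cur_mem le_rfl with h | ⟨j, -, -, h, -⟩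
    · exact h
    · omega
  rw [hpar]
  have htight := hf.tight cur hf.cur_lt hf.cur_mem
  rw [hpar] at htight
  refine ⟨hf.feasible, fun i hi => ?_, fun j hj h => ?_, fun i hi => ?_⟩
  · by_cases hir : i = r
    · subst hir
      exact ⟨cur, hf.cur_lt, by simp, by simp, htight⟩
    · obtain ⟨j, hj, h1, h2, h3, h4⟩ := hf.row i (by omega)
      exact ⟨j, hj, by rw [Function.update_of_ne hir, h2], by rw [Function.update_of_ne h1, h3], h4⟩
  · by_cases hjc : j = cur
    · subst hjc
      exact ⟨r, by omega, by simp, by simp⟩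
    · rw [Function.update_of_ne hjc] at h ⊢
      obtain ⟨i, hi, h1, h2⟩ := hf.col j hj hjc h
      exact ⟨i, by omega, h1, by rw [Function.update_of_ne (by omega), h2]⟩
  · rw [Function.update_of_ne (by omega)]
    exact hf.free i (by omega)

/-- The parent takes `cur` and gives up its old column, whose smaller rank makes the process
terminate. -/
theorem Flipping.next {cur : ℕ} (hf : Flipping n C P V RM CM T PAR r cur ord)
    (hRM : RM (PAR cur) ≠ 0) :
    Flipping n C P V (Function.update RM (PAR cur) (cur + 1))
      (Function.update CM cur (PAR cur + 1)) T PAR r (RM (PAR cur) - 1) ord ∧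
      ord (RM (PAR cur) - 1) < ord cur := by
  have hir : PAR cur < r := by
    by_contra hc
    exact hRM (hf.free _ (not_lt.1 hc))
  obtain ⟨j', hj', h1, h2, h3⟩ : ∃ j' < n, T j' ≠ 0 ∧ RM (PAR cur) = j' + 1 ∧ ord j' < ord cur := by
    rcases hf.rank cur hf.cur_lt hf.cur_mem le_rfl with h | h
    · omega
    · exact h
  set i := PAR cur with hi
  obtain ⟨j'', hj'', g1, g2, g3, g4⟩ := hf.row i hir
  obtain rfl : j'' = j' := by omega
  rw [h2, Nat.add_sub_cancel]
  refine ⟨⟨hf.feasible, hj', h1, fun l hl => ?_, fun j hj hne h => ?_, fun l hl => ?_, hf.tight,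
    fun j hj hT hle => ?_⟩, h3⟩
  · by_cases hli : l = i
    · subst hli
      exact ⟨cur, hf.cur_lt, fun h => g1 h.symm, by simp, by simp, hf.tight cur hf.cur_lt hf.cur_mem⟩
    · obtain ⟨j, hj, e1, e2, e3, e4⟩ := hf.row l hl
      refine ⟨j, hj, ?_, by rw [Function.update_of_ne hli, e2],
        by rw [Function.update_of_ne e1, e3], e4⟩
      rintro rfl
      omega
  · by_cases hjc : j = cur
    · subst hjc
      exact ⟨i, hir, by simp, by simp⟩
    · rw [Function.update_of_ne hjc] at h ⊢
      obtain ⟨l, hl, e1, e2⟩ := hf.col j hj hjc h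
      have : l ≠ i := by rintro rfl; omega
      exact ⟨l, hl, e1, by rw [Function.update_of_ne this, e2]⟩
  · rw [Function.update_of_ne (by omega)]
    exact hf.free l hl
  · rcases hf.rank j hj hT (by omega) with h | ⟨l, hl, e1, e2, e3⟩
    · exact Or.inl h
    · refine Or.inr ⟨l, hl, e1, ?_, e3⟩
      -- If `i` were the parent of `j`, then `j''` would have smaller rank than `j`, against the
      -- restriction to ranks up to that of the new current column.
      have : PAR j ≠ i := by
        intro h
        rw [h] at e2
        have : l = j'' := by omega
        subst this
        omega
      rw [Function.update_of_ne this, e2]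

end EPR

namespace EPR

/-! ## The Hungarian method: program

Arrays: `0` costs (row by row), `1` the dual variables `P`, `2` the dual variables `V`, `3` partners
of rows, `4` partners of columns, `5` rows of the tree, `6` columns of the tree, `7` parents.
Variables: `0` root, `2` and `3` loop variables for rows and columns, `4` whether there is a path
to flip, `5` to `8` whether a candidate edge is known, its slack, row and column, `9` slack,
`10` current column, `11` current row, `12` next column plus one. -/

namespace Hungarian

def cost (x y : ℕ) : Expr := .get 0 (.add (.mulInp (.var x) (.const 0)) (.var y))

def record : Cmd :=
  .seq (.set 5 (.const 1)) (.seq (.set 6 (.var 9)) (.seq (.set 7 (.var 2)) (.set 8 (.var 3))))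

def searchStep : Cmd :=
  .ifLt (.const 0) (.get 5 (.var 2))
    (.ifLt (.get 6 (.var 3)) (.const 1)
      (.seq (.set 9 (.sub (.add (cost 2 3) (.get 2 (.var 3))) (.get 1 (.var 2))))
        (.ifLt (.var 5) (.const 1) record (.ifLt (.var 9) (.var 6) record .skip)))
      .skip)
    .skip

def search : Cmd := .seq (.set 5 (.const 0)) (.forN 2 (.forN 3 searchStep))

def shiftStep : Cmd :=
  .seq
    (.ifLt (.const 0) (.get 5 (.var 2)) (.put 1 (.var 2) (.add (.get 1 (.var 2)) (.var 6))) .skip)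
    (.ifLt (.const 0) (.get 6 (.var 2)) (.put 2 (.var 2) (.add (.get 2 (.var 2)) (.var 6))) .skip)

def shift : Cmd := .forN 2 shiftStep

def extend : Cmd :=
  .seq (.put 6 (.var 8) (.const 1)) (.seq (.put 7 (.var 8) (.var 7))
    (.ifLt (.get 4 (.var 8)) (.const 1) (.seq (.set 4 (.const 1)) (.set 10 (.var 8)))
      (.put 5 (.sub (.get 4 (.var 8)) (.const 1)) (.const 1))))

def grow : Cmd := .ifLt (.var 4) (.const 1) (.seq search (.seq shift extend)) .skip

def flip : Cmd :=
  .ifLt (.const 0) (.var 4)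
    (.seq (.set 11 (.get 7 (.var 10))) (.seq (.set 12 (.get 3 (.var 11)))
      (.seq (.put 3 (.var 11) (.add (.var 10) (.const 1)))
        (.seq (.put 4 (.var 10) (.add (.var 11) (.const 1)))
          (.ifLt (.const 0) (.var 12) (.set 10 (.sub (.var 12) (.const 1)))
            (.set 4 (.const 0)))))))
    .skip

def initTree : Cmd :=
  .seq (.forN 2 (.seq (.put 5 (.var 2) (.const 0)) (.put 6 (.var 2) (.const 0))))
    (.seq (.put 5 (.var 0) (.const 1)) (.set 4 (.const 0)))

def phase : Cmd := .seq initTree (.seq (.forN 1 grow) (.forN 1 flip))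

def solve : Cmd := .forN 0 phase

variable {inp : List ℕ} {n : ℕ}

/-- The best of the edges in `Q` that leave the tree is known. -/
def Searched (n : ℕ) (g : Store) (Q : ℕ → ℕ → Prop) (h : Store) : Prop :=
  (h.var 5 = 0 ∧ ∀ i j, Q i j → g.arr 5 i ≠ 0 → g.arr 6 j ≠ 0) ∨
  (h.var 5 ≠ 0 ∧ h.var 7 < n ∧ h.var 8 < n ∧ g.arr 5 (h.var 7) ≠ 0 ∧ g.arr 6 (h.var 8) = 0 ∧
    h.var 6 = g.arr 0 (h.var 7 * n + h.var 8) + g.arr 2 (h.var 8) - g.arr 1 (h.var 7) ∧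
    ∀ i j, Q i j → g.arr 5 i ≠ 0 → g.arr 6 j = 0 →
      h.var 6 ≤ g.arr 0 (i * n + j) + g.arr 2 j - g.arr 1 i)

theorem searched_step (hn : inp.getD 0 0 = n) {g h : Store} {Q Q' : ℕ → ℕ → Prop} {i j : ℕ}
    (hi : i < n) (hj : j < n) (harr : h.arr = g.arr) (h2 : h.var 2 = i) (h3 : h.var 3 = j)
    (hs : Searched n g Q h) (hQ : ∀ a b, Q' a b → Q a b ∨ a = i ∧ b = j) :
    Searched n g Q' (searchStep.eval inp h) := by
  subst h2 h3
  by_cases hS : g.arr 5 (h.var 2) = 0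
  · have : searchStep.eval inp h = h := by
      simp [searchStep, Cmd.eval, Expr.eval, harr, hS]
    rw [this]
    rcases hs with ⟨h1, h4⟩ | ⟨h1, h4, h5, h6, h7, h8, h9⟩
    · refine Or.inl ⟨h1, fun a b hab => ?_⟩
      rcases hQ a b hab with h | ⟨rfl, rfl⟩
      · exact h4 a b h
      · exact fun h => absurd hS h
    · refine Or.inr ⟨h1, h4, h5, h6, h7, h8, fun a b hab => ?_⟩
      rcases hQ a b hab with h | ⟨rfl, rfl⟩
      · exact h9 a b h
      · exact fun h => absurd hS h
  by_cases hT : g.arr 6 (h.var 3) = 0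
  swap
  · have : searchStep.eval inp h = h := by
      simp [searchStep, Cmd.eval, Expr.eval, harr, hT]
    rw [this]
    rcases hs with ⟨h1, h4⟩ | ⟨h1, h4, h5, h6, h7, h8, h9⟩
    · refine Or.inl ⟨h1, fun a b hab => ?_⟩
      rcases hQ a b hab with h | ⟨rfl, rfl⟩
      · exact h4 a b h
      · exact fun _ => hT
    · refine Or.inr ⟨h1, h4, h5, h6, h7, h8, fun a b hab => ?_⟩
      rcases hQ a b hab with h | ⟨rfl, rfl⟩
      · exact h9 a b h
      · exact fun _ h => absurd h hT
  have hcost : (cost 2 3).eval inp h = g.arr 0 (h.var 2 * n + h.var 3) := by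
    simp only [cost, Expr.eval, harr, hn]
  set s := g.arr 0 (h.var 2 * n + h.var 3) + g.arr 2 (h.var 3) - g.arr 1 (h.var 2) with hsdef
  have heval : searchStep.eval inp h =
      if h.var 5 < 1 then record.eval inp (h.setVar 9 s) else
        if s < h.var 6 then record.eval inp (h.setVar 9 s) else h.setVar 9 s := by
    simp only [searchStep, Cmd.eval, Expr.eval, hcost, harr, hT, Nat.pos_of_ne_zero hS, if_true,
      Nat.lt_one_iff, Store.setVar_var, hsdef]
    rfl
  have hrec : ∀ Q'' : ℕ → ℕ → Prop, (∀ a b, Q'' a b → g.arr 5 a ≠ 0 → g.arr 6 b = 0 →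
      s ≤ g.arr 0 (a * n + b) + g.arr 2 b - g.arr 1 a) →
      Searched n g Q'' (record.eval inp (h.setVar 9 s)) := by
    intro Q'' hmin
    right
    simpa [record, Cmd.eval, Expr.eval, hS, hT, hi, hj] using ⟨hsdef, hmin⟩
  rw [heval]
  rcases hs with ⟨h1, h4⟩ | ⟨h1, h4, h5, h6, h7, h8, h9⟩
  · rw [if_pos (by omega)]
    refine hrec _ fun a b hab ha hb => ?_
    rcases hQ a b hab with h | ⟨rfl, rfl⟩
    · exact absurd hb (h4 a b h ha)
    · exact le_rfl
  · rw [if_neg (by omega)]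
    split_ifs with hlt
    · refine hrec _ fun a b hab ha hb => ?_
      rcases hQ a b hab with h | ⟨rfl, rfl⟩
      · exact hlt.le.trans (h9 a b h ha hb)
      · exact le_rfl
    · right
      simp only [Store.setVar_var]
      refine ⟨h1, h4, h5, h6, h7, h8, fun a b hab ha hb => ?_⟩
      rcases hQ a b hab with h | ⟨rfl, rfl⟩
      · exact h9 a b h ha hb
      · exact not_lt.1 hlt

theorem eval_arr_eq {c : Cmd} (hc : ∀ A, c.setsArr A = false) (h : Store) :
    (c.eval inp h).arr = h.arr :=
  funext fun A => Cmd.eval_arr (hc A) h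

theorem search_spec (hn : inp.getD 0 0 = n) (g : Store) :
    Searched n g (fun i j => i < n ∧ j < n) (search.eval inp g) := by
  have harr : ∀ A, searchStep.setsArr A = false := by decide
  have h2 : searchStep.setsVar 2 = false := by decide
  have h3 : searchStep.setsVar 3 = false := by decide
  simp only [search, Cmd.eval, Expr.eval, hn]
  have hinit : Searched n g (fun i j => i < 0 ∧ j < n) (g.setVar 5 0) :=
    Or.inl ⟨by simp, by simp⟩
  refine (loop_induct (fun i h => h.arr = g.arr ∧ Searched n g (fun a b => a < i ∧ b < n) h)
    ⟨rfl, hinit⟩ ?_).2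
  rintro i hi h ⟨ha, hs⟩
  have := loop_induct (f := fun j h => searchStep.eval inp (h.setVar 3 j)) (n := n)
    (a := h.setVar 2 i)
    (fun j h => h.arr = g.arr ∧ h.var 2 = i ∧
      Searched n g (fun a b => a < i ∧ b < n ∨ a = i ∧ b < j) h)
    ⟨ha, by simp, by simpa [Searched] using hs⟩ (by
      rintro j hj h' ⟨ha', hv', hs'⟩
      refine ⟨?_, ?_, ?_⟩
      · rw [eval_arr_eq harr, Store.setVar_arr, ha']
      · rw [Cmd.eval_var h2]
        simpa using hv'
      · refine searched_step hn hi hj ha' (by simpa using hv') (by simp)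
          (by simpa [Searched] using hs') ?_
        rintro a b (h | ⟨rfl, h⟩)
        · exact Or.inl (Or.inl h)
        · rcases Nat.lt_succ_iff_lt_or_eq.1 h with h | h
          · exact Or.inl (Or.inr ⟨rfl, h⟩)
          · exact Or.inr ⟨rfl, h⟩)
  refine ⟨this.1, ?_⟩
  have h4 := this.2.2
  have : (fun a b => a < i ∧ b < n ∨ a = i ∧ b < n) = fun a b => a < i + 1 ∧ b < n := by
    funext a b
    apply propext
    omega
  rw [this] at h4
  exact h4

theorem shift_spec (hn : inp.getD 0 0 = n) (g : Store) :
    (∀ i < n, (shift.eval inp g).arr 1 i =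
      if g.arr 5 i ≠ 0 then g.arr 1 i + g.var 6 else g.arr 1 i) ∧
    ∀ i < n, (shift.eval inp g).arr 2 i =
      if g.arr 6 i ≠ 0 then g.arr 2 i + g.var 6 else g.arr 2 i := by
  have := loop_induct (f := fun i h => shiftStep.eval inp (h.setVar 2 i)) (n := n) (a := g)
    (fun k h => h.arr 5 = g.arr 5 ∧ h.arr 6 = g.arr 6 ∧ h.var 6 = g.var 6 ∧
      (∀ i, h.arr 1 i = if i < k ∧ g.arr 5 i ≠ 0 then g.arr 1 i + g.var 6 else g.arr 1 i) ∧
      ∀ i, h.arr 2 i = if i < k ∧ g.arr 6 i ≠ 0 then g.arr 2 i + g.var 6 else g.arr 2 i)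
    ⟨rfl, rfl, rfl, by simp, by simp⟩ (by
      rintro k hk h ⟨h5, h6, hv, h1, h2⟩
      refine ⟨?_, ?_, ?_, fun i => ?_, fun i => ?_⟩
      · rw [Cmd.eval_arr (by decide)]; simpa using h5
      · rw [Cmd.eval_arr (by decide)]; simpa using h6
      · rw [Cmd.eval_var (by decide)]; simpa using hv
      · have hk1 := h1 k
        have hi := h1 i
        by_cases e5 : g.arr 5 k = 0 <;> by_cases e6 : g.arr 6 k = 0 <;> by_cases hik : i = k
        all_goals
          have hle : i ≠ k → (i < k + 1 ↔ i < k) := by omega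
          simp_all [shiftStep, Cmd.eval, Expr.eval, Nat.pos_of_ne_zero]
      · have hk1 := h2 k
        have hi := h2 i
        by_cases e5 : g.arr 5 k = 0 <;> by_cases e6 : g.arr 6 k = 0 <;> by_cases hik : i = k
        all_goals
          have hle : i ≠ k → (i < k + 1 ↔ i < k) := by omega
          simp_all [shiftStep, Cmd.eval, Expr.eval, Nat.pos_of_ne_zero])
  have he : shift.eval inp g = loop (fun i h => shiftStep.eval inp (h.setVar 2 i)) n g := by
    rw [← hn]
    rfl
  rw [he]
  refine ⟨fun i hi => ?_, fun i hi => ?_⟩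
  · rw [this.2.2.2.1]
    simp [hi]
  · rw [this.2.2.2.2]
    simp [hi]

end Hungarian

end EPR

/-! ### The primal-dual method: the program preserves the invariants. -/

namespace EPR

/-! ## The Hungarian method: correctness -/

namespace Hungarian

variable {inp : List ℕ} {n r k : ℕ} {A : ℕ → ℕ}

/-- The rows below `r` are matched in the arrays. -/
def MatchedIn (n : ℕ) (A : ℕ → ℕ) (r : ℕ) (h : Store) : Prop :=
  h.arr 0 = A ∧
    Matched n (fun i j => A (i * n + j)) (h.arr 1) (h.arr 2) (h.arr 3) (h.arr 4) r

def TreeIn (n : ℕ) (A : ℕ → ℕ) (r k : ℕ) (ord : ℕ → ℕ) (h : Store) : Prop :=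
  Tree n (fun i j => A (i * n + j)) (h.arr 1) (h.arr 2) (h.arr 3) (h.arr 4) (h.arr 5) (h.arr 6)
    (h.arr 7) r k ord

/-- A tree with `k` columns, all matched, or a path to flip. -/
def Growing (n : ℕ) (A : ℕ → ℕ) (r k : ℕ) (h : Store) : Prop :=
  -- `k'` bounds the ranks; it may lag behind `k`, since rounds after a path has been found do
  -- nothing.
  MatchedIn n A r h ∧ ∃ ord k', k' ≤ k ∧ TreeIn n A r k' ord h ∧
    (h.var 4 = 0 ∧ (∀ j < n, h.arr 6 j ≠ 0 → h.arr 4 j ≠ 0) ∧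
        ((Finset.range n).filter fun j => h.arr 6 j ≠ 0).card = k ∨
      h.var 4 ≠ 0 ∧ h.var 10 < n ∧ h.arr 6 (h.var 10) ≠ 0 ∧ h.arr 4 (h.var 10) = 0)

theorem card_filter_of_insert {T T' : ℕ → ℕ} {b : ℕ} (hb : b < n) (hTb : T b = 0)
    (hT : ∀ j, T' j = if j = b then 1 else T j) :
    ((Finset.range n).filter fun j => T' j ≠ 0).card =
      ((Finset.range n).filter fun j => T j ≠ 0).card + 1 := by
  have : (Finset.range n).filter (fun j => T' j ≠ 0) =
      insert b ((Finset.range n).filter fun j => T j ≠ 0) := by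
    ext j
    simp only [Finset.mem_filter, Finset.mem_range, Finset.mem_insert, hT]
    by_cases h : j = b <;> simp [h, hb]
  rw [this, Finset.card_insert_of_notMem (by simp [hTb])]

theorem grow_spec (hn : inp.getD 0 0 = n) (hr : r < n) {h : Store} (hh : Growing n A r k h) :
    Growing n A r (k + 1) (grow.eval inp h) := by
  obtain ⟨⟨hA, hm⟩, ord, k', hk, ht, ⟨h4, hall, hcard⟩ | ⟨h4, h5⟩⟩ := hh
  swap
  · have : grow.eval inp h = h := by simp [grow, Cmd.eval, Expr.eval, h4]
    rw [this]
    exact ⟨⟨hA, hm⟩, ord, k', by omega, ht, Or.inr ⟨h4, h5⟩⟩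
  set g := search.eval inp h with hg
  set g' := shift.eval inp g with hg'
  have heval : grow.eval inp h = extend.eval inp g' := by
    simp [grow, Cmd.eval, Expr.eval, h4, hg, hg']
  have harr : g.arr = h.arr := eval_arr_eq (by decide) h
  have hg4 : g'.var 4 = 0 := by
    rw [hg', Cmd.eval_var (by decide), hg, Cmd.eval_var (by decide), h4]
  have hga : ∀ B, B ≠ 1 → B ≠ 2 → g'.arr B = h.arr B := fun B h1 h2 => by
    rw [hg', Cmd.eval_arr (by revert B; decide), harr]
  have h6 : g'.var 6 = g.var 6 := Cmd.eval_var (by decide) _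
  have h7 : g'.var 7 = g.var 7 := Cmd.eval_var (by decide) _
  have h8 : g'.var 8 = g.var 8 := Cmd.eval_var (by decide) _
  obtain ⟨hP, hV⟩ := shift_spec hn g
  rw [← hg'] at hP hV
  rw [harr] at hP hV
  rcases search_spec hn h with ⟨-, hs⟩ | ⟨-, ha, hb, hSa, hTb, hδ, hmin⟩
  · exfalso
    obtain ⟨j, hj, hCM⟩ := hm.exists_free hr
    exact hall j hj (hs r j ⟨hr, hj⟩ ((ht.mem_row r hr).2 (Or.inl rfl))) hCM
  rw [← hg] at ha hb hSa hTb hδ hmin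
  rw [hA] at hδ hmin
  rw [heval]
  have hm' := hm.shift ht hr hP hV fun i hi j hj => hmin i j ⟨hi, hj⟩
  have e3 := hga 3 (by decide) (by decide)
  have e4 := hga 4 (by decide) (by decide)
  have e5 := hga 5 (by decide) (by decide)
  have e6 := hga 6 (by decide) (by decide)
  have e7 := hga 7 (by decide) (by decide)
  have e0 := hga 0 (by decide) (by decide)
  set a := g.var 7
  set b := g.var 8
  set e := extend.eval inp g' with he
  have f0 : e.arr 0 = A := by rw [he, Cmd.eval_arr (by decide), e0, hA]
  have f1 : e.arr 1 = g'.arr 1 := Cmd.eval_arr (by decide) _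
  have f2 : e.arr 2 = g'.arr 2 := Cmd.eval_arr (by decide) _
  have f3 : e.arr 3 = h.arr 3 := by rw [he, Cmd.eval_arr (by decide), e3]
  have f4 : e.arr 4 = h.arr 4 := by rw [he, Cmd.eval_arr (by decide), e4]
  have f6 : ∀ j, e.arr 6 j = if j = b then 1 else h.arr 6 j := fun j => by
    by_cases hz : h.arr 4 b = 0 <;>
      simp [he, extend, Cmd.eval, Expr.eval, h8, e4, e6, hz, Function.update_apply]
  have f7 : ∀ j, e.arr 7 j = if j = b then a else h.arr 7 j := fun j => by
    by_cases hz : h.arr 4 b = 0 <;>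
      simp [he, extend, Cmd.eval, Expr.eval, h7, h8, e4, e7, hz, Function.update_apply]
  have f5 : ∀ i < n, e.arr 5 i ≠ 0 ↔ h.arr 5 i ≠ 0 ∨ h.arr 4 b = i + 1 := fun i _ => by
    by_cases hz : h.arr 4 b = 0
    · simp [he, extend, Cmd.eval, Expr.eval, h8, e4, e5, hz]
    · by_cases hi : i = h.arr 4 b - 1
      · have : h.arr 4 b = i + 1 := by omega
        simp [he, extend, Cmd.eval, Expr.eval, h8, e4, this]
      · have : ¬ h.arr 4 b = i + 1 := by omega
        simp [he, extend, Cmd.eval, Expr.eval, h8, e4, e5, hz, hi, this]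
  refine ⟨⟨f0, ?_⟩, Function.update ord b k', k' + 1, by omega, ?_, ?_⟩
  · rw [f1, f2, f3, f4]
    exact hm'
  · unfold TreeIn
    rw [f1, f2, f3, f4]
    exact ht.extend hm ha hb hSa hTb hδ hP hV f6 f7 f5
  · rw [f4]
    by_cases hz : h.arr 4 b = 0
    · right
      have f10 : e.var 10 = b := by
        simp [he, extend, Cmd.eval, Expr.eval, h8, e4, hz]
      have f4' : e.var 4 = 1 := by
        simp [he, extend, Cmd.eval, Expr.eval, h8, e4, hz]
      rw [f10, f4']
      exact ⟨one_ne_zero, hb, by simp [f6], hz⟩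
    · left
      refine ⟨by simp [he, extend, Cmd.eval, Expr.eval, h8, e4, hz, hg4], fun j hj h1 => ?_, ?_⟩
      · by_cases hjb : j = b
        · rwa [hjb]
        · rw [f6, if_neg hjb] at h1
          exact hall j hj h1
      · rw [card_filter_of_insert hb hTb f6, hcard]

/-- The path is being flipped and will be finished within `n - s` steps, or is finished. -/
def FlippingIn (n : ℕ) (A : ℕ → ℕ) (r : ℕ) (ord : ℕ → ℕ) (s : ℕ) (h : Store) : Prop :=
  h.arr 0 = A ∧
    (h.var 4 ≠ 0 ∧ ord (h.var 10) + s < n ∧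
        Flipping n (fun i j => A (i * n + j)) (h.arr 1) (h.arr 2) (h.arr 3) (h.arr 4) (h.arr 6)
          (h.arr 7) r (h.var 10) ord ∨
      h.var 4 = 0 ∧
        Matched n (fun i j => A (i * n + j)) (h.arr 1) (h.arr 2) (h.arr 3) (h.arr 4) (r + 1))

theorem flip_spec {ord : ℕ → ℕ} {s : ℕ} {h : Store} (hh : FlippingIn n A r ord s h) :
    FlippingIn n A r ord (s + 1) (flip.eval inp h) := by
  obtain ⟨hA, ⟨h4, hs, hf⟩ | ⟨h4, hm⟩⟩ := hh
  swap
  · have : flip.eval inp h = h := by simp [flip, Cmd.eval, Expr.eval, h4]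
    rw [this]
    exact ⟨hA, Or.inr ⟨h4, hm⟩⟩
  set g := flip.eval inp h with hg
  have f0 : g.arr 0 = A := by rw [hg, Cmd.eval_arr (by decide), hA]
  have f1 : g.arr 1 = h.arr 1 := Cmd.eval_arr (by decide) _
  have f2 : g.arr 2 = h.arr 2 := Cmd.eval_arr (by decide) _
  have f6 : g.arr 6 = h.arr 6 := Cmd.eval_arr (by decide) _
  have f7 : g.arr 7 = h.arr 7 := Cmd.eval_arr (by decide) _
  set cur := h.var 10 with hcur
  have f3 : g.arr 3 = Function.update (h.arr 3) (h.arr 7 cur) (cur + 1) := by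
    by_cases hz : h.arr 3 (h.arr 7 cur) = 0 <;>
      simp [hg, flip, Cmd.eval, Expr.eval, Nat.pos_of_ne_zero, h4, ← hcur, hz]
  have f4 : g.arr 4 = Function.update (h.arr 4) cur (h.arr 7 cur + 1) := by
    by_cases hz : h.arr 3 (h.arr 7 cur) = 0 <;>
      simp [hg, flip, Cmd.eval, Expr.eval, Nat.pos_of_ne_zero, h4, ← hcur, hz]
  refine ⟨f0, ?_⟩
  rw [f1, f2, f3, f4, f6, f7]
  by_cases hz : h.arr 3 (h.arr 7 cur) = 0
  · right
    refine ⟨?_, hf.finish hz⟩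
    simp [hg, flip, Cmd.eval, Expr.eval, Nat.pos_of_ne_zero, h4, ← hcur, hz]
  · left
    have f10 : g.var 10 = h.arr 3 (h.arr 7 cur) - 1 := by
      simp [hg, flip, Cmd.eval, Expr.eval, Nat.pos_of_ne_zero, h4, ← hcur, hz]
    have g4 : g.var 4 = h.var 4 := by
      simp [hg, flip, Cmd.eval, Expr.eval, Nat.pos_of_ne_zero, h4, ← hcur, hz]
    obtain ⟨hf', hlt⟩ := hf.next hz
    rw [f10, g4]
    exact ⟨h4, by omega, hf'⟩

theorem initTree_spec (hn : inp.getD 0 0 = n) {h : Store} (hh : MatchedIn n A r h)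
    (h0 : h.var 0 = r) : Growing n A r 0 (initTree.eval inp h) := by
  set c : Cmd := .seq (.put 5 (.var 2) (.const 0)) (.put 6 (.var 2) (.const 0)) with hc
  set g := loop (fun i g => c.eval inp (g.setVar 2 i)) n h with hg
  have heval : initTree.eval inp h = (g.setArr 5 (g.var 0) 1).setVar 4 0 := by
    rw [hg, ← hn]
    rfl
  obtain ⟨hv, h0', h1, h2, h3, h4, h5, h6⟩ := loop_induct
    (f := fun i g => c.eval inp (g.setVar 2 i)) (n := n) (a := h)
    (fun k g => g.var 0 = r ∧ g.arr 0 = h.arr 0 ∧ g.arr 1 = h.arr 1 ∧ g.arr 2 = h.arr 2 ∧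
      g.arr 3 = h.arr 3 ∧ g.arr 4 = h.arr 4 ∧ (∀ i < k, g.arr 5 i = 0) ∧ ∀ i < k, g.arr 6 i = 0)
    ⟨h0, rfl, rfl, rfl, rfl, rfl, by simp, by simp⟩ (by
      rintro i hi g ⟨hv, h0', h1, h2, h3, h4, h5, h6⟩
      simp only [hc, Cmd.eval, Expr.eval]
      refine ⟨by simpa using hv, by simpa using h0', by simpa using h1, by simpa using h2,
        by simpa using h3, by simpa using h4, fun j hj => ?_, fun j hj => ?_⟩
      · by_cases hji : j = i
        · simp [hji]
        · simpa [hji] using h5 j (by omega)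
      · by_cases hji : j = i
        · simp [hji]
        · simpa [hji] using h6 j (by omega))
  rw [← hg] at hv h0' h1 h2 h3 h4 h5 h6
  rw [heval]
  obtain ⟨hA, hm⟩ := hh
  refine ⟨⟨by simpa using h0'.trans hA, by simpa [h1, h2, h3, h4] using hm⟩, fun _ => 0, 0, le_rfl,
    ?_, Or.inl ⟨by simp, fun j hj hT => ?_, ?_⟩⟩
  · refine Tree.init (fun i hi => ?_) fun j hj => by simpa using h6 j hj
    have := h5 i hi
    by_cases hir : i = r <;> simp [hir, hv, this]
  · exact absurd (h6 j hj) (by simpa using hT)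
  · rw [Finset.card_eq_zero, Finset.filter_eq_empty_iff]
    intro j hj
    simpa using h6 j (Finset.mem_range.1 hj)

/-- Without a path after n rounds, the tree would contain all n columns, all matched, although one
is free. The ranks on the path are below n, so n rounds also suffice for flipping it. -/
theorem phase_spec (hn : inp.getD 0 0 = n) {h : Store} (hh : MatchedIn n A r h)
    (h0 : h.var 0 = r) (hr : r < n) : MatchedIn n A (r + 1) (phase.eval inp h) := by
  set g := loop (fun i g => grow.eval inp (g.setVar 1 i)) n (initTree.eval inp h) with hg
  have heval : phase.eval inp h = loop (fun i g => flip.eval inp (g.setVar 1 i)) n g := by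
    rw [hg, ← hn]
    rfl
  have hgrow : Growing n A r n g :=
    loop_induct (Growing n A r) (initTree_spec hn hh h0) fun i _ g' hg' =>
      grow_spec hn hr (h := g'.setVar 1 i) hg'
  obtain ⟨⟨hA, hm⟩, ord, k, hk, ht, ⟨-, hall, hcard⟩ | ⟨h4, h10, hT, hCM⟩⟩ := hgrow
  · exfalso
    obtain ⟨j, hj, hCM⟩ := hm.exists_free hr
    have := Finset.card_filter_eq_iff.1 (hcard.trans (Finset.card_range n).symm)
    exact hall j hj (this j (Finset.mem_range.2 hj)) hCM
  · have h0 : FlippingIn n A r ord 0 g :=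
      ⟨hA, Or.inl ⟨h4, by have := (ht.rank _ h10 hT).1; omega, ht.flipping hm h10 hT hCM⟩⟩
    rw [heval]
    obtain ⟨hA', ⟨-, hlt, -⟩ | ⟨-, hm'⟩⟩ := loop_induct (f := fun i g => flip.eval inp (g.setVar 1 i))
      (n := n) (FlippingIn n A r ord) h0 fun i _ g' hg' =>
        flip_spec (by simpa [FlippingIn] using hg')
    · omega
    · exact ⟨hA', hm'⟩

/-- The induction starts from the empty matching: with `P` zero, feasibility is automatic for
natural costs and column variables. -/
theorem solve_spec (hn : inp.getD 0 0 = n) {h : Store} (hA : h.arr 0 = A)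
    (h1 : ∀ i, h.arr 1 i = 0) (h3 : ∀ i, h.arr 3 i = 0) (h4 : ∀ i, h.arr 4 i = 0) :
    MatchedIn n A n (solve.eval inp h) := by
  have h0 : MatchedIn n A 0 h :=
    ⟨hA, ⟨fun i _ j _ => by rw [h1]; exact Nat.zero_le _, fun i hi => absurd hi (Nat.not_lt_zero i),
      fun j _ h => absurd (h4 j) h, fun i _ => h3 i⟩⟩
  have heval : solve.eval inp h = loop (fun i g => phase.eval inp (g.setVar 0 i)) n h := by
    rw [← hn]
    rfl
  rw [heval]
  exact loop_induct (MatchedIn n A) h0 fun i hi g hg =>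
    phase_spec hn (by simpa [MatchedIn] using hg) (by simp) hi

end Hungarian

end EPR

/-! ### Clearing denominators, and positions in the encoded instance. -/

namespace EPR

/-! ## From the input to the costs of an assignment problem -/

namespace Costs

variable {inp : List ℕ} {n : ℕ}

/-- Position of the pair of the loop variables `2` and `3`. -/
def pos : Expr := .add (.mulInp (.var 2) (.const 0)) (.var 3)

def grid (c : Cmd) : Cmd := .forN 2 (.forN 3 c)

/-- Variable `13` becomes the product of the denominators. -/
def denStep : Cmd := .set 13 (.mulInp (.var 13) (.add (.const 2) (.add pos pos)))

def fill : Cmd :=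
  .seq (.put 0 pos (.mulInp (.div (.var 13) (.inp (.add (.const 2) (.add pos pos))))
      (.add (.const 1) (.add pos pos))))
    (.set 14 (.add (.var 14) (.get 0 pos)))

/-- The off-diagonal weights times the product of the denominators go to array `0`, their sum to
variable `14`. -/
def fillStep : Cmd :=
  .ifLt (.var 2) (.var 3) fill (.ifLt (.var 3) (.var 2) fill .skip)

def flipStep : Cmd := .put 0 pos (.sub (.var 14) (.get 0 pos))

def setup : Cmd :=
  .seq (.set 13 (.const 1)) (.seq (grid denStep) (.seq (grid fillStep) (grid flipStep)))

theorem grid_induct (hn : inp.getD 0 0 = n) {c : Cmd} (h2 : c.setsVar 2 = false)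
    (P : ℕ → Store → Prop) {h : Store} (h0 : P 0 h)
    (hset2 : ∀ q g v, P q g → P q (g.setVar 2 v)) (hset3 : ∀ q g v, P q g → P q (g.setVar 3 v))
    (hs : ∀ i < n, ∀ j < n, ∀ g : Store, g.var 2 = i → g.var 3 = j → P (i * n + j) g →
      P (i * n + j + 1) (c.eval inp g)) : P (n * n) ((grid c).eval inp h) := by
  have heval : (grid c).eval inp h = loop (fun i g =>
      loop (fun j g => c.eval inp (g.setVar 3 j)) n (g.setVar 2 i)) n h := by
    rw [← hn]
    rfl
  rw [heval]
  refine loop_induct (fun i => P (i * n)) (by simpa using h0) fun i hi g hg => ?_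
  have := loop_induct (f := fun j g => c.eval inp (g.setVar 3 j)) (n := n) (a := g.setVar 2 i)
    (fun j g => g.var 2 = i ∧ P (i * n + j) g) ⟨by simp, hset2 _ _ _ hg⟩
    fun j hj g' hg' => ⟨by rw [Cmd.eval_var h2]; simpa using hg'.1,
      hs i hi j hj _ (by simpa using hg'.1) (by simp) (hset3 _ _ _ hg'.2)⟩
  rw [Nat.succ_mul]
  exact this.2

/-- The product of the denominators. -/
def denProd (inp : List ℕ) (m : ℕ) : ℕ := ∏ q ∈ Finset.range m, inp.getD (2 + (q + q)) 0

/-- The off-diagonal weights times `D`. -/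
def scaled (inp : List ℕ) (n D q : ℕ) : ℕ :=
  if q / n = q % n then 0 else D / inp.getD (2 + (q + q)) 0 * inp.getD (1 + (q + q)) 0

/-- Subtraction from the sum of all scaled weights turns the maximization into a minimization with
natural costs; the sum dominates every term, so truncation does no harm. -/
theorem setup_spec (hn : inp.getD 0 0 = n) :
    (∀ i < n, ∀ j < n, (setup.eval inp Store.empty).arr 0 (i * n + j) =
      (∑ q ∈ Finset.range (n * n), scaled inp n (denProd inp (n * n)) q) -
        scaled inp n (denProd inp (n * n)) (i * n + j)) ∧
    ∀ A, A ≠ 0 → (setup.eval inp Store.empty).arr A = fun _ => 0 := by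
  refine ⟨?_, fun A hA => by rw [Cmd.eval_arr (by revert A; decide)]; rfl⟩
  set D := denProd inp (n * n) with hD
  have hpos : ∀ g : Store, pos.eval inp g = g.var 2 * n + g.var 3 := fun g => by
    simp only [pos, Expr.eval, hn]
  have hlt : ∀ {i j}, i < n → j < n → i * n + j < n * n := fun {i j} hi hj => by nlinarith
  set g1 := (grid denStep).eval inp (Store.empty.setVar 13 1) with hg1
  obtain ⟨hv13, hv14, harr⟩ : g1.var 13 = D ∧ g1.var 14 = 0 ∧ ∀ q, g1.arr 0 q = 0 :=
    grid_induct hn (by decide)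
      (fun k g => g.var 13 = denProd inp k ∧ g.var 14 = 0 ∧ ∀ q, g.arr 0 q = 0)
      ⟨by simp [denProd], rfl, fun _ => rfl⟩ (by simp) (by simp) (by
        rintro i hi j hj g rfl rfl ⟨h1, h2, h3⟩
        refine ⟨?_, by simpa [denStep, Cmd.eval] using h2, by simpa [denStep, Cmd.eval] using h3⟩
        simp only [denStep, Cmd.eval, Expr.eval, hpos, Store.setVar_var, if_true, h1]
        rw [denProd, denProd, Finset.prod_range_succ])
  set g2 := (grid fillStep).eval inp g1 with hg2
  obtain ⟨-, hU, hN⟩ : g2.var 13 = D ∧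
      g2.var 14 = ∑ q ∈ Finset.range (n * n), scaled inp n D q ∧
      ∀ q, g2.arr 0 q = if q < n * n then scaled inp n D q else 0 :=
    grid_induct hn (by decide)
      (fun k g => g.var 13 = D ∧ g.var 14 = ∑ q ∈ Finset.range k, scaled inp n D q ∧
        ∀ q, g.arr 0 q = if q < k then scaled inp n D q else 0)
      ⟨hv13, by simpa using hv14, by simpa using harr⟩ (by simp) (by simp) (by
        rintro i hi j hj g h2 h3 ⟨h1, h4, h5⟩
        refine ⟨by rw [Cmd.eval_var (by decide), h1], ?_⟩
        have hdiv : (i * n + j) / n = i := by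
          rw [mul_comm, Nat.mul_add_div (by omega), Nat.div_eq_of_lt hj, add_zero]
        have hmod : (i * n + j) % n = j := by
          rw [mul_comm, Nat.mul_add_mod, Nat.mod_eq_of_lt hj]
        rw [Finset.sum_range_succ]
        by_cases hij : i = j
        · have he : fillStep.eval inp g = g := by
            simp [fillStep, Cmd.eval, Expr.eval, h2, h3, hij]
          have hz : scaled inp n D (i * n + j) = 0 := by
            rw [scaled, hdiv, hmod, if_pos hij]
          rw [he, hz]
          refine ⟨h4, fun q => ?_⟩
          by_cases hq : q = i * n + j
          · rw [h5, hq, if_neg (by omega), if_pos (by omega), hz]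
          · simp only [h5, show q < i * n + j + 1 ↔ q < i * n + j by omega]
        · have he : fillStep.eval inp g = fill.eval inp g := by
            simp only [fillStep, Cmd.eval, Expr.eval, h2, h3]
            split_ifs
            · rfl
            · rfl
            · omega
          have hz : scaled inp n D (i * n + j) = D / inp.getD (2 + ((i * n + j) + (i * n + j))) 0 *
              inp.getD (1 + ((i * n + j) + (i * n + j))) 0 := by
            rw [scaled, hdiv, hmod, if_neg hij]
          rw [he]
          simp only [fill, Cmd.eval, Expr.eval, hpos, h2, h3, h1, ← hz, Store.setVar_var, if_true,
            Store.setArr_var, Store.setArr_arr, Function.update_self, Store.setVar_arr, h4,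
            Function.update_apply, true_and]
          intro q
          by_cases hq : q = i * n + j
          · rw [if_pos hq, if_pos (by omega), hq]
          · simp only [hq, if_false, h5, show q < i * n + j + 1 ↔ q < i * n + j by omega])
  set U := ∑ q ∈ Finset.range (n * n), scaled inp n D q with hUdef
  have := grid_induct (c := flipStep) (h := g2) hn (by decide)
    (fun k g => g.var 14 = U ∧ ∀ q < n * n,
      g.arr 0 q = if q < k then U - scaled inp n D q else scaled inp n D q)
    ⟨hU, fun q hq => by simp [hN, hq]⟩ (by simp) (by simp) (by
      rintro i hi j hj g h2 h3 ⟨h1, h4⟩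
      refine ⟨by rw [Cmd.eval_var (by decide), h1], fun q hq => ?_⟩
      simp only [flipStep, Cmd.eval, Expr.eval, hpos, h2, h3, h1, Store.setArr_arr, if_true,
        Function.update_apply]
      by_cases hqk : q = i * n + j
      · rw [if_pos hqk, if_pos (by omega), h4 _ (hlt hi hj), if_neg (by omega), hqk]
      · simp only [hqk, if_false, h4 q hq, show q < i * n + j + 1 ↔ q < i * n + j by omega])
  intro i hi j hj
  have h := this.2 _ (hlt hi hj)
  rw [if_pos (hlt hi hj)] at h
  exact h

theorem scaled_le_sum {D q : ℕ} (hq : q < n * n) :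
    scaled inp n D q ≤ ∑ q ∈ Finset.range (n * n), scaled inp n D q :=
  Finset.single_le_sum (fun _ _ => Nat.zero_le _) (Finset.mem_range.2 hq)

end Costs

/-! ## The encoding of an instance -/

theorem flatten_ofFn_getElem? {α : Type} {k m : ℕ} (f : Fin k → List α) (hf : ∀ i, (f i).length = m)
    (i : Fin k) {j : ℕ} (hj : j < m) : (List.ofFn f).flatten[i * m + j]? = (f i)[j]? := by
  induction k with
  | zero => exact i.elim0
  | succ k ih =>
    rw [List.ofFn_succ, List.flatten_cons]
    induction i using Fin.cases with
    | zero =>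
      rw [List.getElem?_append_left (by simpa [hf] using hj)]
      simp
    | succ i =>
      have h1 : ((i.succ : Fin (k + 1)) : ℕ) * m + j = (f 0).length + (i * m + j) := by
        rw [hf, Fin.val_succ]
        ring
      rw [h1, List.getElem?_append_right (by omega), Nat.add_sub_cancel_left]
      exact ih (fun i => f i.succ) (fun i => hf _) i

theorem length_flatten_ofFn {α : Type} {k m : ℕ} (f : Fin k → List α)
    (hf : ∀ i, (f i).length = m) : (List.ofFn f).flatten.length = k * m := by
  simp [List.length_flatten, List.map_ofFn, Function.comp_def, hf]

theorem Instance.encode_head (I : Instance) : I.encode.getD 0 0 = I.n := rfl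

theorem Instance.encode_length (I : Instance) : I.encode.length = 1 + I.n * (I.n * 2) := by
  rw [Instance.encode, List.length_cons, length_flatten_ofFn (m := I.n * 2), add_comm]
  intro i
  rw [length_flatten_ofFn]
  simp

theorem Instance.encode_entry (I : Instance) (i j : Fin I.n) {e : ℕ} (he : e < 2) :
    I.encode.getD (1 + e + ((i * I.n + j) + (i * I.n + j))) 0 =
      [(I.w i j).num, (I.w i j).den].getD e 0 := by
  have h1 : 1 + e + ((i * I.n + j : ℕ) + (i * I.n + j)) = (i * (I.n * 2) + (j * 2 + e)) + 1 := by
    ring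
  have h2 : j * 2 + e < I.n * 2 := by omega
  rw [h1, Instance.encode, List.getD_cons_succ, List.getD_eq_getElem?_getD,
    flatten_ofFn_getElem? (m := I.n * 2), flatten_ofFn_getElem? (m := 2) _ (by simp) _ he,
    List.getD_eq_getElem?_getD]
  · intro i
    rw [length_flatten_ofFn]
    simp
  · exact h2

/-- The input contains n² fractions, so loops up to n are polynomial although n itself is written in
binary. -/
theorem Instance.le_bitLength_encode (I : Instance) : I.encode.getD 0 0 ≤ bitLength I.encode := by
  refine le_trans ?_ (length_le_bitLength _)
  rw [Instance.encode_head, Instance.encode_length]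
  have := Nat.le_mul_self I.n
  nlinarith

end EPR

/-! ### Complementary slackness: the assignment certifies the approximation ratio. -/

namespace EPR

/-! ## An optimal assignment gives a good state -/

/-- In terms of weights, U - P_i and V_j are dual variables: N_ij ≤ (U - P_i) + V_j, with equality
along σ. Symmetrizing them gives a cover for which the upper bound and the energy bound of σ involve
the same quantity. -/
theorem ratio_mul_lambdaMax_le (I : Instance) {D U : ℕ} (hD : 0 < D) {N : Fin I.n → Fin I.n → ℕ}
    (hN : ∀ i j, i ≠ j → (N i j : ℝ) = D * I.w i j) (hN0 : ∀ i, N i i = 0)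
    (hU : ∀ i j, N i j ≤ U) {P V : Fin I.n → ℕ} (hle : ∀ i j, P i ≤ U - N i j + V j)
    (σ : Equiv.Perm (Fin I.n)) (heq : ∀ i, P i = U - N i (σ i) + V (σ i)) :
    ratio * lambdaMax I.ham ≤ energy (StateDesc.permDesc σ).toOp I.ham := by
  have hD' : (0 : ℝ) < D := by exact_mod_cast hD
  have hle' : ∀ i j, (N i j : ℝ) ≤ U - P i + V j := fun i j => by
    have h1 := hle i j
    have h2 := hU i j
    have : N i j + P i ≤ U + V j := by omega
    have : ((N i j + P i : ℕ) : ℝ) ≤ (U + V j : ℕ) := by exact_mod_cast this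
    push_cast at this
    linarith
  have heq' : ∀ i, (U : ℝ) - P i + V (σ i) = N i (σ i) := fun i => by
    have h1 := heq i
    have h2 := hU i (σ i)
    have : N i (σ i) + P i = U + V (σ i) := by omega
    have : ((N i (σ i) + P i : ℕ) : ℝ) = (U + V (σ i) : ℕ) := by exact_mod_cast this
    push_cast at this
    linarith
  -- The average of the row and column variables, with the common denominator `D` removed.
  set y : Fin I.n → ℝ := fun i => ((U : ℝ) - P i + V i) / (2 * D) with hy
  -- Reindexing the column variables by σ lets tightness be applied term by term; fixed points
  -- contribute the zero diagonal.
  have hsum : ∑ i, y i = 1 / 2 * ∑ i, if σ i = i then 0 else (I.w i (σ i) : ℝ) := by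
    have h1 : ∑ i, ((U : ℝ) - P i + V i) = ∑ i, (N i (σ i) : ℝ) := by
      rw [Finset.sum_add_distrib, ← Equiv.sum_comp σ fun i => (V i : ℝ), ← Finset.sum_add_distrib]
      exact Finset.sum_congr rfl fun i _ => heq' i
    rw [hy, ← Finset.sum_div, h1, Finset.sum_div, Finset.mul_sum]
    refine Finset.sum_congr rfl fun i _ => ?_
    split_ifs with h
    · simp [h, hN0]
    · rw [hN i _ fun h' => h h'.symm]
      field_simp
  have h1 := lambdaMax_ham_le I y
    -- The dual inequality on the zero diagonal is exactly the nonnegativity of `y`.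
    (fun i => div_nonneg (by have := hle' i i; simpa [hN0] using this) (by positivity))
    (fun i j hij => by
      rw [hy]
      simp only
      rw [← add_div, le_div_iff₀ (by positivity)]
      have h1 := hle' i j
      have h2 := hle' j i
      rw [hN i j hij] at h1
      rw [hN j i hij.symm, I.symm.apply] at h2
      linarith)
  have h2 := StateDesc.energy_permDesc I σ
  have h3 : 0 < ratio := by
    have := ratio_bounds.1
    linarith
  rw [hsum] at h1
  refine le_trans (mul_le_mul_of_nonneg_left h1 h3.le) (le_trans (le_of_eq ?_) h2)
  ring

namespace Hungarian

theorem exists_perm {n : ℕ} {C : ℕ → ℕ → ℕ} {P V RM CM : ℕ → ℕ} (hm : Matched n C P V RM CM n) :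
    ∃ σ : Equiv.Perm (Fin n), ∀ i : Fin n, RM i = σ i + 1 ∧ P i = C i (σ i) + V (σ i) := by
  choose! f hf h1 h2 h3 using hm.row
  have hinj : Function.Injective fun i : Fin n => (⟨f i, hf i i.2⟩ : Fin n) := by
    intro i j hij
    have hij : f i = f j := by simpa using hij
    have e1 := h2 i i.2
    have e2 := h2 j j.2
    rw [hij] at e1
    exact Fin.ext (by omega)
  exact ⟨Equiv.ofBijective _ (Finite.injective_iff_bijective.1 hinj),
    fun i => ⟨h1 i i.2, h3 i i.2⟩⟩

theorem setup_solve_spec (I : Instance) : ∃ σ : Equiv.Perm (Fin I.n),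
    (∀ i : Fin I.n, (solve.eval I.encode (Costs.setup.eval I.encode Store.empty)).arr 3 i
      = σ i + 1) ∧
    ratio * lambdaMax I.ham ≤ energy (StateDesc.permDesc σ).toOp I.ham := by
  have hn := I.encode_head
  obtain ⟨hcost, hzero⟩ := Costs.setup_spec hn
  set g := Costs.setup.eval I.encode Store.empty
  obtain ⟨-, hm⟩ := solve_spec hn (h := g) rfl (by simp [hzero]) (by simp [hzero]) (by simp [hzero])
  set g' := solve.eval I.encode g
  obtain ⟨σ, hσ⟩ := exists_perm hm
  refine ⟨σ, fun i => (hσ i).1, ?_⟩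
  set D := Costs.denProd I.encode (I.n * I.n) with hDdef
  set U := ∑ q ∈ Finset.range (I.n * I.n), Costs.scaled I.encode I.n D q with hUdef
  have hpos : ∀ i j : Fin I.n, (i * I.n + j : ℕ) < I.n * I.n := fun i j => by nlinarith [i.2, j.2]
  have hden : ∀ i j : Fin I.n, I.encode.getD (2 + ((i * I.n + j) + (i * I.n + j))) 0
      = (I.w i j).den := fun i j => I.encode_entry i j (e := 1) (by norm_num)
  have hnum : ∀ i j : Fin I.n, I.encode.getD (1 + ((i * I.n + j) + (i * I.n + j))) 0
      = (I.w i j).num := fun i j => I.encode_entry i j (e := 0) (by norm_num)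
  have hdiv : ∀ i j : Fin I.n, (i * I.n + j : ℕ) / I.n = i := fun i j => by
    rw [mul_comm, Nat.mul_add_div i.pos, Nat.div_eq_of_lt j.2, add_zero]
  have hmod : ∀ i j : Fin I.n, (i * I.n + j : ℕ) % I.n = j := fun i j => by
    rw [mul_comm, Nat.mul_add_mod, Nat.mod_eq_of_lt j.2]
  have hD : 0 < D := by
    refine Finset.prod_pos fun q hq => ?_
    have hq := Finset.mem_range.1 hq
    have hn0 : 0 < I.n := Nat.pos_of_ne_zero fun h => by simp [h] at hq
    have := hden ⟨q / I.n, Nat.div_lt_of_lt_mul hq⟩ ⟨q % I.n, Nat.mod_lt _ hn0⟩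
    simp only at this
    rw [mul_comm (q / I.n), Nat.div_add_mod] at this
    rw [this]
    exact NNRat.den_pos _
  refine ratio_mul_lambdaMax_le I hD (U := U)
    (N := fun i j => Costs.scaled I.encode I.n D (i * I.n + j)) (P := fun i => g'.arr 1 i)
    (V := fun i => g'.arr 2 i) (fun i j hij => ?_) (fun i => ?_)
    (fun i j => Costs.scaled_le_sum (hpos i j)) (fun i j => ?_) σ fun i => ?_
  · have hdvd : (I.w i j).den ∣ D := by
      rw [← hden i j]
      exact Finset.dvd_prod_of_mem _ (Finset.mem_range.2 (hpos i j))
    rw [Costs.scaled, hdiv, hmod, if_neg fun h => hij (Fin.ext h), hden, hnum]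
    have h1 : ((I.w i j).den : ℝ) ≠ 0 := by exact_mod_cast (NNRat.den_ne_zero _)
    have h2 : ((I.w i j : ℚ≥0) : ℝ) = (I.w i j).num / (I.w i j).den := NNRat.cast_def _
    rw [h2, Nat.cast_mul, Nat.cast_div hdvd h1]
    ring
  · rw [Costs.scaled, hdiv, hmod, if_pos rfl]
  · have := hm.feasible i i.2 j j.2
    rwa [hcost i i.2 j j.2] at this
  · have := (hσ i).2
    rwa [hcost i i.2 _ (σ i).2] at this

end Hungarian

end EPR

/-! ### Printing matchings and rotations in prefix notation. -/

namespace EPR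

/-! ## Encodings of the descriptions -/

namespace StateDesc

variable {n : ℕ}

/-- The encoded entries of a real matrix. -/
def encodeMatrix {m : ℕ} (A : (Fin m → Fin 2) → (Fin m → Fin 2) → Radical) : List ℕ :=
  (List.ofFn fun r : Fin (2 ^ m) => (List.ofFn fun c : Fin (2 ^ m) => Entry.encode
    (A (finFunctionFinEquiv.symm r) (finFunctionFinEquiv.symm c), .rat 0)).flatten).flatten

theorem encode_blockOn {m : ℕ} {v : Fin m → Fin n} (hv : Function.Injective v)
    (A : (Fin m → Fin 2) → (Fin m → Fin 2) → Radical) :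
    (blockOn v A).encode = 0 :: m :: (List.ofFn (fun k => (v k : ℕ)) ++ encodeMatrix A) := by
  rw [blockOn_of_injective hv]
  rfl

/-- The encoding of the state of no qubits. -/
def emptyCode : List ℕ := 0 :: 0 :: encodeMatrix (m := 0) fun _ _ => .rat 1

theorem encode_emptyDesc : (emptyDesc : StateDesc n).encode = emptyCode := by
  rw [emptyDesc, encode_blockOn fun i => i.elim0]
  simp [emptyCode]

/-- In prefix notation a right-nested tensor product is the list of its tagged factors followed by a
terminator, so a plain loop can print it. -/
theorem encode_pairsDesc (k : ℕ) (v : ℕ → Fin n) : (pairsDesc k v).encode =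
    ((List.range k).flatMap fun p => 1 :: (pairDesc (v (2 * p)) (v (2 * p + 1))).encode) ++
      emptyCode := by
  induction k generalizing v with
  | zero => simp [pairsDesc, encode_emptyDesc]
  | succ k ih =>
    rw [pairsDesc, encode, ih, List.range_succ_eq_map, List.flatMap_cons, List.flatMap_map]
    simp [Nat.mul_add, add_right_comm]

theorem encodeRat_one_div (k : ℕ) : encodeRat (1 / ((k : ℚ) + 1)) = [0, 1, k + 1] := by
  have h0 : ¬ (1 / ((k : ℚ) + 1)) < 0 := not_lt.2 (by positivity)
  have h1 : (1 / ((k : ℚ) + 1)) = ((k + 1 : ℕ) : ℚ)⁻¹ := by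
    push_cast
    rw [one_div]
  rw [encodeRat, if_neg h0, h1, Rat.inv_natCast_num_of_pos k.succ_pos,
    Rat.inv_natCast_den_of_pos k.succ_pos]
  rfl

/-- At level p there are k - p states left to mix, so the weight is 1/(k-p), written as sign 0,
numerator 1, denominator k - p. -/
theorem encode_mixDesc (k : ℕ) (r : ℕ → StateDesc n) (t : StateDesc n) : (mixDesc k r t).encode =
    ((List.range k).flatMap fun p => 2 :: 0 :: 1 :: (k - p) :: (r p).encode) ++ t.encode := by
  induction k generalizing r with
  | zero => simp [mixDesc]
  | succ k ih =>
    rw [mixDesc, encode, ih, List.range_succ_eq_map, List.flatMap_cons, List.flatMap_map,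
      encodeRat_one_div]
    simp

theorem encode_tensorList (l : List (StateDesc n)) :
    (tensorList l).encode = (l.flatMap fun d => 1 :: d.encode) ++ emptyCode := by
  induction l with
  | nil => simp [tensorList, encode_emptyDesc]
  | cons d l ih => simp [tensorList, encode, ih]

theorem minimalPeriod_perm_le (σ : Equiv.Perm (Fin n)) (u : Fin n) :
    Function.minimalPeriod σ u ≤ n := by
  have := Finset.card_le_card_of_injOn (s := Finset.range (Function.minimalPeriod σ u))
    (t := (Finset.univ : Finset (Fin n))) (fun p => σ^[p] u)
    (fun _ _ => Finset.mem_coe.2 (Finset.mem_univ _))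
    (by simpa using Function.iterate_injOn_Iio_minimalPeriod)
  simpa using this

/-- The description of the cycle of `r`. -/
noncomputable def orbitDesc (σ : Equiv.Perm (Fin n)) (r : Fin n) : StateDesc n :=
  cycleDesc (Function.minimalPeriod σ r) fun p => σ^[p] r

open scoped Classical in
theorem encode_permDesc (σ : Equiv.Perm (Fin n)) : (permDesc σ).encode =
    ((List.finRange n).flatMap fun r => if ∀ k, r ≤ σ^[k] r then 1 :: (orbitDesc σ r).encode
      else []) ++ emptyCode := by
  rw [permDesc, encode_tensorList, List.flatMap_map, cycleHeads]
  congr 1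
  induction List.finRange n with
  | nil => rfl
  | cons r l ih =>
    by_cases h : ∀ k, r ≤ σ^[k] r
    · rw [List.filter_cons_of_pos (by simpa using h), List.flatMap_cons, ih, List.flatMap_cons,
        if_pos h]
      rfl
    · rw [List.filter_cons_of_neg (by simpa using h), ih, List.flatMap_cons, if_neg h]
      rfl

end StateDesc

/-! ## Writing the description of the state of a permutation

The partners plus one are in array `3`. Variables: `0` first element of the cycle, `1` and `2` loop
variables, `4` length of the cycle, `5` whether the first element is the smallest one, `6` first
element of the rotation, `7` current element, `8` number of pairs. -/

/-- All loops run for n rounds; one that needs only k ≤ n of them idles afterwards. -/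
theorem loop_induct_le {α : Type} {f : ℕ → α → α} {n k : ℕ} {a : α} (P : ℕ → α → Prop) (hk : k ≤ n)
    (h0 : P 0 a) (hs : ∀ i < k, ∀ a, P i a → P (i + 1) (f i a))
    (hskip : ∀ i, k ≤ i → ∀ a, P k a → P k (f i a)) : P k (loop f n a) := by
  have := loop_induct (f := f) (n := n) (fun i a => P (min i k) a) (by simpa using h0)
    fun i _ a ha => by
      by_cases hik : i < k
      · rw [min_eq_left hik.le] at ha
        rw [min_eq_left (show i + 1 ≤ k from hik)]
        exact hs i hik a ha
      · rw [min_eq_right (not_lt.1 hik)] at ha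
        rw [min_eq_right (by omega)]
        exact hskip i (not_lt.1 hik) a ha
  rwa [min_eq_right hk] at this

namespace Printer

open StateDesc

variable {inp : List ℕ} {n : ℕ} {σ : Equiv.Perm (Fin n)}

def writes : List Expr → Cmd
  | [] => .skip
  | e :: l => .seq (.write e) (writes l)

theorem eval_append_out (e : Expr) (h : Store) (l : List ℕ) :
    e.eval inp { h with out := l } = e.eval inp h := by
  induction e with
  | const => rfl
  | var => rfl
  | inp e ih => simp [Expr.eval, ih]
  | get A e ih => simp [Expr.eval, ih]
  | add a b iha ihb => simp [Expr.eval, iha, ihb]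
  | sub a b iha ihb => simp [Expr.eval, iha, ihb]
  | div a b iha ihb => simp [Expr.eval, iha, ihb]
  | mulInp a b iha ihb => simp [Expr.eval, iha, ihb]

theorem eval_writes (l : List Expr) (h : Store) :
    (writes l).eval inp h = { h with out := h.out ++ l.map fun e => e.eval inp h } := by
  induction l generalizing h with
  | nil => simp [writes, Cmd.eval]
  | cons e l ih => simp [writes, Cmd.eval, ih, eval_append_out]

@[simp] theorem setsVar_writes (x : ℕ) (l : List Expr) : (writes l).setsVar x = false := by
  induction l with
  | nil => rfl
  | cons e l ih => simpa [writes, Cmd.setsVar] using ih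

@[simp] theorem setsArr_writes (A : Fin 16) (l : List Expr) : (writes l).setsArr A = false := by
  induction l with
  | nil => rfl
  | cons e l ih => simpa [writes, Cmd.setsArr] using ih

def next (e : Expr) : Expr := .sub (.get 3 e) (.const 1)

/-- The successors in `σ` are stored in array `3`. -/
def Stores (σ : Equiv.Perm (Fin n)) (h : Store) : Prop := ∀ i : Fin n, h.arr 3 i = σ i + 1

theorem eval_next {h : Store} (hh : Stores σ h) {e : Expr} {u : Fin n} (he : e.eval inp h = u) :
    (next e).eval inp h = (σ u : ℕ) := by
  simp [next, Expr.eval, he, hh u]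

def block {m : ℕ} (q : Fin m → Expr) (A : (Fin m → Fin 2) → (Fin m → Fin 2) → Radical) : Cmd :=
  writes (.const 0 :: .const m :: (List.ofFn q ++ (encodeMatrix A).map .const))

theorem eval_block {m : ℕ} {q : Fin m → Expr} {v : Fin m → Fin n} (hv : Function.Injective v)
    (A : (Fin m → Fin 2) → (Fin m → Fin 2) → Radical) {h : Store}
    (hq : ∀ k, (q k).eval inp h = v k) :
    (block q A).eval inp h = { h with out := h.out ++ (blockOn v A).encode } := by
  rw [block, eval_writes, encode_blockOn hv]
  simp [Expr.eval, List.map_ofFn, Function.comp_def, hq]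

def pairStep : Cmd :=
  .ifLt (.var 2) (.var 8)
    (.seq (.write (.const 1)) (.seq (block ![.var 7, next (.var 7)] pairMatrix)
      (.set 7 (next (next (.var 7)))))) .skip

/-- Writes `var 8` pairs, starting at `var 7`. -/
def pairs : Cmd := .seq (.forN 2 pairStep) (writes (emptyCode.map .const))

theorem pairs_spec (hn : inp.getD 0 0 = n) {k : ℕ} (hk : k ≤ n) {u : Fin n}
    (hinj : Set.InjOn (fun p => σ^[p] u) (Set.Iio (2 * k))) {h : Store} (hh : Stores σ h)
    (h7 : h.var 7 = u) (h8 : h.var 8 = k) :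
    (pairs.eval inp h).out = h.out ++ (pairsDesc k fun p => σ^[p] u).encode := by
  have hloop := loop_induct_le (f := fun i g => pairStep.eval inp (g.setVar 2 i)) (a := h)
    (fun s g => Stores σ g ∧ g.var 8 = k ∧ g.var 7 = (σ^[2 * s] u : ℕ) ∧
      g.out = h.out ++ (List.range s).flatMap fun p =>
        1 :: (pairDesc (σ^[2 * p] u) (σ^[2 * p + 1] u)).encode) hk
    ⟨hh, h8, h7, by simp⟩ (by
      rintro s hs g ⟨g3, g8, g7, gout⟩
      have hne : σ^[2 * s] u ≠ σ^[2 * s + 1] u := fun heq => by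
        have := hinj (Set.mem_Iio.2 (by omega)) (Set.mem_Iio.2 (by omega)) heq
        omega
      have hb : ∀ g' : Store, Stores σ g' → g'.var 7 = (σ^[2 * s] u : ℕ) →
          (block ![.var 7, next (.var 7)] pairMatrix).eval inp g' =
          { g' with out := g'.out ++ (pairDesc (σ^[2 * s] u) (σ^[2 * s + 1] u)).encode } :=
        fun g' hg' h7' => eval_block (injective_pair hne) _ (by
          intro k
          fin_cases k
          · exact h7'
          · rw [Function.iterate_succ_apply']
            exact eval_next hg' h7')
      have he : pairStep.eval inp (g.setVar 2 s) =
          Store.setVar { g.setVar 2 s with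
            out := g.out ++ [1] ++ (pairDesc (σ^[2 * s] u) (σ^[2 * s + 1] u)).encode }
            7 (σ^[2 * (s + 1)] u : ℕ) := by
        simp only [pairStep, Cmd.eval, Expr.eval, Store.setVar_var]
        rw [if_pos (by simpa [g8] using hs),
          hb { g.setVar 2 s with out := (g.setVar 2 s).out ++ [1] } g3 g7]
        congr 1
        rw [show σ^[2 * (s + 1)] u = σ (σ (σ^[2 * s] u)) by
          rw [Nat.mul_add, Function.iterate_succ_apply', Function.iterate_succ_apply']]
        exact eval_next (inp := inp) (h := g) g3 (eval_next (e := .var 7) g3 g7)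
      rw [he]
      refine ⟨g3, g8, by simp, ?_⟩
      simp [gout, List.range_succ, List.flatMap_append])
    (by
      rintro i hi g ⟨g3, g8, g7, gout⟩
      have : pairStep.eval inp (g.setVar 2 i) = g.setVar 2 i := by
        simp [pairStep, Cmd.eval, Expr.eval, g8, hi]
      rw [this]
      exact ⟨g3, g8, g7, gout⟩)
  have he : pairs.eval inp h = (writes (emptyCode.map .const)).eval inp
      (loop (fun i g => pairStep.eval inp (g.setVar 2 i)) n h) := by
    rw [← hn]
    rfl
  rw [he, eval_writes, encode_pairsDesc]
  simp [hloop.2.2.2, Expr.eval, Function.comp_def]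

def headBlock : Cmd :=
  .ifLt (.var 4) (.const 2) (block ![.var 7] singleMatrix)
    (block ![.var 7, next (.var 7), next (next (.var 7))] tripleMatrix)

/-- Writes the rotation of the cycle of length `var 4` that starts with `var 6`. -/
def rotation : Cmd :=
  .seq (.set 7 (.var 6)) (.seq
    -- The test 2⌊m/2⌋ < m holds exactly for odd m.
    (.ifLt (.add (.div (.var 4) (.const 2)) (.div (.var 4) (.const 2))) (.var 4)
      (.seq (.write (.const 1)) (.seq headBlock (.seq (.set 7 (next (next (next (.var 7)))))
          (.set 8 (.div (.sub (.var 4) (.const 3)) (.const 2))))))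
      (.set 8 (.div (.var 4) (.const 2))))
    pairs)

theorem rotation_spec (hn : inp.getD 0 0 = n) {u : Fin n} {h : Store} (hh : Stores σ h)
    (h6 : h.var 6 = u) (h4 : h.var 4 = Function.minimalPeriod σ u) :
    (rotation.eval inp h).out = h.out ++
      (rotationDesc (Function.minimalPeriod σ u) fun p => σ^[p] u).encode := by
  set m := Function.minimalPeriod σ u with hm
  have hinj : Set.InjOn (fun p => σ^[p] u) (Set.Iio m) :=
    Function.iterate_injOn_Iio_minimalPeriod
  have hmn : m ≤ n := minimalPeriod_perm_le σ u
  have hpos : 0 < m := minimalPeriod_perm_pos σ u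
  by_cases hpar : m % 2 = 0
  · have he : rotation.eval inp h = pairs.eval inp ((h.setVar 7 u).setVar 8 (m / 2 : ℕ)) := by
      simp only [rotation, Cmd.eval, Expr.eval, h6]
      rw [if_neg (by simp [h4]; omega)]
      simp [h4]
    rw [rotationDesc, if_pos hpar, he]
    exact pairs_spec (h := (h.setVar 7 u).setVar 8 (m / 2 : ℕ)) hn (by omega)
      (hinj.mono (Set.Iio_subset_Iio (by omega))) hh (by simp) (by simp)
  · set d : StateDesc n :=
      if m = 1 then singleDesc u else tripleDesc u (σ^[1] u) (σ^[2] u) with hd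
    set g : Store := { h.setVar 7 u with out := h.out ++ [1] ++ d.encode } with hg
    have hb : ∀ g' : Store, Stores σ g' → g'.var 4 = m → g'.var 7 = u →
        headBlock.eval inp g' = { g' with out := g'.out ++ d.encode } := by
      intro g' hg' h4' h7'
      simp only [headBlock, Cmd.eval, Expr.eval, h4']
      split_ifs with hlt
      · have hm1 : m = 1 := by omega
        rw [hd, if_pos hm1]
        exact eval_block (Function.injective_of_subsingleton _) _ (by simpa [Expr.eval] using h7')
      · have hm1 : m ≠ 1 := by omega
        rw [hd, if_neg hm1]
        have hne : ∀ p q, p < 3 → q < 3 → p ≠ q → σ^[p] u ≠ σ^[q] u := fun p q hp hq hpq heq =>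
          hpq (hinj (Set.mem_Iio.2 (by omega)) (Set.mem_Iio.2 (by omega)) heq)
        refine eval_block (injective_triple (hne 0 1 (by omega) (by omega) (by omega))
          (hne 0 2 (by omega) (by omega) (by omega)) (hne 1 2 (by omega) (by omega) (by omega))) _ ?_
        intro k
        fin_cases k
        · exact h7'
        · exact eval_next hg' h7'
        · exact eval_next hg' (eval_next hg' h7')
    have he : rotation.eval inp h =
        pairs.eval inp ((g.setVar 7 (σ^[3] u : ℕ)).setVar 8 ((m - 3) / 2 : ℕ)) := by
      simp only [rotation, Cmd.eval, h6, Expr.eval]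
      rw [if_pos (by simp [h4]; omega)]
      have hg' : headBlock.eval inp { h.setVar 7 u with out := (h.setVar 7 u).out ++ [1] } = g :=
        hb { h.setVar 7 u with out := (h.setVar 7 u).out ++ [1] } hh h4 (by simp)
      have hu : (Expr.var 7).eval inp g = u := by simp [Expr.eval, hg]
      have h3 : (next (next (next (.var 7)))).eval inp g = (σ^[3] u : ℕ) :=
        eval_next (h := g) hh (eval_next (h := g) hh (eval_next (h := g) hh hu))
      rw [hg', h3]
      simp [hg, h4]
    have hshift : (fun p => σ^[p + 3] u) = fun p => σ^[p] (σ^[3] u) :=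
      funext fun p => Function.iterate_add_apply _ _ _ _
    rw [rotationDesc, if_neg hpar, he, encode, hshift]
    rw [pairs_spec (h := (g.setVar 7 (σ^[3] u : ℕ)).setVar 8 ((m - 3) / 2 : ℕ)) (σ := σ)
      (u := σ^[3] u) (k := (m - 3) / 2) hn (by omega) ?_ hh (by simp) (by simp)]
    · simp only [Store.setVar_out, hg, hd]
      simp
    · rw [← hshift]
      intro p hp q hq hpq
      have hp := Set.mem_Iio.1 hp
      have hq := Set.mem_Iio.1 hq
      have := hinj (Set.mem_Iio.2 (by omega)) (Set.mem_Iio.2 (by omega)) hpq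
      omega

end Printer

end EPR

/-! ### Finding and printing the cycles of the permutation. -/

namespace EPR

namespace Printer

open StateDesc

variable {inp : List ℕ} {n : ℕ} {σ : Equiv.Perm (Fin n)}

def walkStep : Cmd :=
  .seq (.set 6 (next (.var 6))) (.seq (.ifLt (.var 6) (.var 0) (.set 5 (.const 0)) .skip)
    (.ifLt (.var 4) (.const 1)
      (.ifLt (.var 6) (.var 0) .skip (.ifLt (.var 0) (.var 6) .skip
        (.set 4 (.add (.var 1) (.const 1))))) .skip))

theorem eval_walkStep {g : Store} {x : ℕ} (hx : (next (.var 6)).eval inp g = x) :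
    (walkStep.eval inp g).var 6 = x ∧
    (walkStep.eval inp g).var 5 = (if x < g.var 0 then 0 else g.var 5) ∧
    (walkStep.eval inp g).var 4 = if g.var 4 = 0 ∧ x = g.var 0 then g.var 1 + 1 else g.var 4 := by
  simp only [walkStep, Cmd.eval, Expr.eval, hx]
  by_cases h4 : g.var 4 = 0
  · rcases lt_trichotomy x (g.var 0) with h | h | h
    · simp [h4, h, h.ne]
    · simp [h4, h]
    · simp [h4, h, h.ne', h.not_gt]
  · have h4' : ¬ g.var 4 < 1 := by omega
    by_cases h : x < g.var 0 <;> simp [h4, h]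

/-- Variable `4` becomes the length of the cycle of `var 0`, and `5` becomes `0` if `var 0` is not
its smallest element. -/
def walk : Cmd :=
  .seq (.set 4 (.const 0)) (.seq (.set 5 (.const 1)) (.seq (.set 6 (.var 0)) (.forN 1 walkStep)))

/-- Since the period is at most n, n steps visit the whole cycle; variable `4` is assigned only
while it is 0, so it keeps the time of the first return. -/
theorem walk_spec (hn : inp.getD 0 0 = n) {u : Fin n} {h : Store} (hh : Stores σ h)
    (h0 : h.var 0 = u) : (walk.eval inp h).var 4 = Function.minimalPeriod σ u ∧
      ((walk.eval inp h).var 5 ≠ 0 ↔ ∀ k, u ≤ σ^[k] u) := by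
  set m := Function.minimalPeriod σ u with hm
  have hpos : 0 < m := minimalPeriod_perm_pos σ u
  have hmn : m ≤ n := minimalPeriod_perm_le σ u
  have hback : ∀ k, σ^[k] u = u ↔ m ∣ k := fun k =>
    Function.isPeriodicPt_iff_minimalPeriod_dvd
  set g := ((h.setVar 4 0).setVar 5 1).setVar 6 (h.var 0) with hg
  have he : walk.eval inp h = loop (fun i g => walkStep.eval inp (g.setVar 1 i)) n g := by
    rw [← hn]
    rfl
  obtain ⟨-, -, -, h4, h5⟩ := loop_induct (f := fun i g => walkStep.eval inp (g.setVar 1 i))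
    (n := n) (a := g)
    (fun k g => Stores σ g ∧ g.var 0 = u ∧ g.var 6 = (σ^[k] u : ℕ) ∧
      g.var 4 = (if m ≤ k then m else 0) ∧ (g.var 5 ≠ 0 ↔ ∀ q ≤ k, u ≤ σ^[q] u))
    ⟨hh, by simp [hg, h0], by simp [hg, h0], by simp [hg, hpos.ne'], by simp [hg]⟩ (by
      rintro k hk g ⟨g3, g0, g6, g4, g5⟩
      have hnext : (next (.var 6)).eval inp (g.setVar 1 k) = (σ^[k + 1] u : ℕ) := by
        rw [Function.iterate_succ_apply']
        exact eval_next (h := g.setVar 1 k) g3 g6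
      obtain ⟨e6, e5, e4⟩ := eval_walkStep hnext
      refine ⟨fun i => by rw [Cmd.eval_arr (by decide)]; exact g3 i,
        by rw [Cmd.eval_var (by decide)]; exact g0, e6, e4.trans ?_, ?_⟩
      · have hret : (σ^[k + 1] u : ℕ) = u ↔ m ∣ k + 1 := by rw [← hback, Fin.ext_iff]
        simp only [Store.setVar_var, show (4 : ℕ) = 1 ↔ False by decide,
          show (0 : ℕ) = 1 ↔ False by decide, if_false, if_true, g0, g4, hret]
        by_cases hmk : m ≤ k
        · simp [hmk, hpos.ne', hmk.trans (Nat.le_succ k)]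
        · by_cases hk1 : m = k + 1
          · simp [hk1]
          · have hnd : ¬ m ∣ k + 1 := fun h => by
              have := Nat.le_of_dvd k.succ_pos h
              omega
            have hmk1 : ¬ m ≤ k + 1 := by omega
            simp [hmk, hnd, hmk1]
      · have hle : (∀ q ≤ k + 1, u ≤ σ^[q] u) ↔ (∀ q ≤ k, u ≤ σ^[q] u) ∧ u ≤ σ^[k + 1] u :=
          ⟨fun h => ⟨fun q hq => h q (by omega), h _ le_rfl⟩, fun h q hq =>
            (Nat.le_succ_iff.1 hq).elim (h.1 q) fun e => e ▸ h.2⟩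
        rw [hle, ← g5, e5]
        simp only [Store.setVar_var, show (5 : ℕ) = 1 ↔ False by decide,
          show (0 : ℕ) = 1 ↔ False by decide, if_false, g0]
        by_cases hlt : (σ^[k + 1] u : ℕ) < u
        · have hlt' : ¬ u ≤ σ^[k + 1] u := not_le.2 hlt
          rw [if_pos hlt]
          tauto
        · have hlt' : u ≤ σ^[k + 1] u := not_lt.1 hlt
          rw [if_neg hlt]
          tauto)
  rw [he]
  refine ⟨by rw [h4, if_pos hmn], h5.trans ⟨fun h k => ?_, fun h q _ => h q⟩⟩
  rw [← Function.iterate_mod_minimalPeriod_eq]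
  exact h _ ((Nat.mod_lt _ hpos).le.trans hmn)

def mixStep : Cmd :=
  .ifLt (.var 1) (.var 4)
    (.seq (writes [.const 2, .const 0, .const 1, .sub (.var 4) (.var 1)])
      (.seq rotation (.set 6 (next (.var 6))))) .skip

/-- Writes the cycle of `var 0`, which has length `var 4`. -/
def cycle : Cmd :=
  .seq (.set 6 (.var 0)) (.seq (.forN 1 mixStep) (.seq (.set 6 (.var 0)) rotation))

theorem rotation_setsVar {x : ℕ} (h2 : x ≠ 2) (h7 : x ≠ 7) (h8 : x ≠ 8) :
    rotation.setsVar x = false := by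
  simp [rotation, pairs, pairStep, headBlock, block, Cmd.setsVar, h2, h7, h8]

theorem rotation_setsArr (A : Fin 16) : rotation.setsArr A = false := by
  simp [rotation, pairs, pairStep, headBlock, block, Cmd.setsArr]

/-- The rotation by k is the orbit of the k-th iterate of u, which has the same period, so one
printing routine serves all rotations; the last call prints the filler of `mixDesc`. -/
theorem cycle_spec (hn : inp.getD 0 0 = n) {u : Fin n} {h : Store} (hh : Stores σ h)
    (h0 : h.var 0 = u) (h4 : h.var 4 = Function.minimalPeriod σ u) :
    (cycle.eval inp h).out = h.out ++ (orbitDesc σ u).encode := by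
  set m := Function.minimalPeriod σ u with hm
  have hper : ∀ k, Function.minimalPeriod σ (σ^[k] u) = m := fun k =>
    Function.minimalPeriod_apply_iterate (σ.injective.mem_periodicPts u) k
  obtain ⟨g3, g0, g4, -, gout⟩ := loop_induct_le
    (f := fun i g => mixStep.eval inp (g.setVar 1 i)) (a := h.setVar 6 u)
    (fun k g => Stores σ g ∧ g.var 0 = u ∧ g.var 4 = m ∧ g.var 6 = (σ^[k] u : ℕ) ∧
      g.out = h.out ++ (List.range k).flatMap fun p =>
        2 :: 0 :: 1 :: (m - p) :: (rotationDesc m fun q => σ^[p + q] u).encode)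
    (minimalPeriod_perm_le σ u) ⟨hh, by simp [h0], by simp [h4], by simp, by simp⟩ (by
      rintro k hk g ⟨g3, g0, g4, g6, gout⟩
      set g' : Store := { g.setVar 1 k with out := g.out ++ [2, 0, 1, m - k] } with hg'
      have he : mixStep.eval inp (g.setVar 1 k) =
          (rotation.eval inp g').setVar 6 ((next (.var 6)).eval inp (rotation.eval inp g')) := by
        simp only [mixStep, Cmd.eval, eval_writes]
        rw [if_pos (by simpa [Expr.eval, g4] using hk)]
        simp [hg', Expr.eval, g4]
      have hS : Stores σ (rotation.eval inp g') := fun i => by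
        rw [Cmd.eval_arr (rotation_setsArr 3)]
        exact g3 i
      have hv : ∀ x, x ≠ 2 → x ≠ 7 → x ≠ 8 → (rotation.eval inp g').var x = g'.var x :=
        fun x h2 h7 h8 => Cmd.eval_var (rotation_setsVar h2 h7 h8) _
      have hout := rotation_spec hn (σ := σ) (u := σ^[k] u) (h := g') g3 (by simpa [hg'] using g6)
        (by rw [hper]; simpa [hg'] using g4)
      have hshift : (fun p => σ^[p] (σ^[k] u)) = fun p => σ^[k + p] u := funext fun p => by
        rw [add_comm, Function.iterate_add_apply]
      rw [hper, hshift] at hout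
      rw [he]
      refine ⟨hS, ?_, ?_, ?_, ?_⟩
      · rw [Store.setVar_var, if_neg (by decide), hv 0 (by decide) (by decide) (by decide)]
        exact g0
      · rw [Store.setVar_var, if_neg (by decide), hv 4 (by decide) (by decide) (by decide)]
        exact g4
      · rw [Function.iterate_succ_apply']
        simpa using eval_next (inp := inp) (e := .var 6) (u := σ^[k] u) hS
          ((hv 6 (by decide) (by decide) (by decide)).trans g6)
      · rw [Store.setVar_out, hout, List.range_succ, List.flatMap_append]
        simp [hg', gout])
    (by
      rintro i hi g ⟨g3, g0, g4, g6, gout⟩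
      have : mixStep.eval inp (g.setVar 1 i) = g.setVar 1 i := by
        simp [mixStep, Cmd.eval, Expr.eval, g4, not_lt.2 hi, hm]
      rw [this]
      exact ⟨g3, g0, g4, g6, gout⟩)
  set g := loop (fun i g => mixStep.eval inp (g.setVar 1 i)) n (h.setVar 6 u) with hg
  have he : cycle.eval inp h = rotation.eval inp (g.setVar 6 u) := by
    rw [← g0, hg, ← h0]
    subst hn
    rfl
  rw [he, rotation_spec hn (σ := σ) (u := u) (h := g.setVar 6 u) g3 (by simp) g4, orbitDesc, cycleDesc,
    encode_mixDesc, Store.setVar_out, gout, List.append_assoc]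

def headStep : Cmd :=
  .seq walk (.ifLt (.const 0) (.var 5) (.seq (.write (.const 1)) cycle) .skip)

def print : Cmd := .seq (.forN 0 headStep) (writes (emptyCode.map .const))

open scoped Classical in
theorem headStep_spec (hn : inp.getD 0 0 = n) {u : Fin n} {h : Store} (hh : Stores σ h)
    (h0 : h.var 0 = u) : Stores σ (headStep.eval inp h) ∧ (headStep.eval inp h).out =
      h.out ++ if ∀ k, u ≤ σ^[k] u then 1 :: (orbitDesc σ u).encode else [] := by
  obtain ⟨h4, h5⟩ := walk_spec hn hh h0
  set g := walk.eval inp h with hg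
  have hS : Stores σ g := fun i => by rw [hg, Cmd.eval_arr (by decide)]; exact hh i
  have g0 : g.var 0 = u := by rw [hg, Cmd.eval_var (by decide), h0]
  have gout : g.out = h.out := Cmd.eval_out (by decide) _
  refine ⟨fun i => ?_, ?_⟩
  · rw [Cmd.eval_arr (by simp [headStep, walk, walkStep, cycle, mixStep, Cmd.setsArr,
      rotation_setsArr])]
    exact hh i
  · by_cases hu : ∀ k, u ≤ σ^[k] u
    · have he : headStep.eval inp h = cycle.eval inp { g with out := g.out ++ [1] } := by
        simp only [headStep, Cmd.eval]
        exact if_pos (Nat.pos_of_ne_zero (h5.2 hu))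
      rw [he, if_pos hu, cycle_spec hn (σ := σ) (u := u) (h := { g with out := g.out ++ [1] }) hS g0
        h4, gout]
      simp
    · have he : headStep.eval inp h = g := by
        simp only [headStep, Cmd.eval]
        exact if_neg (by simpa [Expr.eval] using mt h5.1 hu)
      rw [he, if_neg hu, gout]
      simp

theorem print_spec (hn : inp.getD 0 0 = n) {h : Store} (hh : Stores σ h) :
    (print.eval inp h).out = h.out ++ (permDesc σ).encode := by
  classical
  have hloop := loop_induct (f := fun i g => headStep.eval inp (g.setVar 0 i)) (n := n) (a := h)
    (fun k g => Stores σ g ∧ g.out = h.out ++ ((List.finRange n).take k).flatMap fun r =>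
      if ∀ k, r ≤ σ^[k] r then 1 :: (orbitDesc σ r).encode else [])
    ⟨hh, by simp⟩ (by
      rintro k hk g ⟨g3, gout⟩
      obtain ⟨h1, h2⟩ := headStep_spec hn (σ := σ) (u := ⟨k, hk⟩) (h := g.setVar 0 k) g3 (by simp)
      refine ⟨h1, h2.trans ?_⟩
      rw [List.take_add_one, List.flatMap_append, Store.setVar_out, gout, List.append_assoc]
      simp [hk])
  have he : print.eval inp h = (writes (emptyCode.map .const)).eval inp
      (loop (fun i g => headStep.eval inp (g.setVar 0 i)) n h) := by
    rw [← hn]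
    rfl
  rw [he, eval_writes, encode_permDesc]
  simp only [hloop.2, List.map_map, Function.comp_def, Expr.eval, List.map_id']
  rw [List.take_of_length_le (by simp), List.append_assoc]

end Printer

/-! ## The algorithm -/

theorem hasPolyTimeApprox_ratio : HasPolyTimeApprox ratio := by
  obtain ⟨p, hp⟩ :=
    (Cmd.seq Costs.setup (.seq Hungarian.solve Printer.print)).outputsWithin
  refine ⟨(Cmd.seq Costs.setup (.seq Hungarian.solve Printer.print)).compile 0, p, fun I => ?_⟩
  obtain ⟨σ, hσ, hle⟩ := Hungarian.setup_solve_spec I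
  obtain ⟨hgood, hqubits, -⟩ := StateDesc.permDesc_spec σ
  refine ⟨StateDesc.permDesc σ, _, ?_, StateDesc.describes_of_tame hgood.toTame hqubits, hle⟩
  have h := hp I.encode I.le_bitLength_encode
  have hout : (Hungarian.solve.eval I.encode (Costs.setup.eval I.encode Store.empty)).out = [] := by
    rw [Cmd.eval_out (by decide), Cmd.eval_out (by decide)]
    rfl
  simp only [Cmd.eval] at h
  rwa [Printer.print_spec I.encode_head hσ, hout] at h

theorem ratio_le_alphaStar : ratio ≤ alphaStar := by
  obtain ⟨h1, h2⟩ := ratio_bounds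
  exact le_csSup ⟨1, fun α hα => hα.1.2⟩ ⟨⟨by linarith, by linarith⟩, hasPolyTimeApprox_ratio⟩

end EPR

theorem theorem1 :
    EPR.HasPolyTimeApprox ((1 + Real.sqrt 5) / 4) ∧
      (1 + Real.sqrt 5) / 4 ≤ EPR.alphaStar :=
  ⟨EPR.hasPolyTimeApprox_ratio, EPR.ratio_le_alphaStar⟩
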